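/- Let $0<p<\tfrac12$, $q=1-p$, $I=[0,1]$. Put $r_1=r_3=\frac{p}{1+p}$, $r_2=\frac{q}{1+p}$, $m_1=m_3=\frac{q}{1+q}$, $m_2=\frac{p}{1+q}$, $C_0=1+\frac{2}{pq}$, and $F_j(x)=r_jx+(1-r_j)p_j$ with $(p_1,p_2,p_3)=(0,\tfrac12,1)$. For a word $w=w_1\cdots w_n\in\{1,2,3\}^n$ put $F_w=F_{w_1}\circ\cdots\circ F_{w_n}$ and $m_w=m_{w_1}\cdots m_{w_n}$. Let $V_0=\{0,1\}$ and $V_{n+1}=\bigcup_jF_j(V_n)$. **Laplacians and measure.** For $f:V_n\to\mathbb R$ and $x\in V_n$ let $\Delta_nf(x)=f(x)-\sum_yP_n(x,y)f(y)$, where $P_n$ is the nearest-neighbour random walk on $V_n$ that leaves $x$ through a cell $F_w(I)$, $|w|=n$, having $x$ as an endpoint, chosen with probability proportional to $m_w$ (so the two probabilities are $p$ and $q$ at $x\in V_n\setminus V_0$, and the walk is reflected at $0$ and $1$). Let $\mu$ be the self-similar Borel probability measure on $I$, $\mu=\sum_jm_j\,\mu\circ F_j^{-1}$. For continuous $f,u$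 on $I$ write $\Delta_\mu f=u$ if $\max_{x\in V_n\setminus V_0}|C_0^n\Delta_nf(x)-u(x)|\to0$. Let $g$ be the Green's function of $\Delta_\mu$: the nonnegative continuous function on $I\times I$ such that for every continuous $u$ the problem $\Delta_\mu f=u$, $f(0)=f(1)=0$ has exactly the solution $f(x)=\int_Ig(x,y)u(y)\,d\mu(y)$. Put $\|g\|_\infty=\sup_{I\times I}g$. **Eigenfunctions.** Let $\lambda_{n,0}<\lambda_{n,1}<\dots<\lambda_{n,3^n}$ be the eigenvalues of $\Delta_n$ on $V_n$. Let $k,n_0\ge0$ with $k\le3^{n_0}$, let $f_{n_0,k}$ be an eigenfunction of $\Delta_{n_0}$ with eigenvalue $\lambda_{n_0,k}$, and for $n\ge n_0$ let $f_{n+1,k}$ be the extension of $f_{n,k}$ from $V_n$ to $V_{n+1}$ given, with $z=\lambda_{n+1,k}$, on consecutive vertices $x_0<y_0<y_1<x_1$ of $V_{n+1}$ with $x_0,x_1\in V_n$ and $y_0,y_1\notin V_n$, by $$f_{n+1,k}(y_0)=\frac{q(1-z)f_{n,k}(x_0)+pq\,f_{n,k}(x_1)}{(1-p-z)(1+p-z)},\qquad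 f_{n+1,k}(y_1)=\frac{q(1-z)f_{n,k}(x_1)+pq\,f_{n,k}(x_0)}{(1-p-z)(1+p-z)}.$$ Write $f_{n,k}$ also for the harmonic extension to $I$, i.e. the continuous function on $I$ with the given values on $V_n$ that minimizes the energy $\mathcal E(f)=\lim_n\mathcal E_n(f)$, where $\mathcal E_0(f)=(f(1)-f(0))^2$ and $\mathcal E_{n+1}(f)=\sum_jr_j^{-1}\mathcal E_n(f\circ F_j)$. Let $\|\cdot\|_\infty$ and $\|\cdot\|_{n,\infty}$ be the sup norms on $I$ and on $V_n$. **Theorem.** The measure $\mu$, the Green's function $g$ and the harmonic extensions $f_{n,k}$ exist, the limit $\lambda_k=\lim_{n\to\infty}C_0^n\lambda_{n,k}$ exists, the functions $f_{n,k}$ converge uniformly on $I$ to a continuous function $f_k$ as $n\to\infty$, and for every $n\ge n_0$ $$\|f_k-f_{n,k}\|_\infty\le C_0^{-n}\,\lambda_k\,\|f_{n,k}\|_{n,\infty}\,\|g\|_\infty\exp\!\left(\frac{\lambda_{n,k}}{q-\lambda_{n+1,k}}\cdot\frac{p}{2-p}\right).$$ -/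

import Mathlib

open Filter Topology MeasureTheory

noncomputable section

namespace FractalInterval

/-- Resistance weights `r₁ = r₃ = p / (1 + p)`, `r₂ = q / (1 + p)`, with `q = 1 - p`
(indices shifted to `0, 1, 2`). -/
def resistance (p : ℝ) : Fin 3 → ℝ := ![p / (1 + p), (1 - p) / (1 + p), p / (1 + p)]

/-- Measure weights `m₁ = m₃ = q / (1 + q)`, `m₂ = p / (1 + q)`, with `q = 1 - p`. -/
def massWeight (p : ℝ) : Fin 3 → ℝ :=
  ![(1 - p) / (1 + (1 - p)), p / (1 + (1 - p)), (1 - p) / (1 + (1 - p))]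

/-- The fixed points `0, 1/2, 1` of the three contractions. -/
def fixedPt : Fin 3 → ℝ := ![0, 1 / 2, 1]

/-- The contractions `F_j(x) = r_j x + (1 - r_j) p_j`. -/
def contraction (p : ℝ) (j : Fin 3) (x : ℝ) : ℝ :=
  resistance p j * x + (1 - resistance p j) * fixedPt j

/-- `F_w = F_{w₁} ∘ ⋯ ∘ F_{w_n}` for a word `w` of length `n`. The level-`n` cells are the
intervals `F_w([0,1])`. -/
def cellMap (p : ℝ) : {n : ℕ} → (Fin n → Fin 3) → ℝ → ℝ
  | 0, _, x => x
  | _ + 1, w, x => contraction p (w 0) (cellMap p (Fin.tail w) x)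

/-- `m_w = m_{w₁} ⋯ m_{w_n}`. -/
def cellMass (p : ℝ) {n : ℕ} (w : Fin n → Fin 3) : ℝ := ∏ i, massWeight p (w i)

/-- The discrete approximations: `V₀ = {0, 1}` and `V_{n+1} = ⋃_j F_j(V_n)`. -/
def vertices (p : ℝ) : ℕ → Set ℝ
  | 0 => {0, 1}
  | n + 1 => ⋃ j : Fin 3, contraction p j '' vertices p n

/-- The discrete energy form `E_n`. -/
def discreteEnergy (p : ℝ) : ℕ → (ℝ → ℝ) → ℝ
  | 0, f => (f 1 - f 0) ^ 2
  | n + 1, f => ∑ j : Fin 3, (resistance p j)⁻¹ * discreteEnergy p n (f ∘ contraction p j)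

/-- The energy form `E(f) = lim E_n(f)`, with values in `[0, ∞]`; the sequence `E_n(f)` is
nondecreasing, so the limit is the supremum. -/
def energy (p : ℝ) (f : ℝ → ℝ) : ENNReal := ⨆ n, ENNReal.ofReal (discreteEnergy p n f)

/-- `h` is a harmonic extension to `[0, 1]` of the values of `f` on `V_n`: it minimizes the
energy among all continuous functions on `[0, 1]` with these values. -/
def IsHarmonicExtension (p : ℝ) (n : ℕ) (f h : ℝ → ℝ) : Prop :=
  ContinuousOn h (Set.Icc 0 1) ∧ (∀ x ∈ vertices p n, h x = f x) ∧
    ∀ h' : ℝ → ℝ, ContinuousOn h' (Set.Icc 0 1) → (∀ x ∈ vertices p n, h' x = f x) →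
      energy p h ≤ energy p h'

open Classical in
/-- The discrete Laplacian `Δ_n` on `V_n`, i.e. `Δ_n f(x) = f(x) - ∑_y P(x, y) f(y)` for the
nearest neighbour random walk which leaves `x` through a level-`n` cell having `x` as an endpoint,
the cell being chosen with probability proportional to its mass. At an interior vertex the two
probabilities are `p` and `q`; at `0` and `1` there is only one such cell (reflection). -/
def discreteLaplacian (p : ℝ) (n : ℕ) (f : ℝ → ℝ) (x : ℝ) : ℝ :=
  (∑ w : Fin n → Fin 3, cellMass p w *
      ((if cellMap p w 0 = x then f x - f (cellMap p w 1) else 0) +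
        (if cellMap p w 1 = x then f x - f (cellMap p w 0) else 0))) /
    ∑ w : Fin n → Fin 3, cellMass p w *
      ((if cellMap p w 0 = x then 1 else 0) + (if cellMap p w 1 = x then 1 else 0))

/-- `f` restricted to `V_n` is an eigenfunction of `Δ_n` with eigenvalue `l`. -/
def IsEigenfunction (p : ℝ) (n : ℕ) (l : ℝ) (f : ℝ → ℝ) : Prop :=
  (∃ x ∈ vertices p n, f x ≠ 0) ∧
    ∀ x ∈ vertices p n, discreteLaplacian p n f x = l * f x

/-- The set of eigenvalues of `Δ_n` on `V_n`. -/
def eigenvalues (p : ℝ) (n : ℕ) : Set ℝ := {l | ∃ f : ℝ → ℝ, IsEigenfunction p n l f}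

/-- `λ_{n,k}`: the `(k+1)`-th lowest eigenvalue of `Δ_n` (meaningful for `0 ≤ k ≤ 3 ^ n`; the
spectrum of `Δ_n` is simple and has `3 ^ n + 1` elements). -/
def eigenvalue (p : ℝ) (n k : ℕ) : ℝ :=
  sInf {l | l ∈ eigenvalues p n ∧ k ≤ {l' | l' ∈ eigenvalues p n ∧ l' < l}.ncard}

/-- The renormalization factor `C₀ = 1 + 2 / (p q)`. -/
def renorm (p : ℝ) : ℝ := 1 + 2 / (p * (1 - p))

/-- The sequence `f_{n,k} : V_n → ℝ`, `n ≥ n₀`: `f_{n₀,k}` is an eigenfunction of `Δ_{n₀}` with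
eigenvalue `λ_{n₀,k}`, and `f_{n+1,k}` is the extension of `f_{n,k}` to `V_{n+1}` by the spectral
decimation formulas with `z = λ_{n+1,k}`. In the cell `F_w([0,1])` the four consecutive vertices
of `V_{n+1}` are `F_w(0) < F_w(F₁(1)) < F_w(F₃(0)) < F_w(1)`. -/
structure IsEigenfunctionSequence (p : ℝ) (k n₀ : ℕ) (f : ℕ → ℝ → ℝ) : Prop where
  base : IsEigenfunction p n₀ (eigenvalue p n₀ k) (f n₀)
  extends_prev : ∀ n, n₀ ≤ n → ∀ x ∈ vertices p n, f (n + 1) x = f n x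
  left_point : ∀ n, n₀ ≤ n → ∀ w : Fin n → Fin 3,
    f (n + 1) (cellMap p w (contraction p 0 1)) =
      ((1 - p) * (1 - eigenvalue p (n + 1) k) * f n (cellMap p w 0)
          + p * (1 - p) * f n (cellMap p w 1)) /
        ((1 - p - eigenvalue p (n + 1) k) * (1 + p - eigenvalue p (n + 1) k))
  right_point : ∀ n, n₀ ≤ n → ∀ w : Fin n → Fin 3,
    f (n + 1) (cellMap p w (contraction p 2 0)) =
      ((1 - p) * (1 - eigenvalue p (n + 1) k) * f n (cellMap p w 1)
          + p * (1 - p) * f n (cellMap p w 0)) /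
        ((1 - p - eigenvalue p (n + 1) k) * (1 + p - eigenvalue p (n + 1) k))

/-- `μ` is the self-similar Borel probability measure on `[0, 1]` with weights `m₁, m₂, m₃`. -/
def IsSelfSimilarMeasure (p : ℝ) (μ : Measure ℝ) : Prop :=
  IsProbabilityMeasure μ ∧ μ (Set.Icc 0 1)ᶜ = 0 ∧
    μ = ∑ j : Fin 3, ENNReal.ofReal (massWeight p j) • μ.map (contraction p j)

/-- `f` is in the domain of the Laplacian `Δ_μ = lim C₀ⁿ Δ_n` and `Δ_μ f = u` on `[0, 1]`:
both functions are continuous, and `C₀ⁿ Δ_n f` converges to `u` uniformly on interior vertices. -/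
def HasLaplacian (p : ℝ) (f u : ℝ → ℝ) : Prop :=
  ContinuousOn f (Set.Icc 0 1) ∧ ContinuousOn u (Set.Icc 0 1) ∧
    ∀ ε > 0, ∀ᶠ n in atTop, ∀ x ∈ vertices p n \ vertices p 0,
      |renorm p ^ n * discreteLaplacian p n f x - u x| < ε

/-- `g` is the Green's function of `Δ_μ`: a nonnegative continuous function on `[0, 1] × [0, 1]`
which is the integral kernel of the inverse of `Δ_μ` with zero boundary values, that is, for every
continuous `u` the problem `Δ_μ f = u`, `f(0) = f(1) = 0` has exactly the solution
`f(x) = ∫ g(x, y) u(y) dμ(y)`. -/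
def IsGreenFunction (p : ℝ) (μ : Measure ℝ) (g : ℝ → ℝ → ℝ) : Prop :=
  ContinuousOn (Function.uncurry g) (Set.Icc 0 1 ×ˢ Set.Icc 0 1) ∧
    (∀ x ∈ Set.Icc (0 : ℝ) 1, ∀ y ∈ Set.Icc (0 : ℝ) 1, 0 ≤ g x y) ∧
    ∀ u : ℝ → ℝ, ContinuousOn u (Set.Icc 0 1) → ∀ f : ℝ → ℝ,
      (HasLaplacian p f u ∧ f 0 = 0 ∧ f 1 = 0) ↔
        ∀ x ∈ Set.Icc (0 : ℝ) 1, f x = ∫ y in Set.Icc (0 : ℝ) 1, g x y * u y ∂μ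

/-- `sup {|f(x)| : x ∈ s}`. -/
def supNormOn (s : Set ℝ) (f : ℝ → ℝ) : ℝ := sSup ((fun x => |f x|) '' s)

/-- `sup {g(x, y) : x, y ∈ [0, 1]}`. -/
def greenSup (g : ℝ → ℝ → ℝ) : ℝ :=
  sSup (Function.uncurry g '' (Set.Icc 0 1 ×ˢ Set.Icc 0 1))

end FractalInterval

end

noncomputable section

namespace FractalInterval

variable {p : ℝ} {μ : Measure ℝ}

/-! ### The contractions and their inverses -/

/-! The ratios `r_j` are both lengths and resistances, and they sum to 1. Hence an affine function
of slope `c` has energy `c²` at every level, affine functions are harmonic at interior vertices, and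
piecewise linear interpolation is a harmonic extension. The masses are matched to the lengths: `m_j
r_j = 1/C₀` for every `j` (`massWeight_mul_resistance`), so a single factor `C₀` renormalizes the
Laplacian on all cells. This makes `2 (min x y - x y)` a Green's function for every `p`: the
function `2 C₀ⁿ Δ_n (min · y)(x)` of `y` is a probability density for `μ` concentrated near `x`, so
`C₀ⁿ Δ_n` recovers `u` from its potential (`hasLaplacian_greenPotential`). Uniqueness comes from a
minimum principle.

For the eigenfunctions, eliminating the vertices of `V_{n+1} \ V_n` turns the eigenvalue equation
with eigenvalue `z` into the level-`n` equation with eigenvalue `R(z) = z (1+p-z)(2-p-z)/(pq)`. The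
eigenvalue `λ_{n+1,k}` is the lowest preimage of `λ_{n,k}` (`eigenvalue_succ`). Since `R'(0) = C₀`
and `λ_{n+1,k} ≤ (p/2) λ_{n,k}`, the numbers `C₀ⁿ λ_{n,k}` converge. One extension step with
parameter `z` multiplies the sup norm by at most `q/(q-z)` and differs from linear interpolation by
`O(z)`. Thus the extensions converge geometrically, and because `∑_{i≥1} (p/2)^i = p/(2-p)`, the
product of the growth factors beyond level `n` is at most the exponential in the theorem
(`IsEigenfunctionSequence.abs_le`).

The estimate itself is local. On a cell `F_w(I)` of level `n`, the error `e = (f_k - f_{n,k}) ∘ F_w`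
vanishes at `0` and `1`. The affine part has zero Laplacian, and `Δ_m (f_k ∘ F_w) = λ_{m+n,k} f_k ∘
F_w` at interior vertices, so `Δ_μ e = C₀⁻ⁿ λ_k f_k ∘ F_w` (`hasLaplacian_cell`). Representing `e`
by the Green's function and using `μ(I) = 1` gives `|e| ≤ C₀⁻ⁿ λ_k ‖g‖ sup |f_k|`, and the growth
bound controls `sup |f_k|` by the norm of `f_{n,k}` on `V_n`. -/

theorem contraction_zero (p x : ℝ) : contraction p 0 x = p / (1 + p) * x := by
  simp [contraction, resistance, fixedPt]

theorem contraction_one (hp₀ : 0 < p) (x : ℝ) :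
    contraction p 1 x = (1 - p) / (1 + p) * x + p / (1 + p) := by
  have : (1 + p) ≠ 0 := by positivity
  simp [contraction, resistance, fixedPt]
  field_simp
  ring

theorem contraction_two (hp₀ : 0 < p) (x : ℝ) :
    contraction p 2 x = p / (1 + p) * x + 1 / (1 + p) := by
  have : (1 + p) ≠ 0 := by positivity
  simp [contraction, resistance, fixedPt]
  field_simp
  ring

theorem resistance_pos (hp₀ : 0 < p) (hp₁ : p < 1 / 2) (j : Fin 3) : 0 < resistance p j := by
  have h1 : 0 < 1 - p := by linarith
  fin_cases j <;> simp [resistance] <;> positivity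

theorem massWeight_pos (hp₀ : 0 < p) (hp₁ : p < 1 / 2) (j : Fin 3) : 0 < massWeight p j := by
  have h1 : 0 < 1 - p := by linarith
  fin_cases j <;> simp [massWeight] <;> positivity

theorem contraction_affine (p : ℝ) (j : Fin 3) (x : ℝ) :
    contraction p j x = resistance p j * x + contraction p j 0 := by
  simp [contraction]

theorem continuous_contraction (p : ℝ) (j : Fin 3) : Continuous (contraction p j) := by
  unfold contraction; fun_prop

theorem strictMono_contraction (hp₀ : 0 < p) (hp₁ : p < 1 / 2) (j : Fin 3) :
    StrictMono (contraction p j) := by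
  intro x y hxy
  have := resistance_pos hp₀ hp₁ j
  rw [contraction_affine, contraction_affine p j y]
  nlinarith

/-- The inverse of `contraction p j`. -/
def contractionInv (p : ℝ) (j : Fin 3) (x : ℝ) : ℝ :=
  (x - contraction p j 0) / resistance p j

theorem contractionInv_contraction (hp₀ : 0 < p) (hp₁ : p < 1 / 2) (j : Fin 3) (x : ℝ) :
    contractionInv p j (contraction p j x) = x := by
  have := (resistance_pos hp₀ hp₁ j).ne'
  rw [contractionInv, contraction_affine]
  field_simp
  ring

theorem contraction_contractionInv (hp₀ : 0 < p) (hp₁ : p < 1 / 2) (j : Fin 3) (x : ℝ) :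
    contraction p j (contractionInv p j x) = x := by
  have := (resistance_pos hp₀ hp₁ j).ne'
  rw [contractionInv, contraction_affine]
  field_simp
  ring

theorem contractionInv_le_iff (hp₀ : 0 < p) (hp₁ : p < 1 / 2) (j : Fin 3) (x y : ℝ) :
    contractionInv p j x ≤ y ↔ x ≤ contraction p j y := by
  rw [← (strictMono_contraction hp₀ hp₁ j).le_iff_le, contraction_contractionInv hp₀ hp₁]

theorem le_contractionInv_iff (hp₀ : 0 < p) (hp₁ : p < 1 / 2) (j : Fin 3) (x y : ℝ) :
    y ≤ contractionInv p j x ↔ contraction p j y ≤ x := by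
  rw [← (strictMono_contraction hp₀ hp₁ j).le_iff_le, contraction_contractionInv hp₀ hp₁]

theorem contractionInv_lt_iff (hp₀ : 0 < p) (hp₁ : p < 1 / 2) (j : Fin 3) (x y : ℝ) :
    contractionInv p j x < y ↔ x < contraction p j y := by
  rw [← (strictMono_contraction hp₀ hp₁ j).lt_iff_lt, contraction_contractionInv hp₀ hp₁]

theorem lt_contractionInv_iff (hp₀ : 0 < p) (hp₁ : p < 1 / 2) (j : Fin 3) (x y : ℝ) :
    y < contractionInv p j x ↔ contraction p j y < x := by
  rw [← (strictMono_contraction hp₀ hp₁ j).lt_iff_lt, contraction_contractionInv hp₀ hp₁]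

theorem contraction_zero_zero (p : ℝ) : contraction p 0 0 = 0 := by simp [contraction_zero]

theorem contraction_two_one (hp₀ : 0 < p) : contraction p 2 1 = 1 := by
  have : (1 + p) ≠ 0 := by positivity
  rw [contraction_two hp₀]; field_simp; ring

theorem contraction_one_zero (hp₀ : 0 < p) : contraction p 1 0 = contraction p 0 1 := by
  rw [contraction_one hp₀, contraction_zero]; ring

theorem contraction_two_zero (hp₀ : 0 < p) : contraction p 2 0 = contraction p 1 1 := by
  have : (1 + p) ≠ 0 := by positivity
  rw [contraction_two hp₀, contraction_one hp₀]; field_simp; ring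

theorem contraction_order (hp₀ : 0 < p) (hp₁ : p < 1 / 2) :
    0 < contraction p 0 1 ∧ contraction p 0 1 < contraction p 1 1 ∧ contraction p 1 1 < 1 := by
  have h0 := strictMono_contraction hp₀ hp₁ 0 one_pos
  have h1 := strictMono_contraction hp₀ hp₁ 1 one_pos
  have h2 := strictMono_contraction hp₀ hp₁ 2 one_pos
  rw [contraction_zero_zero] at h0
  rw [contraction_one_zero hp₀] at h1
  rw [contraction_two_zero hp₀, contraction_two_one hp₀] at h2
  exact ⟨h0, h1, h2⟩

theorem contraction_mem_Icc (hp₀ : 0 < p) (hp₁ : p < 1 / 2) (j : Fin 3) {x : ℝ}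
    (hx : x ∈ Set.Icc (0 : ℝ) 1) : contraction p j x ∈ Set.Icc (0 : ℝ) 1 := by
  have hm := (strictMono_contraction hp₀ hp₁ j).monotone
  obtain ⟨a, b, c⟩ := contraction_order hp₀ hp₁
  have h0 := hm hx.1
  have h1 := hm hx.2
  have e := contraction_one_zero hp₀
  have e' := contraction_two_zero hp₀
  have e'' := contraction_two_one hp₀
  have e3 := contraction_zero_zero p
  constructor <;> fin_cases j <;> simp_all <;> linarith

theorem exists_contraction (hp₀ : 0 < p) (hp₁ : p < 1 / 2) {x : ℝ}
    (hx : x ∈ Set.Icc (0 : ℝ) 1) : ∃ j, ∃ y ∈ Set.Icc (0 : ℝ) 1, contraction p j y = x := by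
  have key : ∀ j, contraction p j 0 ≤ x → x ≤ contraction p j 1 →
      ∃ j, ∃ y ∈ Set.Icc (0 : ℝ) 1, contraction p j y = x := fun j h0 h1 =>
    ⟨j, contractionInv p j x, ⟨(le_contractionInv_iff hp₀ hp₁ _ _ _).2 h0,
      (contractionInv_le_iff hp₀ hp₁ _ _ _).2 h1⟩, contraction_contractionInv hp₀ hp₁ _ _⟩
  rcases le_total x (contraction p 0 1) with h | h
  · exact key 0 (by rw [contraction_zero_zero]; exact hx.1) h
  rcases le_total x (contraction p 1 1) with h' | h'
  · exact key 1 (by rwa [contraction_one_zero hp₀]) h'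
  · exact key 2 (by rwa [contraction_two_zero hp₀]) (by rw [contraction_two_one hp₀]; exact hx.2)

/-! ### Cells and vertices -/

theorem cellMap_cons (p : ℝ) {n : ℕ} (j : Fin 3) (w : Fin n → Fin 3) (x : ℝ) :
    cellMap p (Fin.cons j w : Fin (n + 1) → Fin 3) x = contraction p j (cellMap p w x) := by
  simp [cellMap]

theorem cellMass_cons (p : ℝ) {n : ℕ} (j : Fin 3) (w : Fin n → Fin 3) :
    cellMass p (Fin.cons j w : Fin (n + 1) → Fin 3) = massWeight p j * cellMass p w := by
  simp [cellMass, Fin.prod_univ_succ]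

theorem cellMap_mem_Icc (hp₀ : 0 < p) (hp₁ : p < 1 / 2) {n : ℕ} (w : Fin n → Fin 3) {x : ℝ}
    (hx : x ∈ Set.Icc (0 : ℝ) 1) : cellMap p w x ∈ Set.Icc (0 : ℝ) 1 := by
  induction n with
  | zero => simpa [cellMap] using hx
  | succ n ih => exact contraction_mem_Icc hp₀ hp₁ _ (ih _)

theorem strictMono_cellMap (hp₀ : 0 < p) (hp₁ : p < 1 / 2) {n : ℕ} (w : Fin n → Fin 3) :
    StrictMono (cellMap p w) := by
  induction n with
  | zero => exact strictMono_id
  | succ n ih => exact (strictMono_contraction hp₀ hp₁ _).comp (ih _)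

theorem cellMap_affine (p : ℝ) {n : ℕ} (w : Fin n → Fin 3) :
    ∃ c d, ∀ x, cellMap p w x = c * x + d := by
  induction n with
  | zero => exact ⟨1, 0, fun x => by simp [cellMap]⟩
  | succ n ih =>
    obtain ⟨c, d, h⟩ := ih (Fin.tail w)
    refine ⟨resistance p (w 0) * c, resistance p (w 0) * d + contraction p (w 0) 0, fun x => ?_⟩
    rw [cellMap, h, contraction_affine]; ring

theorem continuous_cellMap (p : ℝ) {n : ℕ} (w : Fin n → Fin 3) : Continuous (cellMap p w) := by
  obtain ⟨c, d, h⟩ := cellMap_affine p w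
  rw [funext h]; fun_prop

theorem exists_cellMap (hp₀ : 0 < p) (hp₁ : p < 1 / 2) (n : ℕ) {x : ℝ}
    (hx : x ∈ Set.Icc (0 : ℝ) 1) :
    ∃ w : Fin n → Fin 3, ∃ y ∈ Set.Icc (0 : ℝ) 1, cellMap p w y = x := by
  induction n generalizing x with
  | zero => exact ⟨Fin.elim0, x, hx, rfl⟩
  | succ n ih =>
    obtain ⟨j, y, hy, rfl⟩ := exists_contraction hp₀ hp₁ hx
    obtain ⟨w, z, hz, rfl⟩ := ih hy
    exact ⟨Fin.cons j w, z, hz, cellMap_cons _ _ _ _⟩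

theorem mem_vertices_iff {n : ℕ} {x : ℝ} :
    x ∈ vertices p n ↔ ∃ w : Fin n → Fin 3, x = cellMap p w 0 ∨ x = cellMap p w 1 := by
  induction n generalizing x with
  | zero => simp [vertices, cellMap]
  | succ n ih =>
    simp only [vertices, Set.mem_iUnion, Set.mem_image, ih]
    constructor
    · rintro ⟨j, y, ⟨w, h⟩, rfl⟩
      refine ⟨Fin.cons j w, ?_⟩
      rw [cellMap_cons, cellMap_cons]
      exact h.imp (fun h => by rw [h]) (fun h => by rw [h])
    · rintro ⟨w, h | h⟩
      · exact ⟨w 0, cellMap p (Fin.tail w) 0, ⟨_, Or.inl rfl⟩, h.symm⟩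
      · exact ⟨w 0, cellMap p (Fin.tail w) 1, ⟨_, Or.inr rfl⟩, h.symm⟩

theorem cellMap_zero_mem_vertices {n : ℕ} (w : Fin n → Fin 3) : cellMap p w 0 ∈ vertices p n :=
  mem_vertices_iff.2 ⟨w, Or.inl rfl⟩

theorem cellMap_one_mem_vertices {n : ℕ} (w : Fin n → Fin 3) : cellMap p w 1 ∈ vertices p n :=
  mem_vertices_iff.2 ⟨w, Or.inr rfl⟩

theorem finite_vertices (p : ℝ) (n : ℕ) : (vertices p n).Finite := by
  induction n with
  | zero => simp [vertices]
  | succ n ih => exact Set.finite_iUnion fun j => ih.image _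

theorem vertices_subset_Icc (hp₀ : 0 < p) (hp₁ : p < 1 / 2) (n : ℕ) :
    vertices p n ⊆ Set.Icc 0 1 := by
  intro x hx
  obtain ⟨w, rfl | rfl⟩ := mem_vertices_iff.1 hx <;> exact cellMap_mem_Icc hp₀ hp₁ w (by simp)

theorem contraction_mem_vertices {n : ℕ} (j : Fin 3) {x : ℝ} (hx : x ∈ vertices p n) :
    contraction p j x ∈ vertices p (n + 1) := by
  simp only [vertices, Set.mem_iUnion]
  exact ⟨j, x, hx, rfl⟩

theorem zero_mem_vertices (p : ℝ) (n : ℕ) : (0 : ℝ) ∈ vertices p n := by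
  induction n with
  | zero => simp [vertices]
  | succ n ih => simpa [contraction_zero_zero] using contraction_mem_vertices (0 : Fin 3) ih

theorem one_mem_vertices (hp₀ : 0 < p) (n : ℕ) : (1 : ℝ) ∈ vertices p n := by
  induction n with
  | zero => simp [vertices]
  | succ n ih => simpa [contraction_two_one hp₀] using contraction_mem_vertices (2 : Fin 3) ih

theorem vertices_subset_succ (hp₀ : 0 < p) (n : ℕ) : vertices p n ⊆ vertices p (n + 1) := by
  induction n with
  | zero =>
    rintro x (rfl | rfl)
    · exact zero_mem_vertices p 1
    · exact one_mem_vertices hp₀ 1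
  | succ n ih => exact Set.iUnion_mono fun j => Set.image_mono ih

theorem vertices_mono (hp₀ : 0 < p) : Monotone (vertices p) :=
  monotone_nat_of_le_succ (vertices_subset_succ hp₀)

theorem vertices_succ_cases (hp₀ : 0 < p) (hp₁ : p < 1 / 2) {n : ℕ} {x : ℝ}
    (hx : x ∈ vertices p (n + 1)) :
    x = 0 ∨ x = 1 ∨ x = contraction p 0 1 ∨ x = contraction p 1 1 ∨
      ∃ j, ∃ y ∈ vertices p n, y ∈ Set.Ioo (0 : ℝ) 1 ∧ x = contraction p j y := by
  simp only [vertices, Set.mem_iUnion] at hx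
  obtain ⟨j, y, hy, rfl⟩ := hx
  have hI := vertices_subset_Icc hp₀ hp₁ n hy
  rcases eq_or_lt_of_le hI.1 with rfl | h0
  · fin_cases j
    · simp [contraction_zero_zero]
    · simp [contraction_one_zero hp₀]
    · simp [contraction_two_zero hp₀]
  rcases eq_or_lt_of_le hI.2 with rfl | h1
  · fin_cases j
    · simp
    · simp
    · simp [contraction_two_one hp₀]
  · exact Or.inr (Or.inr (Or.inr (Or.inr ⟨j, y, hy, ⟨h0, h1⟩, rfl⟩)))

/-! ### The discrete Laplacian: recursion in the first letter -/

open Classical in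
/-- Numerator of the discrete Laplacian. -/
def lapNum (p : ℝ) (n : ℕ) (f : ℝ → ℝ) (x : ℝ) : ℝ :=
  ∑ w : Fin n → Fin 3, cellMass p w *
      ((if cellMap p w 0 = x then f x - f (cellMap p w 1) else 0) +
        (if cellMap p w 1 = x then f x - f (cellMap p w 0) else 0))

open Classical in
/-- Total mass of the cells with endpoint `x`. -/
def lapDen (p : ℝ) (n : ℕ) (x : ℝ) : ℝ :=
  ∑ w : Fin n → Fin 3, cellMass p w *
      ((if cellMap p w 0 = x then 1 else 0) + (if cellMap p w 1 = x then 1 else 0))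

theorem discreteLaplacian_eq (p : ℝ) (n : ℕ) (f : ℝ → ℝ) (x : ℝ) :
    discreteLaplacian p n f x = lapNum p n f x / lapDen p n x := rfl

theorem sum_word_succ {n : ℕ} (F : (Fin (n + 1) → Fin 3) → ℝ) :
    ∑ w, F w = ∑ j, ∑ w : Fin n → Fin 3, F (Fin.cons j w) := by
  rw [← (Fin.consEquiv (fun _ : Fin (n + 1) => Fin 3)).sum_comp, Fintype.sum_prod_type]
  rfl

theorem contraction_eq_iff (hp₀ : 0 < p) (hp₁ : p < 1 / 2) (j : Fin 3) (x y : ℝ) :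
    contraction p j y = x ↔ y = contractionInv p j x := by
  constructor
  · rintro rfl; rw [contractionInv_contraction hp₀ hp₁]
  · rintro rfl; rw [contraction_contractionInv hp₀ hp₁]

/-- Numerator and denominator are treated separately because each is additive over the three
first-level cells, while their quotient is not. Cells not containing `x` contribute zero, since the
preimage of `x` is then no vertex. -/
theorem lapNum_succ (hp₀ : 0 < p) (hp₁ : p < 1 / 2) (n : ℕ) (f : ℝ → ℝ) (x : ℝ) :
    lapNum p (n + 1) f x =
      ∑ j, massWeight p j * lapNum p n (f ∘ contraction p j) (contractionInv p j x) := by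
  simp only [lapNum, sum_word_succ, cellMap_cons, cellMass_cons, Finset.mul_sum,
    contraction_eq_iff hp₀ hp₁, Function.comp, contraction_contractionInv hp₀ hp₁, mul_assoc]

theorem lapDen_succ (hp₀ : 0 < p) (hp₁ : p < 1 / 2) (n : ℕ) (x : ℝ) :
    lapDen p (n + 1) x = ∑ j, massWeight p j * lapDen p n (contractionInv p j x) := by
  simp only [lapDen, sum_word_succ, cellMap_cons, cellMass_cons, Finset.mul_sum,
    contraction_eq_iff hp₀ hp₁, mul_assoc]

theorem lapNum_eq_zero {n : ℕ} (f : ℝ → ℝ) {x : ℝ} (hx : x ∉ vertices p n) :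
    lapNum p n f x = 0 := by
  refine Finset.sum_eq_zero fun w _ => ?_
  have h0 : cellMap p w 0 ≠ x := fun h => hx (h ▸ cellMap_zero_mem_vertices w)
  have h1 : cellMap p w 1 ≠ x := fun h => hx (h ▸ cellMap_one_mem_vertices w)
  simp [h0, h1]

theorem lapDen_eq_zero {n : ℕ} {x : ℝ} (hx : x ∉ vertices p n) : lapDen p n x = 0 := by
  refine Finset.sum_eq_zero fun w _ => ?_
  have h0 : cellMap p w 0 ≠ x := fun h => hx (h ▸ cellMap_zero_mem_vertices w)
  have h1 : cellMap p w 1 ≠ x := fun h => hx (h ▸ cellMap_one_mem_vertices w)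
  simp [h0, h1]

theorem not_mem_vertices_of_neg (hp₀ : 0 < p) (hp₁ : p < 1 / 2) {n : ℕ} {x : ℝ} (hx : x < 0) :
    x ∉ vertices p n := fun h => absurd (vertices_subset_Icc hp₀ hp₁ n h).1 (not_le.2 hx)

theorem not_mem_vertices_of_one_lt (hp₀ : 0 < p) (hp₁ : p < 1 / 2) {n : ℕ} {x : ℝ} (hx : 1 < x) :
    x ∉ vertices p n := fun h => absurd (vertices_subset_Icc hp₀ hp₁ n h).2 (not_le.2 hx)

section Reduction

variable {n : ℕ} {G : Fin 3 → ℝ → ℝ}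

/-- A sum over the three cells of terms supported on the vertices of these cells reduces to the
terms of the cells that contain the point. -/
theorem sum_cells_left (hp₀ : 0 < p) (hp₁ : p < 1 / 2) (hG : ∀ j x, x ∉ vertices p n → G j x = 0)
    {x : ℝ} (hx : x < contraction p 0 1) : ∑ j, G j (contractionInv p j x) =
      G 0 (contractionInv p 0 x) := by
  obtain ⟨_, h2, _⟩ := contraction_order hp₀ hp₁
  rw [Fin.sum_univ_three, hG 1, hG 2]
  · ring
  · refine not_mem_vertices_of_neg hp₀ hp₁ ((contractionInv_lt_iff hp₀ hp₁ _ _ _).2 ?_)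
    rw [contraction_two_zero hp₀]; linarith
  · refine not_mem_vertices_of_neg hp₀ hp₁ ((contractionInv_lt_iff hp₀ hp₁ _ _ _).2 ?_)
    rw [contraction_one_zero hp₀]; linarith

theorem sum_cells_right (hp₀ : 0 < p) (hp₁ : p < 1 / 2) (hG : ∀ j x, x ∉ vertices p n → G j x = 0)
    {x : ℝ} (hx : contraction p 1 1 < x) : ∑ j, G j (contractionInv p j x) =
      G 2 (contractionInv p 2 x) := by
  obtain ⟨_, h2, _⟩ := contraction_order hp₀ hp₁
  rw [Fin.sum_univ_three, hG 0, hG 1]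
  · ring
  · exact not_mem_vertices_of_one_lt hp₀ hp₁ ((lt_contractionInv_iff hp₀ hp₁ _ _ _).2 hx)
  · refine not_mem_vertices_of_one_lt hp₀ hp₁ ((lt_contractionInv_iff hp₀ hp₁ _ _ _).2 ?_)
    linarith

theorem sum_cells_mid (hp₀ : 0 < p) (hp₁ : p < 1 / 2) (hG : ∀ j x, x ∉ vertices p n → G j x = 0)
    {x : ℝ} (hx : contraction p 0 1 < x) (hx' : x < contraction p 1 1) :
    ∑ j, G j (contractionInv p j x) = G 1 (contractionInv p 1 x) := by
  rw [Fin.sum_univ_three, hG 0, hG 2]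
  · ring
  · refine not_mem_vertices_of_neg hp₀ hp₁ ((contractionInv_lt_iff hp₀ hp₁ _ _ _).2 ?_)
    rwa [contraction_two_zero hp₀]
  · exact not_mem_vertices_of_one_lt hp₀ hp₁ ((lt_contractionInv_iff hp₀ hp₁ _ _ _).2 hx)

theorem sum_cells_interior (hp₀ : 0 < p) (hp₁ : p < 1 / 2)
    (hG : ∀ j x, x ∉ vertices p n → G j x = 0) (j : Fin 3) {y : ℝ} (hy : y ∈ Set.Ioo (0 : ℝ) 1) :
    ∑ i, G i (contractionInv p i (contraction p j y)) = G j y := by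
  have h0 := strictMono_contraction hp₀ hp₁ j hy.1
  have h1 := strictMono_contraction hp₀ hp₁ j hy.2
  fin_cases j
  · refine (sum_cells_left hp₀ hp₁ hG h1).trans ?_
    simp [contractionInv_contraction hp₀ hp₁]
  · refine (sum_cells_mid hp₀ hp₁ hG (lt_of_eq_of_lt (contraction_one_zero hp₀).symm h0) h1).trans ?_
    simp [contractionInv_contraction hp₀ hp₁]
  · refine (sum_cells_right hp₀ hp₁ hG (lt_of_eq_of_lt (contraction_two_zero hp₀).symm h0)).trans ?_
    simp [contractionInv_contraction hp₀ hp₁]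

theorem sum_cells_junction_left (hp₀ : 0 < p) (hp₁ : p < 1 / 2)
    (hG : ∀ j x, x ∉ vertices p n → G j x = 0) :
    ∑ i, G i (contractionInv p i (contraction p 0 1)) = G 0 1 + G 1 0 := by
  obtain ⟨_, h2, _⟩ := contraction_order hp₀ hp₁
  rw [Fin.sum_univ_three, hG 2, contractionInv_contraction hp₀ hp₁, ← contraction_one_zero hp₀,
    contractionInv_contraction hp₀ hp₁, add_zero]
  refine not_mem_vertices_of_neg hp₀ hp₁ ((contractionInv_lt_iff hp₀ hp₁ _ _ _).2 ?_)
  rwa [contraction_two_zero hp₀]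

theorem sum_cells_junction_right (hp₀ : 0 < p) (hp₁ : p < 1 / 2)
    (hG : ∀ j x, x ∉ vertices p n → G j x = 0) :
    ∑ i, G i (contractionInv p i (contraction p 1 1)) = G 1 1 + G 2 0 := by
  obtain ⟨_, h2, _⟩ := contraction_order hp₀ hp₁
  rw [Fin.sum_univ_three, hG 0, contractionInv_contraction hp₀ hp₁, ← contraction_two_zero hp₀,
    contractionInv_contraction hp₀ hp₁, zero_add]
  exact not_mem_vertices_of_one_lt hp₀ hp₁ ((lt_contractionInv_iff hp₀ hp₁ _ _ _).2 h2)

end Reduction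

theorem lapNum_term_eq_zero (p : ℝ) (n : ℕ) (f : ℝ → ℝ) (j : Fin 3) (x : ℝ)
    (hx : x ∉ vertices p n) : massWeight p j * lapNum p n (f ∘ contraction p j) x = 0 := by
  rw [lapNum_eq_zero _ hx, mul_zero]

theorem lapDen_term_eq_zero (p : ℝ) (n : ℕ) (j : Fin 3) (x : ℝ) (hx : x ∉ vertices p n) :
    massWeight p j * lapDen p n x = 0 := by
  rw [lapDen_eq_zero hx, mul_zero]

theorem contractionInv_zero_zero (p : ℝ) : contractionInv p 0 0 = 0 := by
  simp [contractionInv, contraction_zero_zero]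

theorem contractionInv_two_one (hp₀ : 0 < p) (hp₁ : p < 1 / 2) : contractionInv p 2 1 = 1 := by
  conv_lhs => rw [← contraction_two_one hp₀]
  exact contractionInv_contraction hp₀ hp₁ _ _

theorem lapDen_left (hp₀ : 0 < p) (hp₁ : p < 1 / 2) (n : ℕ) :
    lapDen p n 0 = massWeight p 0 ^ n := by
  induction n with
  | zero => simp [lapDen, cellMap, cellMass]
  | succ n ih =>
    rw [lapDen_succ hp₀ hp₁, sum_cells_left hp₀ hp₁ (lapDen_term_eq_zero p n)
      (contraction_order hp₀ hp₁).1, contractionInv_zero_zero, ih, pow_succ']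

theorem massWeight_two (p : ℝ) : massWeight p 2 = massWeight p 0 := by simp [massWeight]

theorem resistance_two (p : ℝ) : resistance p 2 = resistance p 0 := by simp [resistance]

theorem lapDen_right (hp₀ : 0 < p) (hp₁ : p < 1 / 2) (n : ℕ) :
    lapDen p n 1 = massWeight p 0 ^ n := by
  induction n with
  | zero => simp [lapDen, cellMap, cellMass]
  | succ n ih =>
    rw [lapDen_succ hp₀ hp₁, sum_cells_right hp₀ hp₁ (lapDen_term_eq_zero p n)
      (contraction_order hp₀ hp₁).2.2, contractionInv_two_one hp₀ hp₁, ih, pow_succ',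
      massWeight_two]

theorem discreteLaplacian_zero_left (p : ℝ) (f : ℝ → ℝ) :
    discreteLaplacian p 0 f 0 = f 0 - f 1 := by
  simp [discreteLaplacian, cellMap, cellMass]

theorem discreteLaplacian_zero_right (p : ℝ) (f : ℝ → ℝ) :
    discreteLaplacian p 0 f 1 = f 1 - f 0 := by
  simp [discreteLaplacian, cellMap, cellMass]

theorem discreteLaplacian_succ_left (hp₀ : 0 < p) (hp₁ : p < 1 / 2) (n : ℕ) (f : ℝ → ℝ) :
    discreteLaplacian p (n + 1) f 0 = discreteLaplacian p n (f ∘ contraction p 0) 0 := by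
  rw [discreteLaplacian_eq, discreteLaplacian_eq, lapNum_succ hp₀ hp₁, lapDen_succ hp₀ hp₁,
    sum_cells_left hp₀ hp₁ (lapDen_term_eq_zero p n) (contraction_order hp₀ hp₁).1,
    sum_cells_left hp₀ hp₁ (lapNum_term_eq_zero p n f) (contraction_order hp₀ hp₁).1,
    contractionInv_zero_zero, mul_div_mul_left _ _ (massWeight_pos hp₀ hp₁ 0).ne']

theorem discreteLaplacian_succ_right (hp₀ : 0 < p) (hp₁ : p < 1 / 2) (n : ℕ) (f : ℝ → ℝ) :
    discreteLaplacian p (n + 1) f 1 = discreteLaplacian p n (f ∘ contraction p 2) 1 := by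
  rw [discreteLaplacian_eq, discreteLaplacian_eq, lapNum_succ hp₀ hp₁, lapDen_succ hp₀ hp₁,
    sum_cells_right hp₀ hp₁ (lapDen_term_eq_zero p n) (contraction_order hp₀ hp₁).2.2,
    sum_cells_right hp₀ hp₁ (lapNum_term_eq_zero p n f) (contraction_order hp₀ hp₁).2.2,
    contractionInv_two_one hp₀ hp₁, mul_div_mul_left _ _ (massWeight_pos hp₀ hp₁ 2).ne']

theorem discreteLaplacian_succ_interior (hp₀ : 0 < p) (hp₁ : p < 1 / 2) (n : ℕ) (f : ℝ → ℝ)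
    (j : Fin 3) {y : ℝ} (hy : y ∈ Set.Ioo (0 : ℝ) 1) :
    discreteLaplacian p (n + 1) f (contraction p j y) =
      discreteLaplacian p n (f ∘ contraction p j) y := by
  rw [discreteLaplacian_eq, discreteLaplacian_eq, lapNum_succ hp₀ hp₁, lapDen_succ hp₀ hp₁,
    sum_cells_interior hp₀ hp₁ (lapDen_term_eq_zero p n) j hy,
    sum_cells_interior hp₀ hp₁ (lapNum_term_eq_zero p n f) j hy,
    mul_div_mul_left _ _ (massWeight_pos hp₀ hp₁ j).ne']

/-- The two cells meeting at the junction have masses `m_0 M` and `m_1 M` with the same `M = m_0ⁿ`,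
because the end cells of every level have equal mass. Hence they are chosen in the ratio `m_0 : m_1
= q : p` at every level. -/
theorem discreteLaplacian_junction_left (hp₀ : 0 < p) (hp₁ : p < 1 / 2) (n : ℕ) (f : ℝ → ℝ) :
    discreteLaplacian p (n + 1) f (contraction p 0 1) =
      (1 - p) * discreteLaplacian p n (f ∘ contraction p 0) 1 +
        p * discreteLaplacian p n (f ∘ contraction p 1) 0 := by
  simp only [discreteLaplacian_eq]
  rw [lapNum_succ hp₀ hp₁, lapDen_succ hp₀ hp₁,
    sum_cells_junction_left hp₀ hp₁ (lapDen_term_eq_zero p n),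
    sum_cells_junction_left hp₀ hp₁ (lapNum_term_eq_zero p n f), lapDen_left hp₀ hp₁,
    lapDen_right hp₀ hp₁]
  have h := pow_pos (massWeight_pos hp₀ hp₁ 0) n
  set M := massWeight p 0 ^ n
  have h2 : (1 + (1 - p)) ≠ 0 := by linarith
  have h3 : (1 - p + p) ≠ 0 := by linarith
  simp [massWeight]
  field_simp
  ring

theorem discreteLaplacian_junction_right (hp₀ : 0 < p) (hp₁ : p < 1 / 2) (n : ℕ) (f : ℝ → ℝ) :
    discreteLaplacian p (n + 1) f (contraction p 1 1) =
      p * discreteLaplacian p n (f ∘ contraction p 1) 1 +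
        (1 - p) * discreteLaplacian p n (f ∘ contraction p 2) 0 := by
  simp only [discreteLaplacian_eq]
  rw [lapNum_succ hp₀ hp₁, lapDen_succ hp₀ hp₁,
    sum_cells_junction_right hp₀ hp₁ (lapDen_term_eq_zero p n),
    sum_cells_junction_right hp₀ hp₁ (lapNum_term_eq_zero p n f), lapDen_left hp₀ hp₁,
    lapDen_right hp₀ hp₁]
  have h := pow_pos (massWeight_pos hp₀ hp₁ 0) n
  set M := massWeight p 0 ^ n
  have h2 : (1 + (1 - p)) ≠ 0 := by linarith
  have h3 : (p + (1 - p)) ≠ 0 := by linarith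
  simp [massWeight]
  field_simp
  ring

theorem cellMap_mem_Ioo (hp₀ : 0 < p) (hp₁ : p < 1 / 2) {n : ℕ} (w : Fin n → Fin 3) {x : ℝ}
    (hx : x ∈ Set.Ioo (0 : ℝ) 1) : cellMap p w x ∈ Set.Ioo (0 : ℝ) 1 :=
  ⟨(cellMap_mem_Icc hp₀ hp₁ w (x := 0) (by simp)).1.trans_lt (strictMono_cellMap hp₀ hp₁ w hx.1),
    (strictMono_cellMap hp₀ hp₁ w hx.2).trans_le (cellMap_mem_Icc hp₀ hp₁ w (x := 1) (by simp)).2⟩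

/-- The Laplacian is compatible with restriction to cells. -/
theorem discreteLaplacian_cellMap (hp₀ : 0 < p) (hp₁ : p < 1 / 2) {n : ℕ} (w : Fin n → Fin 3)
    (m : ℕ) (f : ℝ → ℝ) {y : ℝ} (hy : y ∈ Set.Ioo (0 : ℝ) 1) :
    discreteLaplacian p (m + n) f (cellMap p w y) =
      discreteLaplacian p m (f ∘ cellMap p w) y := by
  induction n generalizing f with
  | zero => rfl
  | succ n ih =>
    rw [cellMap, ← add_assoc, discreteLaplacian_succ_interior hp₀ hp₁ _ _ _
      (cellMap_mem_Ioo hp₀ hp₁ _ hy), ih]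
    rfl

theorem cellMap_mem_vertices {n : ℕ} (w : Fin n → Fin 3) {m : ℕ} {x : ℝ}
    (hx : x ∈ vertices p m) : cellMap p w x ∈ vertices p (m + n) := by
  induction n with
  | zero => exact hx
  | succ n ih => exact contraction_mem_vertices (w 0) (ih (Fin.tail w))

/-! ### Linearity, locality, and the minimum principle -/

theorem discreteLaplacian_congr {n : ℕ} {f g : ℝ → ℝ} (h : ∀ x ∈ vertices p n, f x = g x)
    {x : ℝ} (hx : x ∈ vertices p n) : discreteLaplacian p n f x = discreteLaplacian p n g x := by
  simp only [discreteLaplacian, h _ hx, h _ (cellMap_zero_mem_vertices _),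
    h _ (cellMap_one_mem_vertices _)]

theorem lapNum_linear (p : ℝ) (n : ℕ) (a b : ℝ) (f g : ℝ → ℝ) (x : ℝ) :
    lapNum p n (fun y => a * f y + b * g y) x = a * lapNum p n f x + b * lapNum p n g x := by
  simp only [lapNum, Finset.mul_sum, ← Finset.sum_add_distrib]
  refine Finset.sum_congr rfl fun w _ => ?_
  split_ifs <;> ring

theorem discreteLaplacian_linear (p : ℝ) (n : ℕ) (a b : ℝ) (f g : ℝ → ℝ) (x : ℝ) :
    discreteLaplacian p n (fun y => a * f y + b * g y) x =
      a * discreteLaplacian p n f x + b * discreteLaplacian p n g x := by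
  simp only [discreteLaplacian_eq, lapNum_linear]
  ring

theorem discreteLaplacian_const (p : ℝ) (n : ℕ) (c x : ℝ) :
    discreteLaplacian p n (fun _ => c) x = 0 := by
  simp [discreteLaplacian]

theorem discreteLaplacian_affine (p : ℝ) (n : ℕ) (c d : ℝ) (f : ℝ → ℝ) (x : ℝ) :
    discreteLaplacian p n (fun y => c * f y + d) x = c * discreteLaplacian p n f x := by
  have := discreteLaplacian_linear p n c d f (fun _ => 1) x
  simpa [discreteLaplacian_const] using this

theorem discreteLaplacian_id_left (hp₀ : 0 < p) (hp₁ : p < 1 / 2) (n : ℕ) :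
    discreteLaplacian p n (fun y => y) 0 = - resistance p 0 ^ n := by
  induction n with
  | zero => simp [discreteLaplacian_zero_left]
  | succ n ih =>
    rw [discreteLaplacian_succ_left hp₀ hp₁]
    have : ((fun y => y) ∘ contraction p 0) =
      fun y => resistance p 0 * y + contraction p 0 0 := funext (contraction_affine p 0)
    rw [this, discreteLaplacian_affine, ih]; ring

theorem discreteLaplacian_id_right (hp₀ : 0 < p) (hp₁ : p < 1 / 2) (n : ℕ) :
    discreteLaplacian p n (fun y => y) 1 = resistance p 0 ^ n := by
  induction n with
  | zero => simp [discreteLaplacian_zero_right]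
  | succ n ih =>
    rw [discreteLaplacian_succ_right hp₀ hp₁]
    have : ((fun y => y) ∘ contraction p 2) =
      fun y => resistance p 2 * y + contraction p 2 0 := funext (contraction_affine p 2)
    rw [this, discreteLaplacian_affine, ih, resistance_two]; ring

/-- At a junction the walk steps a distance proportional to `r_0` with probability `q` and to `r_1`
in the opposite direction with probability `p`. The identity says that the mean displacement is
zero. -/
theorem resistance_balance (hp₀ : 0 < p) :
    (1 - p) * resistance p 0 = p * resistance p 1 := by
  have : (1 + p) ≠ 0 := by positivity
  simp [resistance]
  field_simp

/-- Affine functions are harmonic. -/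
theorem discreteLaplacian_id (hp₀ : 0 < p) (hp₁ : p < 1 / 2) (n : ℕ) {x : ℝ}
    (hx : x ∈ vertices p n) (hx' : x ∈ Set.Ioo (0 : ℝ) 1) :
    discreteLaplacian p n (fun y => y) x = 0 := by
  have key : ∀ j, ((fun y => y) ∘ contraction p j) =
      fun y => resistance p j * y + contraction p j 0 := fun j => funext (contraction_affine p j)
  induction n generalizing x with
  | zero => rcases hx with rfl | rfl <;> simp at hx'
  | succ n ih =>
    rcases vertices_succ_cases hp₀ hp₁ hx with rfl | rfl | rfl | rfl | ⟨j, y, hy, hy', rfl⟩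
    · simp at hx'
    · simp at hx'
    · rw [discreteLaplacian_junction_left hp₀ hp₁, key, key, discreteLaplacian_affine,
        discreteLaplacian_affine, discreteLaplacian_id_left hp₀ hp₁,
        discreteLaplacian_id_right hp₀ hp₁]
      linear_combination (resistance p 0 ^ n) * resistance_balance hp₀
    · rw [discreteLaplacian_junction_right hp₀ hp₁, key, key, discreteLaplacian_affine,
        discreteLaplacian_affine, discreteLaplacian_id_left hp₀ hp₁,
        discreteLaplacian_id_right hp₀ hp₁, resistance_two]
      linear_combination (-resistance p 0 ^ n) * resistance_balance hp₀
    · rw [discreteLaplacian_succ_interior hp₀ hp₁ _ _ _ hy', key, discreteLaplacian_affine,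
        ih hy hy', mul_zero]

/-- The transition operator `1 - Δ_n` preserves lower bounds. -/
theorem le_sub_discreteLaplacian (hp₀ : 0 < p) (hp₁ : p < 1 / 2) {n : ℕ} {f : ℝ → ℝ} {M : ℝ}
    (hf : ∀ x ∈ vertices p n, M ≤ f x) {x : ℝ} (hx : x ∈ vertices p n) :
    M ≤ f x - discreteLaplacian p n f x := by
  induction n generalizing f x with
  | zero =>
    rcases hx with rfl | rfl
    · rw [discreteLaplacian_zero_left]
      have := hf 1 (by simp [vertices]); linarith
    · rw [discreteLaplacian_zero_right]
      have := hf 0 (by simp [vertices]); linarith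
  | succ n ih =>
    have key : ∀ j, ∀ x ∈ vertices p n, M ≤ (f ∘ contraction p j) x := fun j x hx =>
      hf _ (contraction_mem_vertices j hx)
    have z := zero_mem_vertices p n
    have o := one_mem_vertices hp₀ n
    rcases vertices_succ_cases hp₀ hp₁ hx with rfl | rfl | rfl | rfl | ⟨j, y, hy, hy', rfl⟩
    · have := ih (key 0) z
      rwa [Function.comp_apply, contraction_zero_zero,
        ← discreteLaplacian_succ_left hp₀ hp₁] at this
    · have := ih (key 2) o
      rwa [Function.comp_apply, contraction_two_one hp₀,
        ← discreteLaplacian_succ_right hp₀ hp₁] at this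
    · have h1 := ih (key 0) o
      have h2 := ih (key 1) z
      rw [Function.comp_apply, contraction_one_zero hp₀] at h2
      rw [Function.comp_apply] at h1
      rw [discreteLaplacian_junction_left hp₀ hp₁]
      nlinarith
    · have h1 := ih (key 1) o
      have h2 := ih (key 2) z
      rw [Function.comp_apply, contraction_two_zero hp₀] at h2
      rw [Function.comp_apply] at h1
      rw [discreteLaplacian_junction_right hp₀ hp₁]
      nlinarith
    · rw [discreteLaplacian_succ_interior hp₀ hp₁ _ _ _ hy']
      exact ih (key j) hy

/-- Minimum principle for functions that are strictly superharmonic at the interior vertices. -/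
theorem nonneg_of_discreteLaplacian_pos (hp₀ : 0 < p) (hp₁ : p < 1 / 2) {n : ℕ} {e : ℝ → ℝ}
    (h0 : 0 ≤ e 0) (h1 : 0 ≤ e 1)
    (he : ∀ x ∈ vertices p n \ vertices p 0, 0 < discreteLaplacian p n e x) {x : ℝ}
    (hx : x ∈ vertices p n) : 0 ≤ e x := by
  obtain ⟨y, hy, hmin⟩ := (finite_vertices p n).exists_minimalFor e _ ⟨x, hx⟩
  have hmin' : ∀ z ∈ vertices p n, e y ≤ e z := fun z hz => by
    by_contra! h
    exact absurd (hmin hz h.le) (not_le.2 h)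
  refine le_trans ?_ (hmin' x hx)
  by_cases hy0 : y ∈ vertices p 0
  · rcases hy0 with rfl | rfl
    · exact h0
    · exact h1
  -- At a minimum point the average over the neighbours is at least the value, so the Laplacian is
  -- nonpositive there; the minimum is therefore attained on the boundary.
  · have := le_sub_discreteLaplacian hp₀ hp₁ hmin' hy
    have := he y ⟨hy, hy0⟩
    linarith

theorem mem_interior_iff (hp₀ : 0 < p) (hp₁ : p < 1 / 2) {n : ℕ} {x : ℝ} :
    x ∈ vertices p n \ vertices p 0 ↔ x ∈ vertices p n ∧ x ∈ Set.Ioo (0 : ℝ) 1 := by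
  constructor
  · rintro ⟨h, h'⟩
    have hI := vertices_subset_Icc hp₀ hp₁ n h
    refine ⟨h, lt_of_le_of_ne hI.1 ?_, lt_of_le_of_ne hI.2 ?_⟩
    · rintro rfl; exact h' (by simp [vertices])
    · rintro rfl; exact h' (by simp [vertices])
  · rintro ⟨h, h'⟩
    refine ⟨h, ?_⟩
    rintro (rfl | rfl) <;> simp at h'

/-! ### Gluing functions along the three cells -/

/-- The function on `[0, 1]` whose restriction to the `j`-th cell is `G j`. -/
def glue (p : ℝ) (G : Fin 3 → ℝ → ℝ) (x : ℝ) : ℝ :=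
  if x ≤ contraction p 0 1 then G 0 (contractionInv p 0 x)
  else if x ≤ contraction p 1 1 then G 1 (contractionInv p 1 x)
  else G 2 (contractionInv p 2 x)

theorem glue_contraction (hp₀ : 0 < p) (hp₁ : p < 1 / 2) {G : Fin 3 → ℝ → ℝ}
    (h01 : G 0 1 = G 1 0) (h12 : G 1 1 = G 2 0) (j : Fin 3) {x : ℝ}
    (hx : x ∈ Set.Icc (0 : ℝ) 1) : glue p G (contraction p j x) = G j x := by
  obtain ⟨o1, o2, o3⟩ := contraction_order hp₀ hp₁
  have hinv := fun j => contractionInv_contraction hp₀ hp₁ j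
  have hm := fun j => strictMono_contraction hp₀ hp₁ j
  unfold glue
  match j with
  | 0 =>
    rw [if_pos ((hm 0).monotone hx.2), hinv]
  | 1 =>
    rcases eq_or_lt_of_le hx.1 with rfl | h
    · rw [contraction_one_zero hp₀, if_pos le_rfl, hinv, h01]
    · have := hm 1 h
      rw [contraction_one_zero hp₀] at this
      rw [if_neg (not_le.2 this), if_pos ((hm 1).monotone hx.2), hinv]
  | 2 =>
    rcases eq_or_lt_of_le hx.1 with rfl | h
    · rw [contraction_two_zero hp₀, if_neg (not_le.2 o2), if_pos le_rfl, hinv, h12]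
    · have := hm 2 h
      rw [contraction_two_zero hp₀] at this
      rw [if_neg (not_le.2 (o2.trans this)), if_neg (not_le.2 this), hinv]

theorem continuous_contractionInv (p : ℝ) (j : Fin 3) : Continuous (contractionInv p j) := by
  unfold contractionInv; fun_prop

theorem continuous_glue (hp₀ : 0 < p) (hp₁ : p < 1 / 2) {G : Fin 3 → ℝ → ℝ}
    (h01 : G 0 1 = G 1 0) (h12 : G 1 1 = G 2 0) (hG : ∀ j, Continuous (G j)) :
    Continuous (glue p G) := by
  obtain ⟨o1, o2, o3⟩ := contraction_order hp₀ hp₁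
  have hc := fun j => (hG j).comp (continuous_contractionInv p j)
  have hinv := fun j => contractionInv_contraction hp₀ hp₁ j
  refine Continuous.if_le (hc 0) (Continuous.if_le (hc 1) (hc 2) continuous_id continuous_const ?_)
    continuous_id continuous_const ?_
  · rintro x rfl
    have : contractionInv p 2 (contraction p 1 1) = 0 := by
      rw [← contraction_two_zero hp₀, hinv]
    simp only [hinv, this, h12]
  · rintro x rfl
    have : contractionInv p 1 (contraction p 0 1) = 0 := by
      rw [← contraction_one_zero hp₀, hinv]
    simp only [hinv, this, h01, if_pos o2.le]

/-! ### Spectral decimation -/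

/-- `f` is determined on `V_{n+1} \ V_n` by the decimation formulas with parameter `z`. -/
def IsDecimated (p z : ℝ) (n : ℕ) (f : ℝ → ℝ) : Prop :=
  ∀ w : Fin n → Fin 3,
    f (cellMap p w (contraction p 0 1)) =
        ((1 - p) * (1 - z) * f (cellMap p w 0) + p * (1 - p) * f (cellMap p w 1)) /
          ((1 - p - z) * (1 + p - z)) ∧
      f (cellMap p w (contraction p 1 1)) =
        ((1 - p) * (1 - z) * f (cellMap p w 1) + p * (1 - p) * f (cellMap p w 0)) /
          ((1 - p - z) * (1 + p - z))

theorem IsDecimated.comp {z : ℝ} {n : ℕ} {f : ℝ → ℝ} (h : IsDecimated p z (n + 1) f)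
    (j : Fin 3) : IsDecimated p z n (f ∘ contraction p j) := fun w => by
  simpa [cellMap_cons] using h (Fin.cons j w)

/-- The decimation polynomial. -/
def decimation (p z : ℝ) : ℝ := z * (1 + p - z) * (2 - p - z) / (p * (1 - p))

theorem discreteLaplacian_one_left (hp₀ : 0 < p) (hp₁ : p < 1 / 2) (f : ℝ → ℝ) :
    discreteLaplacian p 1 f (contraction p 0 1) =
      f (contraction p 0 1) - (1 - p) * f 0 - p * f (contraction p 1 1) := by
  rw [discreteLaplacian_junction_left hp₀ hp₁, discreteLaplacian_zero_left,
    discreteLaplacian_zero_right]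
  simp only [Function.comp_apply, contraction_zero_zero, contraction_one_zero hp₀]
  ring

theorem discreteLaplacian_one_right (hp₀ : 0 < p) (hp₁ : p < 1 / 2) (f : ℝ → ℝ) :
    discreteLaplacian p 1 f (contraction p 1 1) =
      f (contraction p 1 1) - (1 - p) * f 1 - p * f (contraction p 0 1) := by
  rw [discreteLaplacian_junction_right hp₀ hp₁, discreteLaplacian_zero_left,
    discreteLaplacian_zero_right]
  simp only [Function.comp_apply, contraction_two_zero hp₀, contraction_one_zero hp₀,
    contraction_two_one hp₀]
  ring

/-- At new vertices only the four points of one level-`n` cell matter. The eigenvalue equations at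
the two new points form a 2×2 linear system with determinant `(1-z)² - p² = (1-p-z)(1+p-z)`, whose
solution is the pair of decimation formulas. -/
theorem discreteLaplacian_new_left (hp₀ : 0 < p) (hp₁ : p < 1 / 2) {n : ℕ} (f : ℝ → ℝ)
    (w : Fin n → Fin 3) :
    discreteLaplacian p (n + 1) f (cellMap p w (contraction p 0 1)) =
      f (cellMap p w (contraction p 0 1)) - (1 - p) * f (cellMap p w 0)
        - p * f (cellMap p w (contraction p 1 1)) := by
  obtain ⟨o1, o2, o3⟩ := contraction_order hp₀ hp₁
  rw [add_comm, discreteLaplacian_cellMap hp₀ hp₁ w 1 f ⟨o1, o2.trans o3⟩,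
    discreteLaplacian_one_left hp₀ hp₁]
  rfl

theorem discreteLaplacian_new_right (hp₀ : 0 < p) (hp₁ : p < 1 / 2) {n : ℕ} (f : ℝ → ℝ)
    (w : Fin n → Fin 3) :
    discreteLaplacian p (n + 1) f (cellMap p w (contraction p 1 1)) =
      f (cellMap p w (contraction p 1 1)) - (1 - p) * f (cellMap p w 1)
        - p * f (cellMap p w (contraction p 0 1)) := by
  obtain ⟨o1, o2, o3⟩ := contraction_order hp₀ hp₁
  rw [add_comm, discreteLaplacian_cellMap hp₀ hp₁ w 1 f ⟨o1.trans o2, o3⟩,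
    discreteLaplacian_one_right hp₀ hp₁]
  rfl

theorem vertices_succ_eq (hp₀ : 0 < p) {n : ℕ} {x : ℝ}
    (hx : x ∈ vertices p (n + 1)) : x ∈ vertices p n ∨ ∃ w : Fin n → Fin 3,
      x = cellMap p w (contraction p 0 1) ∨ x = cellMap p w (contraction p 1 1) := by
  induction n generalizing x with
  | zero =>
    obtain ⟨w, h⟩ := mem_vertices_iff.1 hx
    simp only [cellMap] at h
    have h0 := contraction_zero_zero p
    have h1 := contraction_one_zero hp₀
    have h2 := contraction_two_zero hp₀
    have h3 := contraction_two_one hp₀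
    generalize w 0 = j at h
    fin_cases j <;> simp_all [vertices, cellMap] <;> tauto
  | succ n ih =>
    simp only [vertices, Set.mem_iUnion, Set.mem_image] at hx
    obtain ⟨j, y, hy, rfl⟩ := hx
    rcases ih (x := y) (by simpa [vertices] using hy) with h | ⟨w, h⟩
    · exact Or.inl (contraction_mem_vertices j h)
    · refine Or.inr ⟨Fin.cons j w, ?_⟩
      simp only [cellMap_cons]
      exact h.imp (fun h => by rw [h]) (fun h => by rw [h])

theorem new_left_mem_vertices {n : ℕ} (w : Fin n → Fin 3) :
    cellMap p w (contraction p 0 1) ∈ vertices p (n + 1) := by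
  rw [add_comm]
  exact cellMap_mem_vertices w (contraction_mem_vertices (n := 0) 0 (by simp [vertices]))

theorem new_right_mem_vertices {n : ℕ} (w : Fin n → Fin 3) :
    cellMap p w (contraction p 1 1) ∈ vertices p (n + 1) := by
  rw [add_comm]
  exact cellMap_mem_vertices w (contraction_mem_vertices (n := 0) 1 (by simp [vertices]))

/-- On old vertices the transition operator of level `n + 1` acts on a decimated function through
the transition operator of level `n`. -/
theorem IsDecimated.discreteLaplacian_succ (hp₀ : 0 < p) (hp₁ : p < 1 / 2) {z : ℝ} {n : ℕ}
    {f : ℝ → ℝ} (h : IsDecimated p z n f) {x : ℝ} (hx : x ∈ vertices p n) :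
    discreteLaplacian p (n + 1) f x =
      f x - ((1 - p) * (1 - z) * f x + p * (1 - p) * (f x - discreteLaplacian p n f x)) /
        ((1 - p - z) * (1 + p - z)) := by
  induction n generalizing f x with
  | zero =>
    have := h Fin.elim0
    simp only [cellMap] at this
    rcases hx with rfl | rfl
    · rw [discreteLaplacian_succ_left hp₀ hp₁, discreteLaplacian_zero_left,
        discreteLaplacian_zero_left]
      simp only [Function.comp_apply, contraction_zero_zero, this.1]
      ring
    · rw [discreteLaplacian_succ_right hp₀ hp₁, discreteLaplacian_zero_right,
        discreteLaplacian_zero_right]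
      simp only [Function.comp_apply, contraction_two_one hp₀, contraction_two_zero hp₀, this.2]
      ring
  | succ n ih =>
    have z := zero_mem_vertices p n
    have o := one_mem_vertices hp₀ n
    rcases vertices_succ_cases hp₀ hp₁ hx with rfl | rfl | rfl | rfl | ⟨j, y, hy, hy', rfl⟩
    · rw [discreteLaplacian_succ_left hp₀ hp₁ (n + 1), ih (h.comp 0) z,
        discreteLaplacian_succ_left hp₀ hp₁ n]
      simp only [Function.comp_apply, contraction_zero_zero]
    · rw [discreteLaplacian_succ_right hp₀ hp₁ (n + 1), ih (h.comp 2) o,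
        discreteLaplacian_succ_right hp₀ hp₁ n]
      simp only [Function.comp_apply, contraction_two_one hp₀]
    -- The asserted formula is linear in the pair `(f x, Δ_n f x)` with the same coefficients in
    -- both cells, so it survives averaging with weights `q` and `p`.
    · rw [discreteLaplacian_junction_left hp₀ hp₁, discreteLaplacian_junction_left hp₀ hp₁,
        ih (h.comp 0) o, ih (h.comp 1) z]
      simp only [Function.comp_apply, contraction_one_zero hp₀]
      ring
    · rw [discreteLaplacian_junction_right hp₀ hp₁, discreteLaplacian_junction_right hp₀ hp₁,
        ih (h.comp 1) o, ih (h.comp 2) z]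
      simp only [Function.comp_apply, contraction_two_zero hp₀]
      ring
    · rw [discreteLaplacian_succ_interior hp₀ hp₁ _ _ _ hy',
        discreteLaplacian_succ_interior hp₀ hp₁ _ _ _ hy', ih (h.comp j) hy]
      rfl

/-- The decimated extension of an eigenfunction is an eigenfunction. -/
theorem IsDecimated.isEigenfunction_succ (hp₀ : 0 < p) (hp₁ : p < 1 / 2) {z : ℝ} {n : ℕ}
    {f : ℝ → ℝ} (h : IsDecimated p z n f) (hz : (1 - p - z) * (1 + p - z) ≠ 0)
    (hf : IsEigenfunction p n (decimation p z) f) : IsEigenfunction p (n + 1) z f := by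
  obtain ⟨⟨x, hx, hx0⟩, hl⟩ := hf
  refine ⟨⟨x, vertices_subset_succ hp₀ n hx, hx0⟩, fun x hx => ?_⟩
  have hq : (1 - p) ≠ 0 := by linarith
  obtain ⟨ha, hb⟩ := mul_ne_zero_iff.1 hz
  rcases vertices_succ_eq hp₀ hx with hx | ⟨w, rfl | rfl⟩
  · rw [h.discreteLaplacian_succ hp₀ hp₁ hx, hl x hx, decimation]
    field_simp
    ring
  · rw [discreteLaplacian_new_left hp₀ hp₁, (h w).1, (h w).2]
    field_simp
    ring
  · rw [discreteLaplacian_new_right hp₀ hp₁, (h w).1, (h w).2]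
    field_simp
    ring

/-- An eigenfunction of level `n + 1` is decimated, except for two exceptional eigenvalues. -/
theorem IsEigenfunction.isDecimated (hp₀ : 0 < p) (hp₁ : p < 1 / 2) {z : ℝ} {n : ℕ} {f : ℝ → ℝ}
    (hf : IsEigenfunction p (n + 1) z f) (hz : (1 - p - z) * (1 + p - z) ≠ 0) :
    IsDecimated p z n f := fun w => by
  have h1 := hf.2 _ (new_left_mem_vertices w)
  have h2 := hf.2 _ (new_right_mem_vertices w)
  rw [discreteLaplacian_new_left hp₀ hp₁] at h1
  rw [discreteLaplacian_new_right hp₀ hp₁] at h2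
  rw [eq_div_iff hz, eq_div_iff hz]
  constructor
  · linear_combination (1 - z) * h1 + p * h2
  · linear_combination (1 - z) * h2 + p * h1

theorem IsEigenfunction.decimate (hp₀ : 0 < p) (hp₁ : p < 1 / 2) {z : ℝ} {n : ℕ} {f : ℝ → ℝ}
    (hf : IsEigenfunction p (n + 1) z f) (hz : (1 - p - z) * (1 + p - z) ≠ 0) :
    IsEigenfunction p n (decimation p z) f := by
  have h := hf.isDecimated hp₀ hp₁ hz
  have hq : (1 - p) ≠ 0 := by linarith
  constructor
  -- The restriction to `V_n` is not zero: the decimation formulas would propagate zero to all of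
  -- `V_{n+1}`.
  · by_contra! h0
    obtain ⟨x, hx, hx0⟩ := hf.1
    apply hx0
    rcases vertices_succ_eq hp₀ hx with hx | ⟨w, rfl | rfl⟩
    · exact h0 x hx
    · rw [(h w).1, h0 _ (cellMap_zero_mem_vertices w), h0 _ (cellMap_one_mem_vertices w)]; simp
    · rw [(h w).2, h0 _ (cellMap_zero_mem_vertices w), h0 _ (cellMap_one_mem_vertices w)]; simp
  · intro x hx
    have h1 := h.discreteLaplacian_succ hp₀ hp₁ hx
    rw [hf.2 x (vertices_subset_succ hp₀ n hx), eq_sub_iff_add_eq, ← eq_sub_iff_add_eq',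
      div_eq_iff hz] at h1
    have h2 : p * (1 - p) * discreteLaplacian p n f x =
      p * (1 - p) * (decimation p z * f x) := by
      have : p * (1 - p) * (decimation p z * f x) = z * (1 + p - z) * (2 - p - z) * f x := by
        rw [decimation]; field_simp
      rw [this]
      linear_combination -h1
    exact mul_left_cancel₀ (mul_ne_zero hp₀.ne' hq) h2

/-- The extension of a function from `V_n` to `V_{n+1}` by the decimation formulas. -/
def decimatedExtension (p z : ℝ) : ℕ → (ℝ → ℝ) → ℝ → ℝ
  | 0, f => fun x =>
    if x = contraction p 0 1 then
      ((1 - p) * (1 - z) * f 0 + p * (1 - p) * f 1) / ((1 - p - z) * (1 + p - z))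
    else if x = contraction p 1 1 then
      ((1 - p) * (1 - z) * f 1 + p * (1 - p) * f 0) / ((1 - p - z) * (1 + p - z))
    else f x
  | n + 1, f => glue p fun j => decimatedExtension p z n (f ∘ contraction p j)

theorem decimatedExtension_of_mem (hp₀ : 0 < p) (hp₁ : p < 1 / 2) (z : ℝ) {n : ℕ} (f : ℝ → ℝ)
    {x : ℝ} (hx : x ∈ vertices p n) : decimatedExtension p z n f x = f x := by
  obtain ⟨o1, o2, o3⟩ := contraction_order hp₀ hp₁
  induction n generalizing f x with
  | zero =>
    rcases hx with rfl | rfl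
    · simp [decimatedExtension, o1.ne, (o1.trans o2).ne]
    · simp [decimatedExtension, o3.ne', (o2.trans o3).ne']
  | succ n ih =>
    simp only [vertices, Set.mem_iUnion, Set.mem_image] at hx
    obtain ⟨j, y, hy, rfl⟩ := hx
    have z := zero_mem_vertices p n
    have o := one_mem_vertices hp₀ n
    rw [decimatedExtension, glue_contraction hp₀ hp₁ _ _ _ (vertices_subset_Icc hp₀ hp₁ n hy),
      ih _ hy, Function.comp_apply]
    · rw [ih _ z, ih _ o, Function.comp_apply, Function.comp_apply, contraction_one_zero hp₀]
    · rw [ih _ z, ih _ o, Function.comp_apply, Function.comp_apply, contraction_two_zero hp₀]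

theorem isDecimated_decimatedExtension (hp₀ : 0 < p) (hp₁ : p < 1 / 2) (z : ℝ) (n : ℕ)
    (f : ℝ → ℝ) : IsDecimated p z n (decimatedExtension p z n f) := by
  obtain ⟨o1, o2, o3⟩ := contraction_order hp₀ hp₁
  induction n generalizing f with
  | zero =>
    intro w
    simp [decimatedExtension, cellMap, o1.ne, o2.ne', o3.ne', (o1.trans o2).ne, (o2.trans o3).ne']
  | succ n ih =>
    intro w
    have h := ih (f ∘ contraction p (w 0)) (Fin.tail w)
    have v0 := zero_mem_vertices p n
    have v1 := one_mem_vertices hp₀ n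
    have key : ∀ x ∈ Set.Icc (0 : ℝ) 1, decimatedExtension p z (n + 1) f (cellMap p w x) =
        decimatedExtension p z n (f ∘ contraction p (w 0)) (cellMap p (Fin.tail w) x) := by
      intro x hx
      rw [cellMap, decimatedExtension,
        glue_contraction hp₀ hp₁ _ _ _ (cellMap_mem_Icc hp₀ hp₁ _ hx)]
      · rw [decimatedExtension_of_mem hp₀ hp₁ _ _ v0, decimatedExtension_of_mem hp₀ hp₁ _ _ v1,
          Function.comp_apply, Function.comp_apply, contraction_one_zero hp₀]
      · rw [decimatedExtension_of_mem hp₀ hp₁ _ _ v0, decimatedExtension_of_mem hp₀ hp₁ _ _ v1,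
          Function.comp_apply, Function.comp_apply, contraction_two_zero hp₀]
    rw [key _ ⟨o1.le, (o2.trans o3).le⟩, key _ ⟨(o1.trans o2).le, o3.le⟩, key 0 (by simp),
      key 1 (by simp)]
    exact h

theorem IsEigenfunction.congr {l : ℝ} {n : ℕ} {f g : ℝ → ℝ} (hf : IsEigenfunction p n l f)
    (h : ∀ x ∈ vertices p n, f x = g x) : IsEigenfunction p n l g := by
  obtain ⟨⟨x, hx, hx0⟩, hl⟩ := hf
  refine ⟨⟨x, hx, by rwa [← h x hx]⟩, fun x hx => ?_⟩
  rw [← discreteLaplacian_congr h hx, hl x hx, h x hx]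

/-- Restriction and decimated extension carry eigenfunctions between the two levels. The excluded
values `1 - p` and `1 + p` are those for which the 2×2 system at the new vertices is singular. -/
theorem mem_eigenvalues_succ (hp₀ : 0 < p) (hp₁ : p < 1 / 2) {z : ℝ} {n : ℕ}
    (hz : (1 - p - z) * (1 + p - z) ≠ 0) :
    z ∈ eigenvalues p (n + 1) ↔ decimation p z ∈ eigenvalues p n := by
  constructor
  · rintro ⟨f, hf⟩
    exact ⟨f, hf.decimate hp₀ hp₁ hz⟩
  · rintro ⟨f, hf⟩
    exact ⟨_, (isDecimated_decimatedExtension hp₀ hp₁ z n f).isEigenfunction_succ hp₀ hp₁ hz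
      (hf.congr fun x hx => (decimatedExtension_of_mem hp₀ hp₁ z f hx).symm)⟩

theorem eigenvalues_zero (p : ℝ) : eigenvalues p 0 = {0, 2} := by
  ext l
  constructor
  · rintro ⟨f, ⟨x, hx, hx0⟩, hl⟩
    have h0 := hl 0 (by simp [vertices])
    have h1 := hl 1 (by simp [vertices])
    rw [discreteLaplacian_zero_left] at h0
    rw [discreteLaplacian_zero_right] at h1
    by_contra hne
    simp only [Set.mem_insert_iff, Set.mem_singleton_iff, not_or] at hne
    have hs : f 0 + f 1 = 0 :=
      (mul_eq_zero.1 (show l * (f 0 + f 1) = 0 by linear_combination -h0 - h1)).resolve_left hne.1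
    have ha : f 0 = 0 := (mul_eq_zero.1 (show (l - 2) * f 0 = 0 by
      linear_combination -h0 - hs)).resolve_left (sub_ne_zero.2 hne.2)
    rcases hx with rfl | rfl
    · exact hx0 ha
    · exact hx0 (by linarith)
  · rintro (rfl | rfl)
    · refine ⟨fun _ => 1, ⟨0, by simp [vertices], by simp⟩, fun x _ => ?_⟩
      simp [discreteLaplacian_const]
    · refine ⟨fun x => 1 - 2 * x, ⟨0, by simp [vertices], by simp⟩, ?_⟩
      rintro x (rfl | rfl)
      · rw [discreteLaplacian_zero_left]; norm_num
      · rw [discreteLaplacian_zero_right]; norm_num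

/-! ### The decimation polynomial -/

theorem continuous_decimation (p : ℝ) : Continuous (decimation p) := by
  unfold decimation; fun_prop

theorem decimation_zero (p : ℝ) : decimation p 0 = 0 := by simp [decimation]

/-- This symmetry about the midpoint of `[0, 2]` transfers every statement at the lower end of the
spectrum to the upper end. -/
theorem decimation_sub (p : ℝ) (hp₀ : 0 < p) (hp₁ : p < 1 / 2) (z : ℝ) :
    decimation p (2 - z) = 2 - decimation p z := by
  have hq : (1 - p) ≠ 0 := by linarith
  rw [decimation, decimation]; field_simp; ring

theorem decimation_p (hp₀ : 0 < p) (hp₁ : p < 1 / 2) : decimation p p = 2 := by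
  have hq : (1 - p) ≠ 0 := by linarith
  rw [decimation]; field_simp; ring

theorem decimation_neg (hp₀ : 0 < p) (hp₁ : p < 1 / 2) {z : ℝ} (hz : z < 0) :
    decimation p z < 0 := by
  have hq : 0 < 1 - p := by linarith
  refine div_neg_of_neg_of_pos ?_ (by positivity)
  exact mul_neg_of_neg_of_pos (mul_neg_of_neg_of_pos hz (by linarith)) (by linarith)

theorem decimation_mem_Icc_imp (hp₀ : 0 < p) (hp₁ : p < 1 / 2) {z : ℝ}
    (h : decimation p z ∈ Set.Icc (0 : ℝ) 2) : z ∈ Set.Icc (0 : ℝ) 2 := by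
  constructor
  · by_contra! hz
    exact absurd h.1 (not_le.2 (decimation_neg hp₀ hp₁ hz))
  · by_contra! hz
    have := decimation_neg hp₀ hp₁ (show 2 - z < 0 by linarith)
    rw [decimation_sub p hp₀ hp₁] at this
    linarith [h.2]

/-- The polynomial covers `[0, 2]` on each of `[0, p]`, `[1-p, 1+p]` and `[2-p, 2]`, which are
disjoint because `p < 1/2`. On the middle interval only the open one is of use, since its endpoints
are the exceptional values. -/
theorem exists_decimation_low (hp₀ : 0 < p) (hp₁ : p < 1 / 2) {l : ℝ}
    (hl : l ∈ Set.Icc (0 : ℝ) 2) : ∃ z ∈ Set.Icc 0 p, decimation p z = l := by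
  have := intermediate_value_Icc hp₀.le (continuous_decimation p).continuousOn
  rw [decimation_zero, decimation_p hp₀ hp₁] at this
  exact this hl

theorem exists_decimation_high (hp₀ : 0 < p) (hp₁ : p < 1 / 2) {l : ℝ}
    (hl : l ∈ Set.Icc (0 : ℝ) 2) : ∃ z ∈ Set.Icc (2 - p) 2, decimation p z = l := by
  obtain ⟨z, hz, h⟩ := exists_decimation_low hp₀ hp₁ (l := 2 - l)
    ⟨by linarith [hl.2], by linarith [hl.1]⟩
  exact ⟨2 - z, ⟨by linarith [hz.2], by linarith [hz.1]⟩, by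
    rw [decimation_sub p hp₀ hp₁, h]; ring⟩

theorem exists_decimation_mid (hp₀ : 0 < p) (hp₁ : p < 1 / 2) {l : ℝ}
    (hl : l ∈ Set.Ioo (0 : ℝ) 2) : ∃ z ∈ Set.Ioo (1 - p) (1 + p), decimation p z = l := by
  have hq : (1 - p) ≠ 0 := by linarith
  have := intermediate_value_Ioo' (show 1 - p ≤ 1 + p by linarith)
    (continuous_decimation p).continuousOn
  have h1 : decimation p (1 + p) = 0 := by simp [decimation]
  have h2 : decimation p (1 - p) = 2 := by rw [decimation]; field_simp; ring
  rw [h1, h2] at this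
  exact this hl

theorem strictMonoOn_decimation (hp₀ : 0 < p) (hp₁ : p < 1 / 2) :
    StrictMonoOn (decimation p) (Set.Icc 0 p) := by
  intro x hx y hy hxy
  have hq : 0 < 1 - p := by linarith
  unfold decimation
  refine div_lt_div_of_pos_right ?_ (by positivity)
  -- This is the divided difference of `z (1+p-z)(2-p-z) = z³ - 3z² + (2+pq) z` at `x` and `y`. It
  -- decreases as first `y` and then `x` is moved up to `p` (`h1` and `h2` are the two decrements),
  -- and at `x = y = p` it equals `(1-2p)(2-p)`.
  have key : 0 < y ^ 2 + x * y + x ^ 2 - 3 * (x + y) + 2 + p * (1 - p) := by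
    have h1 : 0 ≤ (p - y) * (3 - p - y - x) :=
      mul_nonneg (by linarith [hy.2]) (by linarith [hy.2, hx.2])
    have h2 : 0 ≤ (p - x) * (3 - p - x - p) :=
      mul_nonneg (by linarith [hx.2]) (by linarith [hy.2, hx.2])
    have h3 : 0 < (1 - 2 * p) * (2 - p) := mul_pos (by linarith) (by linarith)
    linarith
  have := mul_pos (sub_pos.2 hxy) key
  linarith

theorem finite_decimation_fiber (hp₀ : 0 < p) (hp₁ : p < 1 / 2) (l : ℝ) :
    {z | decimation p z = l}.Finite := by
  have hq : (1 - p) ≠ 0 := by linarith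
  open Polynomial in
  let P : ℝ[X] := X * (C (1 + p) - X) * (C (2 - p) - X) - C (l * (p * (1 - p)))
  have hev : ∀ z, P.eval z = (decimation p z - l) * (p * (1 - p)) := fun z => by
    simp only [P, decimation, Polynomial.eval_sub, Polynomial.eval_mul, Polynomial.eval_X,
      Polynomial.eval_C]
    field_simp
  have hP : P ≠ 0 := by
    intro h
    have h1 := hev 0
    have h2 := hev p
    rw [h, Polynomial.eval_zero, eq_comm, mul_eq_zero] at h1 h2
    rw [decimation_zero] at h1
    rw [decimation_p hp₀ hp₁] at h2
    have hne := mul_ne_zero hp₀.ne' hq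
    have h1 := h1.resolve_right hne
    have h2 := h2.resolve_right hne
    linarith
  refine (P.roots.toFinset.finite_toSet).subset fun z hz => ?_
  simp only [Set.mem_ofPred_eq] at hz
  simp [hP, hev, hz]

/-! ### The spectrum -/

theorem eigenvalues_succ_subset (hp₀ : 0 < p) (hp₁ : p < 1 / 2) (n : ℕ) :
    eigenvalues p (n + 1) ⊆ {1 - p, 1 + p} ∪ decimation p ⁻¹' eigenvalues p n := by
  intro z hz
  by_cases h : (1 - p - z) * (1 + p - z) = 0
  · left
    rcases mul_eq_zero.1 h with h | h
    · left; linarith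
    · right; exact (sub_eq_zero.1 h).symm
  · right
    exact (mem_eigenvalues_succ hp₀ hp₁ h).1 hz

theorem finite_eigenvalues (hp₀ : 0 < p) (hp₁ : p < 1 / 2) (n : ℕ) :
    (eigenvalues p n).Finite := by
  induction n with
  | zero => rw [eigenvalues_zero]; exact Set.toFinite _
  | succ n ih =>
    refine Set.Finite.subset (Set.Finite.union (Set.toFinite _) ?_)
      (eigenvalues_succ_subset hp₀ hp₁ n)
    exact ih.preimage' fun l _ => finite_decimation_fiber hp₀ hp₁ l

theorem eigenvalues_subset_Icc (hp₀ : 0 < p) (hp₁ : p < 1 / 2) (n : ℕ) :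
    eigenvalues p n ⊆ Set.Icc 0 2 := by
  induction n with
  | zero => rw [eigenvalues_zero]; rintro x (rfl | rfl) <;> norm_num
  | succ n ih =>
    intro z hz
    rcases eigenvalues_succ_subset hp₀ hp₁ n hz with (rfl | rfl) | h
    · constructor <;> linarith
    · constructor <;> linarith
    · exact decimation_mem_Icc_imp hp₀ hp₁ (ih h)

/-- Each of `N` eigenvalues has a low and a high preimage, and all but possibly `0` and `2` have a
middle one, which gives at least `3N - 2`; and `3(3ⁿ+1) - 2 = 3^(n+1) + 1`. This lower bound is all
that is needed for `λ_{n,k}` with `k ≤ 3ⁿ` to be a genuine eigenvalue, so the exceptional values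
need not be examined. -/
theorem le_ncard_eigenvalues (hp₀ : 0 < p) (hp₁ : p < 1 / 2) (n : ℕ) :
    3 ^ n + 1 ≤ (eigenvalues p n).ncard := by
  induction n with
  | zero => rw [eigenvalues_zero, Set.ncard_pair (by norm_num)]; norm_num
  | succ n ih =>
    set S := eigenvalues p n
    have hS : S ⊆ Set.Icc 0 2 := eigenvalues_subset_Icc hp₀ hp₁ n
    have hSf : S.Finite := finite_eigenvalues hp₀ hp₁ n
    have hS' : S \ {0, 2} ⊆ Set.Ioo 0 2 := fun x ⟨hx, hx'⟩ => by
      simp only [Set.mem_insert_iff, Set.mem_singleton_iff, not_or] at hx'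
      exact ⟨lt_of_le_of_ne (hS hx).1 (Ne.symm hx'.1), lt_of_le_of_ne (hS hx).2 hx'.2⟩
    choose! a ha ha' using fun l (hl : l ∈ Set.Icc (0 : ℝ) 2) => exists_decimation_low hp₀ hp₁ hl
    choose! b hb hb' using fun l (hl : l ∈ Set.Ioo (0 : ℝ) 2) => exists_decimation_mid hp₀ hp₁ hl
    choose! c hc hc' using fun l (hl : l ∈ Set.Icc (0 : ℝ) 2) => exists_decimation_high hp₀ hp₁ hl
    have ia : Set.InjOn a S := fun x hx y hy h => by rw [← ha' x (hS hx), h, ha' y (hS hy)]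
    have ic : Set.InjOn c S := fun x hx y hy h => by rw [← hc' x (hS hx), h, hc' y (hS hy)]
    have ib : Set.InjOn b (S \ {0, 2}) := fun x hx y hy h => by
      rw [← hb' x (hS' hx), h, hb' y (hS' hy)]
    have hsub : (a '' S ∪ b '' (S \ {0, 2})) ∪ c '' S ⊆ eigenvalues p (n + 1) := by
      rintro _ ((⟨l, hl, rfl⟩ | ⟨l, hl, rfl⟩) | ⟨l, hl, rfl⟩)
      · have := ha l (hS hl)
        rw [mem_eigenvalues_succ hp₀ hp₁ (mul_ne_zero (by linarith [this.2]) (by linarith [this.2])),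
          ha' l (hS hl)]
        exact hl
      · have := hb l (hS' hl)
        rw [mem_eigenvalues_succ hp₀ hp₁ (mul_ne_zero (by linarith [this.1]) (by linarith [this.2])),
          hb' l (hS' hl)]
        exact hl.1
      · have := hc l (hS hl)
        rw [mem_eigenvalues_succ hp₀ hp₁ (mul_ne_zero (by linarith [this.1]) (by linarith [this.1])),
          hc' l (hS hl)]
        exact hl
    have hd1 : Disjoint (a '' S) (b '' (S \ {0, 2})) := by
      rw [Set.disjoint_left]
      rintro _ ⟨l, hl, rfl⟩ ⟨m, hm, h⟩
      linarith [(ha l (hS hl)).2, (hb m (hS' hm)).1]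
    have hd2 : Disjoint (a '' S ∪ b '' (S \ {0, 2})) (c '' S) := by
      rw [Set.disjoint_left]
      rintro _ (⟨l, hl, rfl⟩ | ⟨l, hl, rfl⟩) ⟨m, hm, h⟩
      · linarith [(ha l (hS hl)).2, (hc m (hS hm)).1]
      · linarith [(hb l (hS' hl)).2, (hc m (hS hm)).1]
    have h := Set.ncard_le_ncard hsub (finite_eigenvalues hp₀ hp₁ _)
    rw [Set.ncard_union_eq hd2 ((hSf.image _).union (hSf.sdiff.image _)) (hSf.image _),
      Set.ncard_union_eq hd1 (hSf.image _) (hSf.sdiff.image _), ia.ncard_image,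
      ib.ncard_image, ic.ncard_image] at h
    have h2 := Set.le_ncard_sdiff {0, 2} S
    rw [Set.ncard_pair (by norm_num : (0 : ℝ) ≠ 2)] at h2
    rw [pow_succ]
    omega

/-- A finite set of reals has an element with exactly `k` smaller elements. -/
theorem exists_ncard_lt_eq {S : Set ℝ} (hS : S.Finite) {k : ℕ} (hk : k < S.ncard) :
    ∃ l ∈ S, {l' | l' ∈ S ∧ l' < l}.ncard = k := by
  rw [Set.ncard_eq_toFinset_card S hS] at hk
  set e := hS.toFinset.orderEmbOfFin rfl
  refine ⟨e ⟨k, hk⟩, hS.mem_toFinset.1 (hS.toFinset.orderEmbOfFin_mem rfl ⟨k, hk⟩), ?_⟩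
  have : {l' | l' ∈ S ∧ l' < e ⟨k, hk⟩} = e '' Set.Iio ⟨k, hk⟩ := by
    ext l
    constructor
    · rintro ⟨hl, hlt⟩
      have : l ∈ Set.range e := by
        rw [Finset.range_orderEmbOfFin]; simpa using hl
      obtain ⟨i, rfl⟩ := this
      exact ⟨i, e.lt_iff_lt.1 hlt, rfl⟩
    · rintro ⟨i, hi, rfl⟩
      exact ⟨hS.mem_toFinset.1 (hS.toFinset.orderEmbOfFin_mem rfl i), e.lt_iff_lt.2 hi⟩
  rw [this, Set.ncard_image_of_injective _ e.injective, ← Finset.coe_Iio, Set.ncard_coe_finset,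
    Fin.card_Iio]

/-- An eigenvalue `m < l` has strictly fewer eigenvalues below it, since `m` itself lies below `l`.
So `l` is the least element of the set whose infimum defines `eigenvalue`. -/
theorem eigenvalue_eq_of_ncard (hp₀ : 0 < p) (hp₁ : p < 1 / 2) {n k : ℕ} {l : ℝ}
    (hl : l ∈ eigenvalues p n) (hk : {l' | l' ∈ eigenvalues p n ∧ l' < l}.ncard = k) :
    eigenvalue p n k = l := by
  refine IsLeast.csInf_eq ⟨⟨hl, hk.ge⟩, fun m ⟨hm, hmk⟩ => ?_⟩
  by_contra! hlt
  have hss : {l' | l' ∈ eigenvalues p n ∧ l' < m} ⊂ {l' | l' ∈ eigenvalues p n ∧ l' < l} := by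
    refine ⟨fun x hx => ⟨hx.1, hx.2.trans hlt⟩, fun h => ?_⟩
    exact lt_irrefl m (h ⟨hm, hlt⟩).2
  have := Set.ncard_lt_ncard hss ((finite_eigenvalues hp₀ hp₁ n).subset fun x hx => hx.1)
  omega

theorem eigenvalue_spec (hp₀ : 0 < p) (hp₁ : p < 1 / 2) {n k : ℕ} (hk : k ≤ 3 ^ n) :
    eigenvalue p n k ∈ eigenvalues p n ∧
      {l' | l' ∈ eigenvalues p n ∧ l' < eigenvalue p n k}.ncard = k := by
  obtain ⟨l, hl, h⟩ := exists_ncard_lt_eq (finite_eigenvalues hp₀ hp₁ n) (k := k)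
    (by have := le_ncard_eigenvalues hp₀ hp₁ n; omega)
  rw [eigenvalue_eq_of_ncard hp₀ hp₁ hl h]
  exact ⟨hl, h⟩

/-- The low eigenvalues of level `n + 1` are the lowest preimages of those of level `n`. -/
theorem eigenvalue_succ (hp₀ : 0 < p) (hp₁ : p < 1 / 2) {n k : ℕ} (hk : k ≤ 3 ^ n) :
    eigenvalue p (n + 1) k ∈ Set.Icc 0 p ∧
      decimation p (eigenvalue p (n + 1) k) = eigenvalue p n k := by
  obtain ⟨hl, hc⟩ := eigenvalue_spec hp₀ hp₁ hk
  have hlow : ∀ {z}, z ∈ Set.Icc 0 p →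
      (z ∈ eigenvalues p (n + 1) ↔ decimation p z ∈ eigenvalues p n) := fun {z} hz =>
    mem_eigenvalues_succ hp₀ hp₁ (mul_ne_zero (by linarith [hz.2]) (by linarith [hz.2]))
  obtain ⟨z, hz, hzl⟩ := exists_decimation_low hp₀ hp₁ (eigenvalues_subset_Icc hp₀ hp₁ n hl)
  suffices eigenvalue p (n + 1) k = z by rw [this]; exact ⟨hz, hzl⟩
  refine eigenvalue_eq_of_ncard hp₀ hp₁ ((hlow hz).2 (hzl ▸ hl)) ?_
  have hmono := strictMonoOn_decimation hp₀ hp₁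
  -- All eigenvalues below `z` lie in `[0, p]`, where the polynomial is an increasing bijection onto
  -- `[0, 2]` and no exceptional value occurs. Hence the rank of `z` at level `n + 1` is the rank of
  -- its image at level `n`.
  have himg : {l' | l' ∈ eigenvalues p n ∧ l' < eigenvalue p n k} =
      decimation p '' {l' | l' ∈ eigenvalues p (n + 1) ∧ l' < z} := by
    ext m
    constructor
    · rintro ⟨hm, hmlt⟩
      obtain ⟨y, hy, rfl⟩ := exists_decimation_low hp₀ hp₁ (eigenvalues_subset_Icc hp₀ hp₁ n hm)
      exact ⟨y, ⟨(hlow hy).2 hm, (hmono.lt_iff_lt hy hz).1 (hzl ▸ hmlt)⟩, rfl⟩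
    · rintro ⟨y, ⟨hy, hyz⟩, rfl⟩
      have hyI : y ∈ Set.Icc 0 p :=
        ⟨(eigenvalues_subset_Icc hp₀ hp₁ _ hy).1, hyz.le.trans hz.2⟩
      exact ⟨(hlow hyI).1 hy, hzl ▸ hmono hyI hz hyz⟩
  rw [← hc, himg, Set.InjOn.ncard_image]
  refine hmono.injOn.mono ?_
  rintro y ⟨hy, hyz⟩
  exact ⟨(eigenvalues_subset_Icc hp₀ hp₁ _ hy).1, hyz.le.trans hz.2⟩

/-! ### Growth of the renormalized eigenvalues -/

theorem eigenvalue_mem_Icc (hp₀ : 0 < p) (hp₁ : p < 1 / 2) {n k : ℕ} (hk : k ≤ 3 ^ n) :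
    eigenvalue p n k ∈ Set.Icc (0 : ℝ) 2 :=
  eigenvalues_subset_Icc hp₀ hp₁ n (eigenvalue_spec hp₀ hp₁ hk).1

/-- On `[0, p]` the factors satisfy `1+p-z ≥ 1` and `2-p-z ≥ 2q`, so `R(z) ≥ 2z/p`. The ratio `p/2`
drives the geometric series for the eigenfunctions and produces the constant `p/(2-p)`. -/
theorem eigenvalue_succ_le (hp₀ : 0 < p) (hp₁ : p < 1 / 2) {n k : ℕ} (hk : k ≤ 3 ^ n) :
    eigenvalue p (n + 1) k ≤ p / 2 * eigenvalue p n k := by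
  obtain ⟨⟨h0, h1⟩, h⟩ := eigenvalue_succ hp₀ hp₁ hk
  rw [← h]
  set z := eigenvalue p (n + 1) k
  have hq : 0 < 1 - p := by linarith
  have h2 : 1 * (2 - 2 * p) ≤ (1 + p - z) * (2 - p - z) :=
    mul_le_mul (by linarith) (by linarith) (by linarith) (by linarith)
  have h3 := mul_le_mul_of_nonneg_left h2 h0
  have : p / 2 * decimation p z = z * ((1 + p - z) * (2 - p - z)) / (2 * (1 - p)) := by
    rw [decimation]; field_simp
  rw [this, le_div_iff₀ (by positivity)]
  linarith

theorem renorm_pos (hp₀ : 0 < p) (hp₁ : p < 1 / 2) : 0 < renorm p := by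
  have hq : 0 < 1 - p := by linarith
  unfold renorm; positivity

/-- The constant `C₀` is the derivative of the polynomial at `0`, since `(1+p)(2-p) = 2 + pq`; the
remaining terms are nonpositive on `[0, p]`. -/
theorem decimation_le (hp₀ : 0 < p) (hp₁ : p < 1 / 2) {z : ℝ} (hz : z ∈ Set.Icc 0 p) :
    decimation p z ≤ renorm p * z := by
  have hq : 0 < 1 - p := by linarith
  have : renorm p * z = z * (2 + p * (1 - p)) / (p * (1 - p)) := by
    rw [renorm]; field_simp; ring
  rw [this, decimation]
  refine div_le_div_of_nonneg_right ?_ (by positivity)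
  rw [mul_assoc]
  refine mul_le_mul_of_nonneg_left ?_ hz.1
  nlinarith [hz.1, hz.2]

theorem le_decimation (hp₀ : 0 < p) (hp₁ : p < 1 / 2) {z : ℝ} (hz : z ∈ Set.Icc 0 p) :
    renorm p * z ≤ decimation p z * (1 + 5 * z) := by
  have hq : 0 < 1 - p := by linarith
  have : renorm p * z = z * (2 + p * (1 - p)) / (p * (1 - p)) := by
    rw [renorm]; field_simp; ring
  rw [this, decimation, div_mul_eq_mul_div]
  refine div_le_div_of_nonneg_right ?_ (by positivity)
  rw [mul_assoc, mul_assoc]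
  refine mul_le_mul_of_nonneg_left ?_ hz.1
  -- This is the difference `(1+p-z)(2-p-z)(1+5z) - (2+pq)`. The constant 5 is large enough to give
  -- `7 - 14z`, which is nonnegative for `z ≤ 1/2`.
  have h1 : 0 ≤ z * (7 - 14 * z + 5 * (p * (1 - p)) + 5 * z ^ 2) := by
    refine mul_nonneg hz.1 ?_
    have : 0 ≤ p * (1 - p) := by positivity
    nlinarith [hz.2, sq_nonneg z]
  linarith

theorem le_three_pow_of_le {k n₀ n : ℕ} (hk : k ≤ 3 ^ n₀) (hn : n₀ ≤ n) : k ≤ 3 ^ n :=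
  hk.trans (Nat.pow_le_pow_right (by norm_num) hn)

theorem renorm_pow_mul_eigenvalue_le_succ (hp₀ : 0 < p) (hp₁ : p < 1 / 2) {n k : ℕ}
    (hk : k ≤ 3 ^ n) :
    renorm p ^ n * eigenvalue p n k ≤ renorm p ^ (n + 1) * eigenvalue p (n + 1) k := by
  obtain ⟨hz, h⟩ := eigenvalue_succ hp₀ hp₁ hk
  rw [← h, pow_succ, mul_assoc]
  exact mul_le_mul_of_nonneg_left (decimation_le hp₀ hp₁ hz)
    (pow_nonneg (renorm_pos hp₀ hp₁).le _)

/-- The weight `exp (2 λ)` turns the increasing sequence `C₀ⁿ λ_{n,k}` into a decreasing one and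
thereby bounds it. A step costs a factor at most `1 + 5z ≤ exp (5z)`, and `5z + 2z ≤ 2 λ_{n,k}`
because `z ≤ (p/2) λ_{n,k} ≤ λ_{n,k}/4`. -/
theorem renorm_pow_mul_eigenvalue_succ_le (hp₀ : 0 < p) (hp₁ : p < 1 / 2) {n k : ℕ}
    (hk : k ≤ 3 ^ n) :
    renorm p ^ (n + 1) * eigenvalue p (n + 1) k * Real.exp (2 * eigenvalue p (n + 1) k) ≤
      renorm p ^ n * eigenvalue p n k * Real.exp (2 * eigenvalue p n k) := by
  obtain ⟨hz, h⟩ := eigenvalue_succ hp₀ hp₁ hk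
  have h1 := eigenvalue_succ_le hp₀ hp₁ hk
  have h0 := (eigenvalue_mem_Icc hp₀ hp₁ hk).1
  have hC := pow_nonneg (renorm_pos hp₀ hp₁).le n
  have h2 := le_decimation hp₀ hp₁ hz
  rw [h] at h2
  set z := eigenvalue p (n + 1) k
  set l := eigenvalue p n k
  have h3 : 1 + 5 * z ≤ Real.exp (5 * z) := by linarith [Real.add_one_le_exp (5 * z)]
  calc renorm p ^ (n + 1) * z * Real.exp (2 * z)
      = renorm p ^ n * (renorm p * z) * Real.exp (2 * z) := by ring
    _ ≤ renorm p ^ n * (l * Real.exp (5 * z)) * Real.exp (2 * z) := by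
        refine mul_le_mul_of_nonneg_right (mul_le_mul_of_nonneg_left ?_ hC) (Real.exp_pos _).le
        exact h2.trans (mul_le_mul_of_nonneg_left h3 h0)
    _ = renorm p ^ n * l * Real.exp (7 * z) := by
        rw [show 7 * z = 5 * z + 2 * z by ring, Real.exp_add]; ring
    _ ≤ _ := by
        refine mul_le_mul_of_nonneg_left (Real.exp_le_exp.2 ?_) (mul_nonneg hC h0)
        nlinarith

/-- The renormalized eigenvalues converge. -/
theorem exists_tendsto_renorm_pow_mul_eigenvalue (hp₀ : 0 < p) (hp₁ : p < 1 / 2) {n₀ k : ℕ}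
    (hk : k ≤ 3 ^ n₀) :
    ∃ lam, 0 ≤ lam ∧ Tendsto (fun n => renorm p ^ n * eigenvalue p n k) atTop (𝓝 lam) := by
  set a : ℕ → ℝ := fun m => renorm p ^ (m + n₀) * eigenvalue p (m + n₀) k with ha
  have hkm : ∀ m, k ≤ 3 ^ (m + n₀) := fun m => le_three_pow_of_le hk (Nat.le_add_left _ _)
  have hnn : ∀ m, 0 ≤ a m := fun m =>
    mul_nonneg (pow_nonneg (renorm_pos hp₀ hp₁).le _) (eigenvalue_mem_Icc hp₀ hp₁ (hkm m)).1
  have hmono : Monotone a := monotone_nat_of_le_succ fun m => by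
    have := renorm_pow_mul_eigenvalue_le_succ hp₀ hp₁ (hkm m)
    simpa only [ha, Nat.add_right_comm] using this
  have hanti : Antitone fun m => a m * Real.exp (2 * eigenvalue p (m + n₀) k) :=
    antitone_nat_of_succ_le fun m => by
      have := renorm_pow_mul_eigenvalue_succ_le hp₀ hp₁ (hkm m)
      simpa only [ha, Nat.add_right_comm] using this
  have hbdd : BddAbove (Set.range a) := by
    refine ⟨a 0 * Real.exp (2 * eigenvalue p (0 + n₀) k), ?_⟩
    rintro _ ⟨m, rfl⟩
    refine le_trans ?_ (hanti (Nat.zero_le m))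
    refine le_mul_of_one_le_right (hnn m) (Real.one_le_exp ?_)
    linarith [(eigenvalue_mem_Icc hp₀ hp₁ (hkm m)).1]
  have ht := tendsto_atTop_ciSup hmono hbdd
  exact ⟨_, ge_of_tendsto' ht hnn, (tendsto_add_atTop_iff_nat n₀).1 ht⟩

/-! ### Sequences of eigenfunctions -/

/-- Bound for decimated functions. -/
theorem IsDecimated.abs_le (hp₀ : 0 < p) (hp₁ : p < 1 / 2) {z : ℝ} (hz : z ∈ Set.Icc 0 p) {n : ℕ}
    {f : ℝ → ℝ} (h : IsDecimated p z n f) {M : ℝ} (hM : ∀ x ∈ vertices p n, |f x| ≤ M) {x : ℝ}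
    (hx : x ∈ vertices p (n + 1)) : |f x| ≤ (1 - p) / (1 - p - z) * M := by
  have hM0 : 0 ≤ M := (abs_nonneg _).trans (hM 0 (zero_mem_vertices p n))
  have hq : 0 < 1 - p := by linarith
  have hz1 : 0 < 1 - p - z := by linarith [hz.2]
  have hz2 : 0 < 1 + p - z := by linarith [hz.2]
  have hz3 : 0 ≤ 1 - z := by linarith [hz.2]
  have key : ∀ a b : ℝ, |a| ≤ M → |b| ≤ M →
      |((1 - p) * (1 - z) * a + p * (1 - p) * b) / ((1 - p - z) * (1 + p - z))| ≤
        (1 - p) / (1 - p - z) * M := by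
    intro a b ha hb
    -- Both coefficients in the decimation formula are nonnegative, and their sum is `q/(q-z)`.
    have e : (1 - p) / (1 - p - z) * M =
        ((1 - p) * (1 - z) * M + p * (1 - p) * M) / ((1 - p - z) * (1 + p - z)) := by
      field_simp; ring
    rw [e, abs_div, abs_of_pos (mul_pos hz1 hz2)]
    refine div_le_div_of_nonneg_right ((abs_add_le _ _).trans ?_) (mul_pos hz1 hz2).le
    rw [abs_mul _ a, abs_mul _ b, abs_of_nonneg (mul_nonneg hq.le hz3),
      abs_of_nonneg (mul_nonneg hp₀.le hq.le)]
    gcongr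
  rcases vertices_succ_eq hp₀ hx with hx | ⟨w, rfl | rfl⟩
  · refine (hM x hx).trans (le_mul_of_one_le_left hM0 ?_)
    rw [one_le_div hz1]; linarith [hz.1]
  · rw [(h w).1]
    exact key _ _ (hM _ (cellMap_zero_mem_vertices w)) (hM _ (cellMap_one_mem_vertices w))
  · rw [(h w).2]
    exact key _ _ (hM _ (cellMap_one_mem_vertices w)) (hM _ (cellMap_zero_mem_vertices w))

namespace IsEigenfunctionSequence

variable {k n₀ : ℕ} {f : ℕ → ℝ → ℝ}

theorem isDecimated (hp₀ : 0 < p) (hf : IsEigenfunctionSequence p k n₀ f) {n : ℕ} (hn : n₀ ≤ n) :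
    IsDecimated p (eigenvalue p (n + 1) k) n (f (n + 1)) := fun w => by
  rw [hf.extends_prev n hn _ (cellMap_zero_mem_vertices w),
    hf.extends_prev n hn _ (cellMap_one_mem_vertices w), ← contraction_two_zero hp₀]
  exact ⟨hf.left_point n hn w, hf.right_point n hn w⟩

theorem isEigenfunction (hp₀ : 0 < p) (hp₁ : p < 1 / 2) (hk : k ≤ 3 ^ n₀)
    (hf : IsEigenfunctionSequence p k n₀ f) {n : ℕ} (hn : n₀ ≤ n) :
    IsEigenfunction p n (eigenvalue p n k) (f n) := by
  induction n, hn using Nat.le_induction with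
  | base => exact hf.base
  | succ n hn ih =>
    obtain ⟨hz, h⟩ := eigenvalue_succ hp₀ hp₁ (le_three_pow_of_le hk hn)
    refine (hf.isDecimated hp₀ hn).isEigenfunction_succ hp₀ hp₁
      (mul_ne_zero (by linarith [hz.2]) (by linarith [hz.2])) ?_
    rw [h]
    exact ih.congr fun x hx => (hf.extends_prev n hn x hx).symm

theorem eq_of_le (hp₀ : 0 < p) (hf : IsEigenfunctionSequence p k n₀ f) {n m : ℕ} (hn : n₀ ≤ n)
    (hm : n ≤ m) {x : ℝ} (hx : x ∈ vertices p n) : f m x = f n x := by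
  induction m, hm using Nat.le_induction with
  | base => rfl
  | succ m hm ih => rw [hf.extends_prev m (hn.trans hm) x (vertices_mono hp₀ hm hx), ih]

/-- Uniform bound of all later functions of the sequence. -/
theorem abs_le (hp₀ : 0 < p) (hp₁ : p < 1 / 2) (hk : k ≤ 3 ^ n₀)
    (hf : IsEigenfunctionSequence p k n₀ f) {n : ℕ} (hn : n₀ ≤ n) {M : ℝ}
    (hM : ∀ x ∈ vertices p n, |f n x| ≤ M) {m : ℕ} (hm : n ≤ m) {x : ℝ} (hx : x ∈ vertices p m) :
    |f m x| ≤ M * Real.exp (eigenvalue p n k / ((1 - p) - eigenvalue p (n + 1) k) *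
      (p / (2 - p))) := by
  have hM0 : 0 ≤ M := (abs_nonneg _).trans (hM 0 (zero_mem_vertices p n))
  set d := (1 - p) - eigenvalue p (n + 1) k with hd
  have hz1 := (eigenvalue_succ hp₀ hp₁ (le_three_pow_of_le hk hn)).1
  have hd0 : 0 < d := by linarith [hz1.2]
  have h2p : 0 < 2 - p := by linarith
  have hlam0 : ∀ {i}, n₀ ≤ i → 0 ≤ eigenvalue p i k := fun hi =>
    (eigenvalue_mem_Icc hp₀ hp₁ (le_three_pow_of_le hk hi)).1
  have hstep : ∀ {i}, n₀ ≤ i → eigenvalue p (i + 1) k ≤ p / 2 * eigenvalue p i k := fun hi =>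
    eigenvalue_succ_le hp₀ hp₁ (le_three_pow_of_le hk hi)
  -- Later eigenvalues do not exceed `λ_{n+1,k}`, so the fixed number `d = q - λ_{n+1,k}` is a lower
  -- bound for every denominator `q - z`.
  have hanti : ∀ {i}, n ≤ i → eigenvalue p (i + 1) k ≤ eigenvalue p (n + 1) k := by
    intro i hi
    induction i, hi using Nat.le_induction with
    | base => exact le_rfl
    | succ i hi ih =>
      have h1 := hstep (i := i + 1) (by omega)
      have h2 := hlam0 (i := i + 1) (by omega)
      nlinarith
  -- The exponential weight at level `m` bounds all growth factors still to come. It absorbs one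
  -- factor `exp (z/d)` per step, because `1 + p/(2-p) = 2/(2-p)` and `2z ≤ p λ_{m,k}`.
  have key : ∀ x ∈ vertices p m, |f m x| * Real.exp (eigenvalue p m k / d * (p / (2 - p))) ≤
      M * Real.exp (eigenvalue p n k / d * (p / (2 - p))) := by
    clear hx
    induction m, hm using Nat.le_induction with
    | base => exact fun x hx => mul_le_mul_of_nonneg_right (hM x hx) (Real.exp_pos _).le
    | succ m hm ih =>
      intro x hx
      have hnm := hn.trans hm
      obtain ⟨hz, -⟩ := eigenvalue_succ hp₀ hp₁ (le_three_pow_of_le hk hnm)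
      set E := Real.exp (eigenvalue p m k / d * (p / (2 - p)))
      set B := M * Real.exp (eigenvalue p n k / d * (p / (2 - p))) with hB
      have hb := (hf.isDecimated hp₀ hnm).abs_le hp₀ hp₁ hz (M := B / E) (fun y hy => by
        rw [hf.extends_prev m hnm y hy, le_div_iff₀ (Real.exp_pos _)]; exact ih y hy) hx
      have hl := hstep hnm
      have ha := hanti hm
      set z := eigenvalue p (m + 1) k
      have hdz : 0 < 1 - p - z := by linarith
      have h1 : (1 - p) / (1 - p - z) ≤ Real.exp (z / d) := by
        have : (1 - p) / (1 - p - z) = z / (1 - p - z) + 1 := by field_simp; ring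
        rw [this]
        refine le_trans ?_ (Real.add_one_le_exp _)
        gcongr
        · exact hz.1
        · linarith
      have h2 : z / d + z / d * (p / (2 - p)) ≤ eigenvalue p m k / d * (p / (2 - p)) := by
        have e1 : z / d + z / d * (p / (2 - p)) = (2 * z) / (d * (2 - p)) := by field_simp; ring
        have e2 : eigenvalue p m k / d * (p / (2 - p)) = (eigenvalue p m k * p) / (d * (2 - p)) := by
          field_simp
        rw [e1, e2]
        refine div_le_div_of_nonneg_right (by linarith) (by positivity)
      have hB0 : 0 ≤ B / E := div_nonneg (mul_nonneg hM0 (Real.exp_pos _).le) (Real.exp_pos _).le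
      calc |f (m + 1) x| * Real.exp (z / d * (p / (2 - p)))
          ≤ (Real.exp (z / d) * (B / E)) * Real.exp (z / d * (p / (2 - p))) := by
            refine mul_le_mul_of_nonneg_right (hb.trans ?_) (Real.exp_pos _).le
            exact mul_le_mul_of_nonneg_right h1 hB0
        _ = (B / E) * Real.exp (z / d + z / d * (p / (2 - p))) := by rw [Real.exp_add]; ring
        _ ≤ (B / E) * E := mul_le_mul_of_nonneg_left (Real.exp_le_exp.2 h2) hB0
        _ = B := div_mul_cancel₀ _ (Real.exp_pos _).ne'
  refine le_trans (le_mul_of_one_le_right (abs_nonneg _) (Real.one_le_exp ?_)) (key x hx)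
  exact mul_nonneg (div_nonneg (hlam0 (hn.trans hm)) hd0.le) (div_nonneg hp₀.le h2p.le)

end IsEigenfunctionSequence

/-! ### Harmonic extension: piecewise linear interpolation -/

/-- The piecewise linear interpolation of the values of `f` on `V_n`. -/
def interpolation (p : ℝ) : ℕ → (ℝ → ℝ) → ℝ → ℝ
  | 0, f => fun x => f 0 + x * (f 1 - f 0)
  | n + 1, f => glue p fun j => interpolation p n (f ∘ contraction p j)

theorem interpolation_endpoints (hp₀ : 0 < p) (hp₁ : p < 1 / 2) (n : ℕ) (f : ℝ → ℝ) :
    interpolation p n f 0 = f 0 ∧ interpolation p n f 1 = f 1 := by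
  induction n generalizing f with
  | zero => simp [interpolation]
  | succ n ih =>
    have h01 : interpolation p n (f ∘ contraction p 0) 1 =
        interpolation p n (f ∘ contraction p 1) 0 := by
      rw [(ih _).1, (ih _).2, Function.comp_apply, Function.comp_apply, contraction_one_zero hp₀]
    have h12 : interpolation p n (f ∘ contraction p 1) 1 =
        interpolation p n (f ∘ contraction p 2) 0 := by
      rw [(ih _).1, (ih _).2, Function.comp_apply, Function.comp_apply, contraction_two_zero hp₀]
    constructor
    · conv_lhs => rw [← contraction_zero_zero p]
      rw [interpolation, glue_contraction hp₀ hp₁ h01 h12 0 (by simp), (ih _).1,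
        Function.comp_apply, contraction_zero_zero]
    · conv_lhs => rw [← contraction_two_one hp₀]
      rw [interpolation, glue_contraction hp₀ hp₁ h01 h12 2 (by simp), (ih _).2,
        Function.comp_apply, contraction_two_one hp₀]

theorem interpolation_left_compat (hp₀ : 0 < p) (hp₁ : p < 1 / 2) (n : ℕ) (f : ℝ → ℝ) :
    interpolation p n (f ∘ contraction p 0) 1 = interpolation p n (f ∘ contraction p 1) 0 := by
  rw [(interpolation_endpoints hp₀ hp₁ _ _).1, (interpolation_endpoints hp₀ hp₁ _ _).2,
    Function.comp_apply, Function.comp_apply, contraction_one_zero hp₀]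

theorem interpolation_right_compat (hp₀ : 0 < p) (hp₁ : p < 1 / 2) (n : ℕ) (f : ℝ → ℝ) :
    interpolation p n (f ∘ contraction p 1) 1 = interpolation p n (f ∘ contraction p 2) 0 := by
  rw [(interpolation_endpoints hp₀ hp₁ _ _).1, (interpolation_endpoints hp₀ hp₁ _ _).2,
    Function.comp_apply, Function.comp_apply, contraction_two_zero hp₀]

theorem continuous_interpolation (hp₀ : 0 < p) (hp₁ : p < 1 / 2) (n : ℕ) (f : ℝ → ℝ) :
    Continuous (interpolation p n f) := by
  induction n generalizing f with
  | zero => simp only [interpolation]; fun_prop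
  | succ n ih =>
    exact continuous_glue hp₀ hp₁ (interpolation_left_compat hp₀ hp₁ n f)
      (interpolation_right_compat hp₀ hp₁ n f) fun j => ih _

theorem interpolation_contraction (hp₀ : 0 < p) (hp₁ : p < 1 / 2) (n : ℕ) (f : ℝ → ℝ) (j : Fin 3)
    {x : ℝ} (hx : x ∈ Set.Icc (0 : ℝ) 1) :
    interpolation p (n + 1) f (contraction p j x) =
      interpolation p n (f ∘ contraction p j) x :=
  glue_contraction hp₀ hp₁ (interpolation_left_compat hp₀ hp₁ n f)
    (interpolation_right_compat hp₀ hp₁ n f) j hx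

theorem interpolation_cellMap (hp₀ : 0 < p) (hp₁ : p < 1 / 2) (m : ℕ) {n : ℕ} (w : Fin n → Fin 3)
    (f : ℝ → ℝ) {x : ℝ} (hx : x ∈ Set.Icc (0 : ℝ) 1) :
    interpolation p (m + n) f (cellMap p w x) = interpolation p m (f ∘ cellMap p w) x := by
  induction n generalizing f with
  | zero => rfl
  | succ n ih =>
    rw [cellMap, ← add_assoc, interpolation_contraction hp₀ hp₁ _ _ _
      (cellMap_mem_Icc hp₀ hp₁ _ hx), ih]
    rfl

theorem interpolation_cellMap_eq (hp₀ : 0 < p) (hp₁ : p < 1 / 2) {n : ℕ} (w : Fin n → Fin 3)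
    (f : ℝ → ℝ) {x : ℝ} (hx : x ∈ Set.Icc (0 : ℝ) 1) :
    interpolation p n f (cellMap p w x) =
      f (cellMap p w 0) + x * (f (cellMap p w 1) - f (cellMap p w 0)) := by
  have := interpolation_cellMap hp₀ hp₁ 0 w f hx
  rwa [zero_add] at this

theorem interpolation_of_mem (hp₀ : 0 < p) (hp₁ : p < 1 / 2) {n : ℕ} (f : ℝ → ℝ) {x : ℝ}
    (hx : x ∈ vertices p n) : interpolation p n f x = f x := by
  obtain ⟨w, rfl | rfl⟩ := mem_vertices_iff.1 hx <;>
    rw [interpolation_cellMap_eq hp₀ hp₁ _ _ (by simp)] <;> ring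

/-! ### Energy of piecewise linear functions -/

theorem discreteEnergy_congr (hp₀ : 0 < p) {n : ℕ} {f g : ℝ → ℝ}
    (h : ∀ x ∈ vertices p n, f x = g x) : discreteEnergy p n f = discreteEnergy p n g := by
  induction n generalizing f g with
  | zero =>
    rw [discreteEnergy, discreteEnergy, h 0 (zero_mem_vertices p 0), h 1 (one_mem_vertices hp₀ 0)]
  | succ n ih =>
    rw [discreteEnergy, discreteEnergy]
    refine Finset.sum_congr rfl fun j _ => ?_
    rw [ih (f := f ∘ contraction p j) (g := g ∘ contraction p j)
      fun x hx => h _ (contraction_mem_vertices j hx)]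

theorem sum_resistance (hp₀ : 0 < p) : ∑ j, resistance p j = 1 := by
  have : (1 + p) ≠ 0 := by positivity
  rw [Fin.sum_univ_three]
  simp [resistance]
  field_simp
  ring

/-- One refinement is the Cauchy–Schwarz inequality in Sedrakyan's form: three resistors in series
of total resistance `∑ r_j = 1` dissipate at least the square of the total increment. -/
theorem discreteEnergy_le_succ (hp₀ : 0 < p) (hp₁ : p < 1 / 2) (n : ℕ) (f : ℝ → ℝ) :
    discreteEnergy p n f ≤ discreteEnergy p (n + 1) f := by
  induction n generalizing f with
  | zero =>
    have h := Finset.sq_sum_div_le_sum_sq_div Finset.univ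
      (fun j => f (contraction p j 1) - f (contraction p j 0))
      (fun j _ => resistance_pos hp₀ hp₁ j)
    rw [sum_resistance hp₀, div_one, Fin.sum_univ_three, contraction_zero_zero,
      contraction_one_zero hp₀, contraction_two_zero hp₀, contraction_two_one hp₀] at h
    simp only [discreteEnergy, Function.comp_apply, inv_mul_eq_div]
    refine le_trans (le_of_eq ?_) h
    ring
  | succ n ih =>
    rw [discreteEnergy, discreteEnergy]
    exact Finset.sum_le_sum fun j _ =>
      mul_le_mul_of_nonneg_left (ih _) (inv_pos.2 (resistance_pos hp₀ hp₁ j)).le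

theorem discreteEnergy_affine (hp₀ : 0 < p) (hp₁ : p < 1 / 2) (n : ℕ) (c d : ℝ) :
    discreteEnergy p n (fun x => c * x + d) = c ^ 2 := by
  induction n generalizing c d with
  | zero => simp [discreteEnergy]
  | succ n ih =>
    have key : ∀ j, ((fun x => c * x + d) ∘ contraction p j) =
        fun x => (c * resistance p j) * x + (c * contraction p j 0 + d) := fun j => by
      funext x; rw [Function.comp_apply, contraction_affine]; ring
    have : ∀ j, (resistance p j)⁻¹ * (c * resistance p j) ^ 2 = c ^ 2 * resistance p j :=
      fun j => by have := (resistance_pos hp₀ hp₁ j).ne'; field_simp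
    simp only [discreteEnergy, key, ih, this, ← Finset.mul_sum, sum_resistance hp₀, mul_one]

/-- The interpolation is affine on each level-`n` cell, and the energy of an affine function does
not change under refinement. At coarser levels the bound is monotonicity of the discrete energies.
-/
theorem discreteEnergy_interpolation_le (hp₀ : 0 < p) (hp₁ : p < 1 / 2) (n m : ℕ) (f : ℝ → ℝ) :
    discreteEnergy p m (interpolation p n f) ≤ discreteEnergy p n f := by
  induction n generalizing m f with
  | zero =>
    have : interpolation p 0 f = fun x => (f 1 - f 0) * x + f 0 := by
      funext x; simp only [interpolation]; ring
    rw [this, discreteEnergy_affine hp₀ hp₁, discreteEnergy]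
  | succ n ih =>
    cases m with
    | zero =>
      have : discreteEnergy p 0 (interpolation p (n + 1) f) = discreteEnergy p 0 f := by
        simp only [discreteEnergy, (interpolation_endpoints hp₀ hp₁ _ _).1,
          (interpolation_endpoints hp₀ hp₁ _ _).2]
      rw [this]
      exact monotone_nat_of_le_succ (fun n => discreteEnergy_le_succ hp₀ hp₁ n f) (Nat.zero_le _)
    | succ m =>
      rw [discreteEnergy, discreteEnergy]
      refine Finset.sum_le_sum fun j _ =>
        mul_le_mul_of_nonneg_left ?_ (inv_pos.2 (resistance_pos hp₀ hp₁ j)).le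
      refine le_trans (le_of_eq ?_) (ih m _)
      exact discreteEnergy_congr hp₀ fun x hx =>
        interpolation_contraction hp₀ hp₁ n f j (vertices_subset_Icc hp₀ hp₁ m hx)

/-- The piecewise linear interpolation is the harmonic extension. -/
theorem isHarmonicExtension_interpolation (hp₀ : 0 < p) (hp₁ : p < 1 / 2) (n : ℕ) (f : ℝ → ℝ) :
    IsHarmonicExtension p n f (interpolation p n f) := by
  refine ⟨(continuous_interpolation hp₀ hp₁ n f).continuousOn,
    fun x hx => interpolation_of_mem hp₀ hp₁ f hx, fun h' _ hh' => ?_⟩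
  refine iSup_le fun m => le_iSup_of_le n (ENNReal.ofReal_le_ofReal ?_)
  rw [discreteEnergy_congr hp₀ hh']
  exact discreteEnergy_interpolation_le hp₀ hp₁ n m f

/-- Refining the interpolation by one level changes it at most by the error at the new vertices. -/
theorem abs_interpolation_succ_sub_le (hp₀ : 0 < p) (hp₁ : p < 1 / 2) {n : ℕ} {f g : ℝ → ℝ}
    {ε : ℝ} (hfg : ∀ x ∈ vertices p n, g x = f x)
    (h : ∀ w : Fin n → Fin 3,
      |g (cellMap p w (contraction p 0 1)) - (f (cellMap p w 0) +
          contraction p 0 1 * (f (cellMap p w 1) - f (cellMap p w 0)))| ≤ ε ∧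
        |g (cellMap p w (contraction p 1 1)) - (f (cellMap p w 0) +
          contraction p 1 1 * (f (cellMap p w 1) - f (cellMap p w 0)))| ≤ ε)
    {x : ℝ} (hx : x ∈ Set.Icc (0 : ℝ) 1) :
    |interpolation p (n + 1) g x - interpolation p n f x| ≤ ε := by
  obtain ⟨w, y, hy, rfl⟩ := exists_cellMap hp₀ hp₁ n hx
  obtain ⟨j, t, ht, rfl⟩ := exists_contraction hp₀ hp₁ hy
  rw [interpolation_cellMap_eq hp₀ hp₁ w f hy, add_comm n 1, interpolation_cellMap hp₀ hp₁ 1 w g hy,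
    interpolation_contraction hp₀ hp₁ 0 _ _ ht]
  simp only [interpolation, Function.comp_apply]
  obtain ⟨h1, h2⟩ := h w
  have hε : 0 ≤ ε := (abs_nonneg _).trans h1
  -- The difference of the interpolants is affine between consecutive vertices of `V_{n+1}`, hence a
  -- convex combination of two values of `e`, and `e` vanishes at the ends of the level-`n` cell.
  set e : ℝ → ℝ := fun s => g (cellMap p w s) - (f (cellMap p w 0) +
          s * (f (cellMap p w 1) - f (cellMap p w 0))) with he
  have e0 : e 0 = 0 := by simp [he, hfg _ (cellMap_zero_mem_vertices w)]
  have e1 : e 1 = 0 := by simp [he, hfg _ (cellMap_one_mem_vertices w)]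
  have key : ∀ a b, |a| ≤ ε → |b| ≤ ε → |(1 - t) * a + t * b| ≤ ε := fun a b ha hb => by
    have := abs_add_le ((1 - t) * a) (t * b)
    rw [abs_mul, abs_mul, abs_of_nonneg ht.1, abs_of_nonneg (sub_nonneg.2 ht.2)] at this
    have h3 := mul_le_mul_of_nonneg_left ha (sub_nonneg.2 ht.2)
    have h4 := mul_le_mul_of_nonneg_left hb ht.1
    linarith
  have hb : |e (contraction p j 0)| ≤ ε ∧ |e (contraction p j 1)| ≤ ε := by
    fin_cases j
    · simp only [Fin.zero_eta, contraction_zero_zero, e0, abs_zero]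
      exact ⟨hε, h1⟩
    · simp only [Fin.mk_one, contraction_one_zero hp₀]
      exact ⟨h1, h2⟩
    · simp only [Fin.reduceFinMk, contraction_two_zero hp₀, contraction_two_one hp₀, e1, abs_zero]
      exact ⟨h2, hε⟩
  refine le_trans (le_of_eq (congrArg _ ?_)) (key _ _ hb.1 hb.2)
  simp only [he]
  rw [contraction_affine p j t, contraction_affine p j 1]
  ring

/-- The decimation formulas are close to linear interpolation. -/
theorem IsDecimated.abs_interpolation_sub_le (hp₀ : 0 < p) (hp₁ : p < 1 / 2) {z : ℝ}
    (hz : z ∈ Set.Icc 0 p) {n : ℕ} {f g : ℝ → ℝ} (hfg : ∀ x ∈ vertices p n, g x = f x)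
    (h : IsDecimated p z n g) {M : ℝ} (hM : ∀ x ∈ vertices p n, |f x| ≤ M) {x : ℝ}
    (hx : x ∈ Set.Icc (0 : ℝ) 1) :
    |interpolation p (n + 1) g x - interpolation p n f x| ≤ z / (1 - 2 * p) * M := by
  have hM0 : 0 ≤ M := (abs_nonneg _).trans (hM 0 (zero_mem_vertices p n))
  have hq : 0 < 1 - p := by linarith
  have hz1 : 0 < 1 - p - z := by linarith [hz.2]
  have hz2 : 0 < 1 + p - z := by linarith [hz.2]
  have h2p : 0 < 1 - 2 * p := by linarith
  have hz0 := hz.1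
  have key : ∀ a b : ℝ, |a| ≤ M → |b| ≤ M →
      |((1 - p) * (1 - z) * a + p * (1 - p) * b) / ((1 - p - z) * (1 + p - z)) -
        (a + p * b) / (1 + p)| ≤ z / (1 - 2 * p) * M := by
    intro a b ha hb
    -- The linear interpolant `(a + p b)/(1+p)` is the decimation formula at `z = 0`, which explains
    -- the factor `z`. The coefficients `1+p²-z` and `p(2-z)` add up to `(1+p)(1+p-z)`, leaving
    -- `z/(q-z) ≤ z/(1-2p)`.
    have e : ((1 - p) * (1 - z) * a + p * (1 - p) * b) / ((1 - p - z) * (1 + p - z)) -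
        (a + p * b) / (1 + p) = z / ((1 - p - z) * (1 + p - z) * (1 + p)) *
          ((1 + p ^ 2 - z) * a + p * (2 - z) * b) := by
      field_simp; ring
    have e2 : z / (1 - p - z) * M = z / ((1 - p - z) * (1 + p - z) * (1 + p)) *
        ((1 + p ^ 2 - z) * M + p * (2 - z) * M) := by
      field_simp; ring
    have h1 : 0 ≤ 1 + p ^ 2 - z := by nlinarith [hz.2]
    have h2 : 0 ≤ p * (2 - z) := mul_nonneg hp₀.le (by linarith [hz.2])
    have h3 : z / (1 - p - z) * M ≤ z / (1 - 2 * p) * M := by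
      refine mul_le_mul_of_nonneg_right (div_le_div_of_nonneg_left hz0 h2p ?_) hM0
      linarith [hz.2]
    refine le_trans ?_ h3
    rw [e, e2, abs_mul, abs_of_nonneg (div_nonneg hz0 (by positivity))]
    refine mul_le_mul_of_nonneg_left ((abs_add_le _ _).trans ?_) (div_nonneg hz0 (by positivity))
    rw [abs_mul _ a, abs_mul _ b, abs_of_nonneg h1, abs_of_nonneg h2]
    gcongr
  refine abs_interpolation_succ_sub_le hp₀ hp₁ hfg (fun w => ?_) hx
  have h0 := hM _ (cellMap_zero_mem_vertices w)
  have h1 := hM _ (cellMap_one_mem_vertices w)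
  rw [(h w).1, (h w).2, hfg _ (cellMap_zero_mem_vertices w), hfg _ (cellMap_one_mem_vertices w)]
  have hp1 : (1 + p) ≠ 0 := by positivity
  constructor
  · convert key _ _ h0 h1 using 3
    rw [contraction_zero]; field_simp; ring
  · convert key _ _ h1 h0 using 3
    rw [contraction_one hp₀]; field_simp; ring

/-- Uniform convergence of a sequence of functions with geometrically small increments. -/
theorem exists_tendstoUniformlyOn_of_le_geometric {F : ℕ → ℝ → ℝ} {s : Set ℝ} {C r : ℝ}
    (hr₀ : 0 ≤ r) (hr₁ : r < 1) (h : ∀ n, ∀ x ∈ s, |F (n + 1) x - F n x| ≤ C * r ^ n) :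
    ∃ G : ℝ → ℝ, TendstoUniformlyOn F G atTop s := by
  have h' : ∀ x ∈ s, ∀ n, dist (F n x) (F (n + 1) x) ≤ C * r ^ n := fun x hx n => by
    rw [dist_comm, Real.dist_eq]; exact h n x hx
  choose! G hG using fun x hx => cauchySeq_tendsto_of_complete
    (cauchySeq_of_le_geometric r C hr₁ (h' x hx))
  refine ⟨G, Metric.tendstoUniformlyOn_iff.2 fun ε hε => ?_⟩
  have ht : Tendsto (fun n => C * r ^ n / (1 - r)) atTop (𝓝 0) := by
    simpa using ((tendsto_pow_atTop_nhds_zero_of_lt_one hr₀ hr₁).const_mul C).div_const (1 - r)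
  filter_upwards [ht.eventually_lt_const hε] with n hn x hx
  rw [dist_comm]
  exact (dist_le_of_le_geometric_of_tendsto r C hr₁ (h' x hx) (hG x hx) n).trans_lt hn

/-! ### Existence of the self-similar measure -/

theorem sum_massWeight (hp₁ : p < 1 / 2) : ∑ j, massWeight p j = 1 := by
  have : (1 + (1 - p)) ≠ 0 := by linarith
  rw [Fin.sum_univ_three]
  simp [massWeight]
  field_simp
  ring

theorem massWeight_le (hp₁ : p < 1 / 2) (j : Fin 3) : massWeight p j ≤ massWeight p 0 := by
  have h : 0 < 1 + (1 - p) := by linarith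
  fin_cases j
  · exact le_rfl
  · simp only [massWeight, Fin.mk_one, Matrix.cons_val_one, Matrix.cons_val_zero]
    gcongr
    linarith
  · exact (massWeight_two p).le

theorem massWeight_lt_one (hp₁ : p < 1 / 2) : massWeight p 0 < 1 := by
  have h : 0 < 1 + (1 - p) := by linarith
  simp only [massWeight, Matrix.cons_val_zero]
  rw [div_lt_one h]; linarith

/-- Approximations of the distribution function of the self-similar measure. -/
def cdfApprox (p : ℝ) : ℕ → ℝ → ℝ
  | 0 => fun x => max 0 (min x 1)
  | n + 1 => fun x => ∑ j, massWeight p j * cdfApprox p n (contractionInv p j x)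

theorem contractionInv_nonpos (hp₀ : 0 < p) (hp₁ : p < 1 / 2) (j : Fin 3) {x : ℝ} (hx : x ≤ 0) :
    contractionInv p j x ≤ 0 := by
  rw [contractionInv_le_iff hp₀ hp₁]
  exact hx.trans (contraction_mem_Icc hp₀ hp₁ j (x := 0) (by simp)).1

theorem one_le_contractionInv (hp₀ : 0 < p) (hp₁ : p < 1 / 2) (j : Fin 3) {x : ℝ} (hx : 1 ≤ x) :
    1 ≤ contractionInv p j x := by
  rw [le_contractionInv_iff hp₀ hp₁]
  exact (contraction_mem_Icc hp₀ hp₁ j (x := 1) (by simp)).2.trans hx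

theorem cdfApprox_of_nonpos (hp₀ : 0 < p) (hp₁ : p < 1 / 2) (n : ℕ) {x : ℝ} (hx : x ≤ 0) :
    cdfApprox p n x = 0 := by
  induction n generalizing x with
  | zero => simp only [cdfApprox]; rw [min_eq_left (by linarith), max_eq_left hx]
  | succ n ih =>
    refine Finset.sum_eq_zero fun j _ => ?_
    rw [ih (contractionInv_nonpos hp₀ hp₁ j hx), mul_zero]

theorem cdfApprox_of_one_le (hp₀ : 0 < p) (hp₁ : p < 1 / 2) (n : ℕ) {x : ℝ} (hx : 1 ≤ x) :
    cdfApprox p n x = 1 := by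
  induction n generalizing x with
  | zero => simp only [cdfApprox]; rw [min_eq_right hx, max_eq_right zero_le_one]
  | succ n ih =>
    rw [← sum_massWeight hp₁]
    refine Finset.sum_congr rfl fun j _ => ?_
    rw [ih (one_le_contractionInv hp₀ hp₁ j hx), mul_one]

theorem monotone_contractionInv (hp₀ : 0 < p) (hp₁ : p < 1 / 2) (j : Fin 3) :
    Monotone (contractionInv p j) := fun x y hxy => by
  rw [contractionInv_le_iff hp₀ hp₁, contraction_contractionInv hp₀ hp₁]; exact hxy

theorem monotone_cdfApprox (hp₀ : 0 < p) (hp₁ : p < 1 / 2) (n : ℕ) :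
    Monotone (cdfApprox p n) := by
  induction n with
  | zero => exact fun x y hxy => max_le_max le_rfl (min_le_min hxy le_rfl)
  | succ n ih =>
    exact fun x y hxy => Finset.sum_le_sum fun j _ => mul_le_mul_of_nonneg_left
      (ih (monotone_contractionInv hp₀ hp₁ j hxy)) (massWeight_pos hp₀ hp₁ j).le

theorem continuous_cdfApprox (p : ℝ) (n : ℕ) : Continuous (cdfApprox p n) := by
  induction n with
  | zero => exact continuous_const.max (continuous_id.min continuous_const)
  | succ n ih =>
    exact continuous_finsetSum _ fun j _ =>
      continuous_const.mul (ih.comp (continuous_contractionInv p j))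

/-- Differences of consecutive iterates vanish outside `(0, 1)`, so at any `x` at most one of the
three terms survives. The iteration therefore contracts these differences by the largest mass weight
`m_0`. -/
theorem abs_cdfApprox_succ_sub_le (hp₀ : 0 < p) (hp₁ : p < 1 / 2) (n : ℕ) (x : ℝ) :
    |cdfApprox p (n + 1) x - cdfApprox p n x| ≤ 1 * massWeight p 0 ^ n := by
  obtain ⟨o1, o2, o3⟩ := contraction_order hp₀ hp₁
  induction n generalizing x with
  | zero =>
    have hI : ∀ n, cdfApprox p n x ∈ Set.Icc (0 : ℝ) 1 := fun n => by
      constructor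
      · rw [← cdfApprox_of_nonpos hp₀ hp₁ n (min_le_right x 0)]
        exact monotone_cdfApprox hp₀ hp₁ n (min_le_left _ _)
      · rw [← cdfApprox_of_one_le hp₀ hp₁ n (le_max_right x 1)]
        exact monotone_cdfApprox hp₀ hp₁ n (le_max_left _ _)
    rw [abs_le]
    constructor <;> linarith [(hI 0).1, (hI 0).2, (hI (0 + 1)).1, (hI (0 + 1)).2]
  | succ n ih =>
    set d : ℝ → ℝ := fun x => cdfApprox p (n + 1) x - cdfApprox p n x with hd
    have hd0 : ∀ {x}, x ≤ 0 → d x = 0 := fun hx => by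
      simp only [hd]; rw [cdfApprox_of_nonpos hp₀ hp₁ _ hx, cdfApprox_of_nonpos hp₀ hp₁ _ hx, sub_self]
    have hd1 : ∀ {x}, 1 ≤ x → d x = 0 := fun hx => by
      simp only [hd]; rw [cdfApprox_of_one_le hp₀ hp₁ _ hx, cdfApprox_of_one_le hp₀ hp₁ _ hx, sub_self]
    have hs : cdfApprox p (n + 1 + 1) x - cdfApprox p (n + 1) x =
        ∑ j, massWeight p j * d (contractionInv p j x) := by
      simp only [hd, mul_sub, Finset.sum_sub_distrib]
      rfl
    have hterm : ∀ j, |massWeight p j * d (contractionInv p j x)| ≤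
        1 * massWeight p 0 ^ (n + 1) := fun j => by
      rw [abs_mul, abs_of_pos (massWeight_pos hp₀ hp₁ j), one_mul, pow_succ']
      have := ih (contractionInv p j x)
      rw [one_mul] at this
      exact mul_le_mul (massWeight_le hp₁ j) this (abs_nonneg _) (massWeight_pos hp₀ hp₁ 0).le
    rw [hs, Fin.sum_univ_three]
    rcases le_total x (contraction p 0 1) with h | h
    · rw [hd0 (x := contractionInv p 1 x), hd0 (x := contractionInv p 2 x)]
      · simpa using hterm 0
      · rw [contractionInv_le_iff hp₀ hp₁, contraction_two_zero hp₀]; linarith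
      · rw [contractionInv_le_iff hp₀ hp₁, contraction_one_zero hp₀]; linarith
    rcases le_total x (contraction p 1 1) with h' | h'
    · rw [hd1 (x := contractionInv p 0 x), hd0 (x := contractionInv p 2 x)]
      · simpa using hterm 1
      · rw [contractionInv_le_iff hp₀ hp₁, contraction_two_zero hp₀]; linarith
      · rwa [le_contractionInv_iff hp₀ hp₁]
    · rw [hd1 (x := contractionInv p 0 x), hd1 (x := contractionInv p 1 x)]
      · simpa using hterm 2
      · rwa [le_contractionInv_iff hp₀ hp₁]
      · rwa [le_contractionInv_iff hp₀ hp₁]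

/-- The distribution function is the uniform limit of the iterates, a continuous fixed point of `G =
∑ m_j G ∘ F_j⁻¹`. Comparing measures on half-lines, this fixed point equation is self-similarity of
the Stieltjes measure of `G`. -/
theorem exists_isSelfSimilarMeasure (hp₀ : 0 < p) (hp₁ : p < 1 / 2) :
    ∃ μ : Measure ℝ, IsSelfSimilarMeasure p μ := by
  obtain ⟨G, hG⟩ := exists_tendstoUniformlyOn_of_le_geometric (s := Set.univ)
    (massWeight_pos hp₀ hp₁ 0).le (massWeight_lt_one hp₁)
    fun n x _ => abs_cdfApprox_succ_sub_le hp₀ hp₁ n x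
  have hlim : ∀ x, Tendsto (fun n => cdfApprox p n x) atTop (𝓝 (G x)) := fun x =>
    hG.tendsto_at (Set.mem_univ x)
  have hmono : Monotone G := fun x y hxy => le_of_tendsto_of_tendsto' (hlim x) (hlim y)
    fun n => monotone_cdfApprox hp₀ hp₁ n hxy
  have hcont : Continuous G := (tendstoUniformlyOn_univ.1 hG).continuous
    (Frequently.of_forall fun n => continuous_cdfApprox p n)
  have h0 : ∀ x ≤ 0, G x = 0 := fun x hx => tendsto_nhds_unique (hlim x) <| by
    simp only [cdfApprox_of_nonpos hp₀ hp₁ _ hx]; exact tendsto_const_nhds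
  have h1 : ∀ x, 1 ≤ x → G x = 1 := fun x hx => tendsto_nhds_unique (hlim x) <| by
    simp only [cdfApprox_of_one_le hp₀ hp₁ _ hx]; exact tendsto_const_nhds
  have hfix : ∀ x, G x = ∑ j, massWeight p j * G (contractionInv p j x) := fun x =>
    tendsto_nhds_unique ((tendsto_add_atTop_iff_nat 1).2 (hlim x))
      (tendsto_finsetSum _ fun j _ => (hlim _).const_mul _)
  let S : StieltjesFunction ℝ := ⟨G, hmono, fun x => hcont.continuousAt.continuousWithinAt⟩
  have hbot : Tendsto S atBot (𝓝 0) := tendsto_const_nhds.congr' <| by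
    filter_upwards [eventually_le_atBot 0] with x hx using (h0 x hx).symm
  have htop : Tendsto S atTop (𝓝 1) := tendsto_const_nhds.congr' <| by
    filter_upwards [eventually_ge_atTop 1] with x hx using (h1 x hx).symm
  have hprob : IsProbabilityMeasure S.measure := S.isProbabilityMeasure hbot htop
  have hIic : ∀ x, S.measure (Set.Iic x) = ENNReal.ofReal (G x) := fun x => by
    rw [S.measure_Iic hbot, sub_zero]
  have hnonneg : ∀ x, 0 ≤ G x := fun x =>
    (h0 _ (min_le_right x 0)) ▸ hmono (min_le_left x 0)
  refine ⟨S.measure, hprob, ?_, ?_⟩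
  · refine measure_mono_null (t := Set.Iic 0 ∪ (Set.Iic 1)ᶜ) (fun x hx => ?_)
      (measure_union_null ?_ ?_)
    · by_contra h
      simp only [Set.mem_union, Set.mem_Iic, Set.mem_compl_iff, not_or, not_le] at h
      exact hx ⟨h.1.le, not_lt.1 h.2⟩
    · rw [hIic, h0 0 le_rfl, ENNReal.ofReal_zero]
    · rw [prob_compl_eq_zero_iff measurableSet_Iic, hIic, h1 1 le_rfl, ENNReal.ofReal_one]
  · refine Measure.ext_of_Iic _ _ fun x => ?_
    have hpre : ∀ j, contraction p j ⁻¹' Set.Iic x = Set.Iic (contractionInv p j x) := fun j => by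
      ext y; simp [le_contractionInv_iff hp₀ hp₁]
    simp only [Measure.coe_finsetSum, Finset.sum_apply, Measure.smul_apply, smul_eq_mul,
      Measure.map_apply (continuous_contraction p _).measurable measurableSet_Iic, hpre, hIic]
    rw [hfix x, ENNReal.ofReal_sum_of_nonneg fun j _ =>
      mul_nonneg (massWeight_pos hp₀ hp₁ j).le (hnonneg _)]
    exact Finset.sum_congr rfl fun j _ => ENNReal.ofReal_mul (massWeight_pos hp₀ hp₁ j).le

/-! ### Integration against a self-similar measure -/

namespace IsSelfSimilarMeasure

theorem restrict_eq (hμ : IsSelfSimilarMeasure p μ) : μ.restrict (Set.Icc 0 1) = μ :=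
  Measure.restrict_eq_self_of_ae_mem (mem_ae_iff.2 hμ.2.1)

theorem integrable (hμ : IsSelfSimilarMeasure p μ) {φ : ℝ → ℝ} (hφ : Continuous φ) :
    Integrable φ μ := by
  have := hμ.1
  rw [← hμ.restrict_eq]
  exact hφ.continuousOn.integrableOn_compact isCompact_Icc

theorem integral_eq_sum (hp₀ : 0 < p) (hp₁ : p < 1 / 2) (hμ : IsSelfSimilarMeasure p μ)
    {φ : ℝ → ℝ} (hφ : Continuous φ) :
    ∫ y, φ y ∂μ = ∑ j, massWeight p j * ∫ y, φ (contraction p j y) ∂μ := by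
  have := hμ.1
  have hint : ∀ j, Integrable φ (ENNReal.ofReal (massWeight p j) • μ.map (contraction p j)) :=
    fun j => ((integrable_map_measure hφ.aestronglyMeasurable
      (continuous_contraction p j).aemeasurable).2
        (hμ.integrable (hφ.comp (continuous_contraction p j)))).smul_measure ENNReal.ofReal_ne_top
  conv_lhs => rw [hμ.2.2]
  rw [integral_finsetSum_measure fun j _ => hint j]
  refine Finset.sum_congr rfl fun j _ => ?_
  rw [integral_smul_measure, integral_map (continuous_contraction p j).aemeasurable
    hφ.aestronglyMeasurable, ENNReal.toReal_ofReal (massWeight_pos hp₀ hp₁ j).le, smul_eq_mul]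

theorem integral_congr (hμ : IsSelfSimilarMeasure p μ) {φ ψ : ℝ → ℝ}
    (h : ∀ y ∈ Set.Icc (0 : ℝ) 1, φ y = ψ y) : ∫ y, φ y ∂μ = ∫ y, ψ y ∂μ := by
  rw [← hμ.restrict_eq]
  exact setIntegral_congr_fun measurableSet_Icc h

theorem integral_affine (hμ : IsSelfSimilarMeasure p μ) (c d : ℝ) :
    ∫ y, (c * y + d) ∂μ = c * ∫ y, y ∂μ + d := by
  have := hμ.1
  rw [integral_add ((hμ.integrable continuous_id').const_mul c) (integrable_const d),
    integral_const_mul, integral_const, probReal_univ, one_smul]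

theorem integral_id (hp₀ : 0 < p) (hp₁ : p < 1 / 2) (hμ : IsSelfSimilarMeasure p μ) :
    ∫ y, y ∂μ = 1 / 2 := by
  have := hμ.1
  have h := hμ.integral_eq_sum hp₀ hp₁ (φ := fun y => y) continuous_id
  have hj : ∀ j, ∫ y, contraction p j y ∂μ =
      resistance p j * ∫ y, y ∂μ + contraction p j 0 := fun j => by
    rw [← hμ.integral_affine]
    exact congrArg (integral μ) (funext (contraction_affine p j))
  simp only [hj, Fin.sum_univ_three] at h
  rw [contraction_zero_zero, contraction_one hp₀, contraction_two hp₀] at h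
  simp only [massWeight, resistance, Matrix.cons_val_zero, Matrix.cons_val_one,
    Matrix.cons_val] at h
  have h1 : (1 + p) ≠ 0 := by positivity
  have h2 : (1 + (1 - p)) ≠ 0 := by linarith
  set I := ∫ y, y ∂μ
  field_simp at h
  -- Self-similarity is a linear equation for the mean. Its coefficient `1 - ∑ m_j r_j = 1 - 3/C₀`
  -- is a positive multiple of `1 - pq`, so the equation has one solution.
  have h3 : (1 - p * (1 - p)) * (2 * I - 1) = 0 := by linear_combination h
  have h4 : (1 - p * (1 - p)) ≠ 0 := by nlinarith
  have := (mul_eq_zero.1 h3).resolve_left h4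
  linarith

end IsSelfSimilarMeasure

/-! ### The Laplacian at the endpoints, and sizes of cells -/

theorem discreteLaplacian_left (hp₀ : 0 < p) (hp₁ : p < 1 / 2) (n : ℕ) (f : ℝ → ℝ) :
    discreteLaplacian p n f 0 = f 0 - f (resistance p 0 ^ n) := by
  induction n generalizing f with
  | zero => simp [discreteLaplacian_zero_left]
  | succ n ih =>
    rw [discreteLaplacian_succ_left hp₀ hp₁, ih, Function.comp_apply, Function.comp_apply,
      contraction_zero_zero, contraction_affine, contraction_zero_zero, add_zero, pow_succ']

theorem contraction_two_zero_eq (hp₀ : 0 < p) : contraction p 2 0 = 1 - resistance p 0 := by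
  have h := contraction_two_one hp₀
  rw [contraction_affine, resistance_two] at h
  linarith

theorem discreteLaplacian_right (hp₀ : 0 < p) (hp₁ : p < 1 / 2) (n : ℕ) (f : ℝ → ℝ) :
    discreteLaplacian p n f 1 = f 1 - f (1 - resistance p 0 ^ n) := by
  induction n generalizing f with
  | zero => simp [discreteLaplacian_zero_right]
  | succ n ih =>
    rw [discreteLaplacian_succ_right hp₀ hp₁, ih, Function.comp_apply, Function.comp_apply,
      contraction_two_one hp₀, contraction_affine, contraction_two_zero_eq hp₀, resistance_two]
    congr 2
    ring

theorem resistance_le (hp₀ : 0 < p) (hp₁ : p < 1 / 2) (j : Fin 3) :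
    resistance p j ≤ resistance p 1 := by
  have h : resistance p 0 ≤ resistance p 1 := by
    simp only [resistance, Matrix.cons_val_one, Matrix.cons_val_zero]
    gcongr
    linarith
  fin_cases j
  · exact h
  · exact le_rfl
  · exact (resistance_two p).trans_le h

theorem resistance_lt_one (hp₀ : 0 < p) : resistance p 1 < 1 := by
  simp only [resistance, Matrix.cons_val_one, Matrix.cons_val_zero]
  rw [div_lt_one (by positivity)]
  linarith

theorem contraction_sub (p : ℝ) (j : Fin 3) (x y : ℝ) :
    contraction p j x - contraction p j y = resistance p j * (x - y) := by
  simp only [contraction]; ring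

theorem abs_cellMap_sub_le (hp₀ : 0 < p) (hp₁ : p < 1 / 2) {n : ℕ} (w : Fin n → Fin 3) (x y : ℝ) :
    |cellMap p w x - cellMap p w y| ≤ resistance p 1 ^ n * |x - y| := by
  induction n with
  | zero => simp [cellMap]
  | succ n ih =>
    have hr := resistance_pos hp₀ hp₁ (w 0)
    rw [cellMap, cellMap, contraction_sub, abs_mul, abs_of_pos hr, pow_succ', mul_assoc]
    exact mul_le_mul (resistance_le hp₀ hp₁ _) (ih _) (abs_nonneg _) (resistance_pos hp₀ hp₁ 1).le

/-- A continuous function that vanishes at all vertices is zero. -/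
theorem eq_zero_of_vertices (hp₀ : 0 < p) (hp₁ : p < 1 / 2) {d : ℝ → ℝ}
    (hd : ContinuousOn d (Set.Icc 0 1)) (h : ∀ n, ∀ x ∈ vertices p n, d x = 0) {x : ℝ}
    (hx : x ∈ Set.Icc (0 : ℝ) 1) : d x = 0 := by
  -- The point lies in a cell of each level `n`, of length at most `r_1ⁿ`; the left endpoints of
  -- these cells are vertices converging to it.
  choose w y hy hwy using fun n => exists_cellMap hp₀ hp₁ n hx
  have hlim : Tendsto (fun n => cellMap p (w n) 0) atTop (𝓝[Set.Icc 0 1] x) := by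
    refine tendsto_nhdsWithin_iff.2 ⟨?_, Eventually.of_forall fun n =>
      cellMap_mem_Icc hp₀ hp₁ _ (by simp)⟩
    rw [tendsto_iff_dist_tendsto_zero]
    refine squeeze_zero (fun _ => dist_nonneg) (fun n => ?_)
      (tendsto_pow_atTop_nhds_zero_of_lt_one (resistance_pos hp₀ hp₁ 1).le (resistance_lt_one hp₀))
    rw [Real.dist_eq]
    conv_lhs => rw [← hwy n]
    refine (abs_cellMap_sub_le hp₀ hp₁ (w n) 0 (y n)).trans (mul_le_of_le_one_right
      (pow_nonneg (resistance_pos hp₀ hp₁ 1).le n) ?_)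
    rw [zero_sub, abs_neg, abs_of_nonneg (hy n).1]
    exact (hy n).2
  have h1 := (hd x hx).tendsto.comp hlim
  refine tendsto_nhds_unique h1 ?_
  simp only [Function.comp_def, h _ _ (cellMap_zero_mem_vertices _)]
  exact tendsto_const_nhds

/-! ### The discrete Laplacian of the kernel `min x y` -/

/-- This is where `C₀` comes from: mass times length is the same for all three cells, so integrals
of rescaled tents shrink by one common factor per level. -/
theorem massWeight_mul_resistance (hp₀ : 0 < p) (hp₁ : p < 1 / 2) (j : Fin 3) :
    massWeight p j * resistance p j = (renorm p)⁻¹ := by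
  have h0 : p ≠ 0 := hp₀.ne'
  have hq : (1 - p) ≠ 0 := by linarith
  have h1 : (1 + p) ≠ 0 := by positivity
  have h2 : (1 + (1 - p)) ≠ 0 := by linarith
  have h3 : p * (1 - p) + 2 ≠ 0 := by nlinarith
  have e : renorm p = (p * (1 - p) + 2) / (p * (1 - p)) := by rw [renorm]; field_simp
  rw [e, inv_div]
  fin_cases j <;> simp [massWeight, resistance] <;> field_simp <;> ring

theorem contraction_le_of_lt (hp₀ : 0 < p) (hp₁ : p < 1 / 2) {i j : Fin 3} (hij : i < j) {x y : ℝ}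
    (hx : x ≤ 1) (hy : 0 ≤ y) : contraction p i x ≤ contraction p j y := by
  refine ((strictMono_contraction hp₀ hp₁ i).monotone hx).trans
    (le_trans ?_ ((strictMono_contraction hp₀ hp₁ j).monotone hy))
  have e1 := contraction_one_zero hp₀
  have e2 := contraction_two_zero hp₀
  have o := (contraction_order hp₀ hp₁).2.1
  fin_cases i <;> fin_cases j <;> simp_all
  linarith

/-- The Laplacian of `min (·) y`. -/
def minKernel (p : ℝ) (n : ℕ) (x y : ℝ) : ℝ := discreteLaplacian p n (fun t => min t y) x

theorem continuous_discreteLaplacian (p : ℝ) (n : ℕ) {G : ℝ → ℝ → ℝ} (hG : ∀ t, Continuous (G t))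
    (x : ℝ) : Continuous fun y => discreteLaplacian p n (fun t => G t y) x := by
  unfold discreteLaplacian
  refine Continuous.div_const (continuous_finsetSum _ fun w _ => continuous_const.mul ?_) _
  split_ifs <;> fun_prop

theorem continuous_minKernel (p : ℝ) (n : ℕ) (x : ℝ) : Continuous (minKernel p n x) :=
  continuous_discreteLaplacian p n (fun t => by fun_prop) x

section Restriction

variable {n : ℕ} {x y : ℝ}

theorem discreteLaplacian_min_same (hp₀ : 0 < p) (hp₁ : p < 1 / 2) (j : Fin 3) :
    discreteLaplacian p n ((fun t => min t (contraction p j y)) ∘ contraction p j) x =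
      resistance p j * minKernel p n x y := by
  have : (fun t => min t (contraction p j y)) ∘ contraction p j =
      fun t => resistance p j * min t y + contraction p j 0 := by
    funext t
    rw [Function.comp_apply, ← (strictMono_contraction hp₀ hp₁ j).monotone.map_min,
      contraction_affine]
  rw [this, discreteLaplacian_affine]
  rfl

theorem discreteLaplacian_min_of_lt (hp₀ : 0 < p) (hp₁ : p < 1 / 2) {i j : Fin 3} (hij : i < j)
    (hy : y ∈ Set.Icc (0 : ℝ) 1) (hx : x ∈ vertices p n) :
    discreteLaplacian p n ((fun t => min t (contraction p i y)) ∘ contraction p j) x = 0 := by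
  rw [discreteLaplacian_congr (g := fun _ => contraction p i y) (fun t ht => ?_) hx,
    discreteLaplacian_const]
  exact min_eq_right (contraction_le_of_lt hp₀ hp₁ hij hy.2 (vertices_subset_Icc hp₀ hp₁ n ht).1)

theorem discreteLaplacian_min_of_gt (hp₀ : 0 < p) (hp₁ : p < 1 / 2) {i j : Fin 3} (hij : j < i)
    (hy : y ∈ Set.Icc (0 : ℝ) 1) (hx : x ∈ vertices p n) :
    discreteLaplacian p n ((fun t => min t (contraction p i y)) ∘ contraction p j) x =
      resistance p j * discreteLaplacian p n (fun t => t) x := by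
  rw [discreteLaplacian_congr (g := fun t => resistance p j * t + contraction p j 0)
    (fun t ht => ?_) hx, discreteLaplacian_affine]
  rw [← contraction_affine]
  exact min_eq_left (contraction_le_of_lt hp₀ hp₁ hij (vertices_subset_Icc hp₀ hp₁ n ht).2 hy.1)

theorem minKernel_succ_same (hp₀ : 0 < p) (hp₁ : p < 1 / 2) (j : Fin 3)
    (hx : x ∈ Set.Ioo (0 : ℝ) 1) :
    minKernel p (n + 1) (contraction p j x) (contraction p j y) =
      resistance p j * minKernel p n x y := by
  rw [minKernel, discreteLaplacian_succ_interior hp₀ hp₁ _ _ _ hx,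
    discreteLaplacian_min_same hp₀ hp₁]

/-- Seen from inside another cell, `min (·) y` is constant or the identity, hence harmonic. -/
theorem minKernel_succ_of_ne (hp₀ : 0 < p) (hp₁ : p < 1 / 2) {i j : Fin 3} (hij : i ≠ j)
    (hx : x ∈ Set.Ioo (0 : ℝ) 1) (hx' : x ∈ vertices p n) (hy : y ∈ Set.Icc (0 : ℝ) 1) :
    minKernel p (n + 1) (contraction p j x) (contraction p i y) = 0 := by
  rw [minKernel, discreteLaplacian_succ_interior hp₀ hp₁ _ _ _ hx]
  rcases lt_or_gt_of_ne hij with h | h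
  · exact discreteLaplacian_min_of_lt hp₀ hp₁ h hy hx'
  · rw [discreteLaplacian_min_of_gt hp₀ hp₁ h hy hx', discreteLaplacian_id hp₀ hp₁ n hx' hx,
      mul_zero]

/-- The tent function on the last cell. -/
def rightTent (p : ℝ) (n : ℕ) (y : ℝ) : ℝ := y - min (1 - resistance p 0 ^ n) y

/-- The tent function on the first cell. -/
def leftTent (p : ℝ) (n : ℕ) (y : ℝ) : ℝ := resistance p 0 ^ n - min (resistance p 0 ^ n) y

theorem minKernel_right (hp₀ : 0 < p) (hp₁ : p < 1 / 2) (hy : y ∈ Set.Icc (0 : ℝ) 1) :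
    minKernel p n 1 y = rightTent p n y := by
  rw [minKernel, discreteLaplacian_right hp₀ hp₁, min_eq_right hy.2, rightTent]

theorem minKernel_left (hp₀ : 0 < p) (hp₁ : p < 1 / 2) (hy : y ∈ Set.Icc (0 : ℝ) 1) :
    minKernel p n 0 y = leftTent p n y - resistance p 0 ^ n := by
  rw [minKernel, discreteLaplacian_left hp₀ hp₁, min_eq_left hy.1, leftTent]; ring

theorem minKernel_junction_left (hp₀ : 0 < p) (hp₁ : p < 1 / 2) (hy : y ∈ Set.Icc (0 : ℝ) 1) :
    minKernel p (n + 1) (contraction p 0 1) (contraction p 0 y) =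
        (1 - p) * resistance p 0 * rightTent p n y ∧
      minKernel p (n + 1) (contraction p 0 1) (contraction p 1 y) =
        p * resistance p 1 * leftTent p n y ∧
      minKernel p (n + 1) (contraction p 0 1) (contraction p 2 y) = 0 := by
  have v0 := zero_mem_vertices p n
  have v1 := one_mem_vertices hp₀ n
  have hb := resistance_balance hp₀
  simp only [minKernel, discreteLaplacian_junction_left hp₀ hp₁]
  refine ⟨?_, ?_, ?_⟩
  · rw [discreteLaplacian_min_same hp₀ hp₁,
      discreteLaplacian_min_of_lt hp₀ hp₁ (by decide) hy v0, minKernel_right hp₀ hp₁ hy]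
    ring
  · rw [discreteLaplacian_min_same hp₀ hp₁, discreteLaplacian_min_of_gt hp₀ hp₁ (by decide) hy v1,
      minKernel_left hp₀ hp₁ hy, discreteLaplacian_id_right hp₀ hp₁]
    -- The linear part of `min (·) y` contributes `±r_0ⁿ` from the two sides of the junction, and
    -- these cancel by the balance of steps; only the tent remains.
    linear_combination resistance p 0 ^ n * hb
  · rw [discreteLaplacian_min_of_gt hp₀ hp₁ (by decide) hy v1,
      discreteLaplacian_min_of_gt hp₀ hp₁ (by decide) hy v0, discreteLaplacian_id_right hp₀ hp₁,
      discreteLaplacian_id_left hp₀ hp₁]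
    linear_combination resistance p 0 ^ n * hb

theorem minKernel_junction_right (hp₀ : 0 < p) (hp₁ : p < 1 / 2) (hy : y ∈ Set.Icc (0 : ℝ) 1) :
    minKernel p (n + 1) (contraction p 1 1) (contraction p 0 y) = 0 ∧
      minKernel p (n + 1) (contraction p 1 1) (contraction p 1 y) =
        p * resistance p 1 * rightTent p n y ∧
      minKernel p (n + 1) (contraction p 1 1) (contraction p 2 y) =
        (1 - p) * resistance p 2 * leftTent p n y := by
  have v0 := zero_mem_vertices p n
  have v1 := one_mem_vertices hp₀ n
  have hb := resistance_balance hp₀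
  simp only [minKernel, discreteLaplacian_junction_right hp₀ hp₁]
  refine ⟨?_, ?_, ?_⟩
  · rw [discreteLaplacian_min_of_lt hp₀ hp₁ (by decide) hy v1,
      discreteLaplacian_min_of_lt hp₀ hp₁ (by decide) hy v0]
    ring
  · rw [discreteLaplacian_min_same hp₀ hp₁,
      discreteLaplacian_min_of_lt hp₀ hp₁ (by decide) hy v0, minKernel_right hp₀ hp₁ hy]
    ring
  · rw [discreteLaplacian_min_same hp₀ hp₁, discreteLaplacian_min_of_gt hp₀ hp₁ (by decide) hy v1,
      minKernel_left hp₀ hp₁ hy, discreteLaplacian_id_right hp₀ hp₁, resistance_two]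
    linear_combination -resistance p 0 ^ n * hb

end Restriction

/-! ### Sign, support and total mass of the kernel -/

theorem rightTent_nonneg (p : ℝ) (n : ℕ) (y : ℝ) : 0 ≤ rightTent p n y :=
  sub_nonneg.2 (min_le_right _ _)

theorem leftTent_nonneg (p : ℝ) (n : ℕ) (y : ℝ) : 0 ≤ leftTent p n y :=
  sub_nonneg.2 (min_le_left _ _)

theorem rightTent_eq_zero {n : ℕ} {y : ℝ} (h : y ≤ 1 - resistance p 0 ^ n) :
    rightTent p n y = 0 := by
  rw [rightTent, min_eq_right h, sub_self]

theorem leftTent_eq_zero {n : ℕ} {y : ℝ} (h : resistance p 0 ^ n ≤ y) : leftTent p n y = 0 := by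
  rw [leftTent, min_eq_left h, sub_self]

theorem continuous_rightTent (p : ℝ) (n : ℕ) : Continuous (rightTent p n) := by
  unfold rightTent; fun_prop

theorem continuous_leftTent (p : ℝ) (n : ℕ) : Continuous (leftTent p n) := by
  unfold leftTent; fun_prop

theorem resistance_pow_succ_le (hp₀ : 0 < p) (hp₁ : p < 1 / 2) (n : ℕ) :
    resistance p 0 ^ (n + 1) ≤ resistance p 0 := by
  have := resistance_pos hp₀ hp₁ 0
  exact pow_le_of_le_one this.le ((resistance_le hp₀ hp₁ 0).trans (resistance_lt_one hp₀).le)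
    (Nat.succ_ne_zero n)

/-- On `[0, 1]` the tent of level `n + 1` lives in the last cell and is there `r_2` times the tent
of level `n`, so each level costs `m_2 r_2 = 1/C₀`. At level zero the integral is the mean `1/2` of
`μ`. -/
theorem integral_rightTent (hp₀ : 0 < p) (hp₁ : p < 1 / 2) (hμ : IsSelfSimilarMeasure p μ)
    (n : ℕ) : ∫ y, rightTent p n y ∂μ = (renorm p)⁻¹ ^ n / 2 := by
  induction n with
  | zero =>
    rw [hμ.integral_congr (ψ := fun y => y) fun y hy => by simp [rightTent, hy.1],
      hμ.integral_id hp₀ hp₁]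
    norm_num
  | succ n ih =>
    have hr := resistance_pow_succ_le hp₀ hp₁ n
    have hlow : ∀ j, j < 2 → ∫ y, rightTent p (n + 1) (contraction p j y) ∂μ = 0 := fun j hj => by
      rw [hμ.integral_congr (ψ := fun _ => 0) fun y hy => ?_, integral_zero]
      refine rightTent_eq_zero ?_
      have := contraction_le_of_lt hp₀ hp₁ hj hy.2 (le_refl (0 : ℝ))
      rw [contraction_two_zero_eq hp₀] at this
      linarith
    have hhigh : ∫ y, rightTent p (n + 1) (contraction p 2 y) ∂μ =
        resistance p 2 * ∫ y, rightTent p n y ∂μ := by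
      rw [← integral_const_mul]
      refine integral_congr_ae (Eventually.of_forall fun y => ?_)
      have : 1 - resistance p 0 ^ (n + 1) = contraction p 2 (1 - resistance p 0 ^ n) := by
        rw [contraction_affine, contraction_two_zero_eq hp₀, resistance_two]; ring
      simp only [rightTent]
      rw [this, ← (strictMono_contraction hp₀ hp₁ 2).monotone.map_min, contraction_sub]
    rw [hμ.integral_eq_sum hp₀ hp₁ (continuous_rightTent p _), Fin.sum_univ_three,
      hlow 0 (by decide), hlow 1 (by decide), hhigh, ih, ← mul_assoc,
      massWeight_mul_resistance hp₀ hp₁]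
    ring

theorem integral_leftTent (hp₀ : 0 < p) (hp₁ : p < 1 / 2) (hμ : IsSelfSimilarMeasure p μ)
    (n : ℕ) : ∫ y, leftTent p n y ∂μ = (renorm p)⁻¹ ^ n / 2 := by
  induction n with
  | zero =>
    rw [hμ.integral_congr (ψ := fun y => (-1) * y + 1) fun y hy => by
      simp [leftTent, hy.2]; ring, hμ.integral_affine, hμ.integral_id hp₀ hp₁]
    norm_num
  | succ n ih =>
    have hr := resistance_pow_succ_le hp₀ hp₁ n
    have hhigh : ∀ j, 0 < j → ∫ y, leftTent p (n + 1) (contraction p j y) ∂μ = 0 := fun j hj => by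
      rw [hμ.integral_congr (ψ := fun _ => 0) fun y hy => ?_, integral_zero]
      refine leftTent_eq_zero ?_
      have := contraction_le_of_lt hp₀ hp₁ hj (le_refl (1 : ℝ)) hy.1
      rw [contraction_affine, contraction_zero_zero] at this
      linarith
    have hlow : ∫ y, leftTent p (n + 1) (contraction p 0 y) ∂μ =
        resistance p 0 * ∫ y, leftTent p n y ∂μ := by
      rw [← integral_const_mul]
      refine integral_congr_ae (Eventually.of_forall fun y => ?_)
      have : resistance p 0 ^ (n + 1) = contraction p 0 (resistance p 0 ^ n) := by
        rw [contraction_affine, contraction_zero_zero]; ring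
      simp only [leftTent]
      rw [this, ← (strictMono_contraction hp₀ hp₁ 0).monotone.map_min, contraction_sub]
    rw [hμ.integral_eq_sum hp₀ hp₁ (continuous_leftTent p _), Fin.sum_univ_three,
      hhigh 1 (by decide), hhigh 2 (by decide), hlow, ih, ← mul_assoc,
      massWeight_mul_resistance hp₀ hp₁]
    ring

theorem minKernel_nonneg (hp₀ : 0 < p) (hp₁ : p < 1 / 2) {n : ℕ} {x y : ℝ}
    (hx : x ∈ vertices p n) (hx' : x ∈ Set.Ioo (0 : ℝ) 1) (hy : y ∈ Set.Icc (0 : ℝ) 1) :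
    0 ≤ minKernel p n x y := by
  induction n generalizing x y with
  | zero => rcases hx with rfl | rfl <;> simp at hx'
  | succ n ih =>
    have hq : 0 ≤ 1 - p := by linarith
    have hr := fun j => (resistance_pos hp₀ hp₁ j).le
    obtain ⟨i, y, hz, rfl⟩ := exists_contraction hp₀ hp₁ hy
    have hL := leftTent_nonneg p n y
    have hR := rightTent_nonneg p n y
    rcases vertices_succ_cases hp₀ hp₁ hx with rfl | rfl | rfl | rfl | ⟨j, x, hv, hv', rfl⟩
    · simp at hx'
    · simp at hx'
    · obtain ⟨h0, h1, h2⟩ := minKernel_junction_left (n := n) hp₀ hp₁ hz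
      match i with
      | 0 => exact h0 ▸ mul_nonneg (mul_nonneg hq (hr _)) hR
      | 1 => exact h1 ▸ mul_nonneg (mul_nonneg hp₀.le (hr _)) hL
      | 2 => exact h2.ge
    · obtain ⟨h0, h1, h2⟩ := minKernel_junction_right (n := n) hp₀ hp₁ hz
      match i with
      | 0 => exact h0.ge
      | 1 => exact h1 ▸ mul_nonneg (mul_nonneg hp₀.le (hr _)) hR
      | 2 => exact h2 ▸ mul_nonneg (mul_nonneg hq (hr _)) hL
    · by_cases hij : i = j
      · subst hij
        rw [minKernel_succ_same hp₀ hp₁ _ hv']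
        exact mul_nonneg (hr _) (ih hv hv' hz)
      · exact (minKernel_succ_of_ne hp₀ hp₁ hij hv' hv hz).ge

theorem minKernel_eq_zero (hp₀ : 0 < p) (hp₁ : p < 1 / 2) {n : ℕ} {x y : ℝ}
    (hx : x ∈ vertices p n) (hx' : x ∈ Set.Ioo (0 : ℝ) 1) (hy : y ∈ Set.Icc (0 : ℝ) 1)
    (hxy : resistance p 1 ^ n < |x - y|) : minKernel p n x y = 0 := by
  induction n generalizing x y with
  | zero => rcases hx with rfl | rfl <;> simp at hx'
  | succ n ih =>
    have hr := fun j => resistance_pos hp₀ hp₁ j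
    -- The middle ratio `r_1` is the largest, so `r_1ⁿ` also bounds the supports of the end tents,
    -- which have width `r_0ⁿ`.
    have hrn : resistance p 0 ^ n ≤ resistance p 1 ^ n :=
      pow_le_pow_left₀ (hr 0).le (resistance_le hp₀ hp₁ 0) n
    have hscale : ∀ {i x y}, resistance p 1 ^ (n + 1) < |contraction p i x - contraction p i y| →
        resistance p 1 ^ n < |x - y| := fun {i x y} h => by
      rw [contraction_sub, abs_mul, abs_of_pos (hr i), pow_succ'] at h
      by_contra! h'
      exact absurd h (not_lt.2 (mul_le_mul (resistance_le hp₀ hp₁ i) h' (abs_nonneg _) (hr 1).le))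
    obtain ⟨i, y, hz, rfl⟩ := exists_contraction hp₀ hp₁ hy
    have hL : resistance p 1 ^ n < |0 - y| → leftTent p n y = 0 := fun h => by
      rw [zero_sub, abs_neg, abs_of_nonneg hz.1] at h
      exact leftTent_eq_zero (hrn.trans h.le)
    have hR : resistance p 1 ^ n < |1 - y| → rightTent p n y = 0 := fun h => by
      rw [abs_of_nonneg (sub_nonneg.2 hz.2)] at h
      exact rightTent_eq_zero (by linarith)
    rcases vertices_succ_cases hp₀ hp₁ hx with rfl | rfl | rfl | rfl | ⟨j, x, hv, hv', rfl⟩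
    · simp at hx'
    · simp at hx'
    · obtain ⟨h0, h1, h2⟩ := minKernel_junction_left (n := n) hp₀ hp₁ hz
      match i with
      | 0 => rw [h0, hR (hscale hxy), mul_zero]
      | 1 => rw [h1, hL (hscale (contraction_one_zero hp₀ ▸ hxy)), mul_zero]
      | 2 => exact h2
    · obtain ⟨h0, h1, h2⟩ := minKernel_junction_right (n := n) hp₀ hp₁ hz
      match i with
      | 0 => exact h0
      | 1 => rw [h1, hR (hscale hxy), mul_zero]
      | 2 => rw [h2, hL (hscale (contraction_two_zero hp₀ ▸ hxy)), mul_zero]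
    · by_cases hij : i = j
      · subst hij
        rw [minKernel_succ_same hp₀ hp₁ _ hv', ih hv hv' hz (hscale hxy), mul_zero]
      · exact minKernel_succ_of_ne hp₀ hp₁ hij hv' hv hz

/-- With nonnegativity and small support, this makes `2 C₀ⁿ minKernel p n x` an approximate identity
for `μ`. At a junction the two half tents carry weights `q m_0 r_0 + p m_1 r_1 = (q + p)/C₀`, so the
total mass is the same at every vertex. -/
theorem integral_minKernel (hp₀ : 0 < p) (hp₁ : p < 1 / 2) (hμ : IsSelfSimilarMeasure p μ) {n : ℕ}
    {x : ℝ} (hx : x ∈ vertices p n) (hx' : x ∈ Set.Ioo (0 : ℝ) 1) :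
    ∫ y, minKernel p n x y ∂μ = (renorm p)⁻¹ ^ n / 2 := by
  induction n generalizing x with
  | zero => rcases hx with rfl | rfl <;> simp at hx'
  | succ n ih =>
    have hm := fun j => massWeight_mul_resistance hp₀ hp₁ j
    rw [hμ.integral_eq_sum hp₀ hp₁ (continuous_minKernel p _ _)]
    rcases vertices_succ_cases hp₀ hp₁ hx with rfl | rfl | rfl | rfl | ⟨j, x, hv, hv', rfl⟩
    · simp at hx'
    · simp at hx'
    · have h := fun y hy => minKernel_junction_left (n := n) (y := y) hp₀ hp₁ hy
      rw [Fin.sum_univ_three, hμ.integral_congr fun y hy => (h y hy).1,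
        hμ.integral_congr fun y hy => (h y hy).2.1, hμ.integral_congr fun y hy => (h y hy).2.2,
        integral_const_mul, integral_const_mul, integral_zero, integral_rightTent hp₀ hp₁ hμ,
        integral_leftTent hp₀ hp₁ hμ]
      linear_combination ((renorm p)⁻¹ ^ n / 2) * ((1 - p) * hm 0 + p * hm 1)
    · have h := fun y hy => minKernel_junction_right (n := n) (y := y) hp₀ hp₁ hy
      rw [Fin.sum_univ_three, hμ.integral_congr fun y hy => (h y hy).1,
        hμ.integral_congr fun y hy => (h y hy).2.1, hμ.integral_congr fun y hy => (h y hy).2.2,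
        integral_const_mul, integral_const_mul, integral_zero, integral_rightTent hp₀ hp₁ hμ,
        integral_leftTent hp₀ hp₁ hμ]
      linear_combination ((renorm p)⁻¹ ^ n / 2) * ((1 - p) * hm 2 + p * hm 1)
    · rw [Finset.sum_eq_single_of_mem j (Finset.mem_univ j) fun i _ hij => ?_]
      · simp only [minKernel_succ_same hp₀ hp₁ j hv']
        rw [integral_const_mul, ih hv hv', ← mul_assoc, hm]
        ring
      · rw [hμ.integral_congr (ψ := fun _ => 0) fun y hy =>
          minKernel_succ_of_ne hp₀ hp₁ hij hv' hv hy, integral_zero, mul_zero]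

/-! ### The Green's function -/

theorem discreteLaplacian_integral (p : ℝ) (n : ℕ) {G : ℝ → ℝ → ℝ}
    (hG : ∀ t, Integrable (G t) μ) (x : ℝ) :
    discreteLaplacian p n (fun t => ∫ y, G t y ∂μ) x =
      ∫ y, discreteLaplacian p n (fun t => G t y) x ∂μ := by
  have hint : ∀ s t (P : Prop) [Decidable P],
      Integrable (fun y => if P then G s y - G t y else 0) μ := fun s t P _ => by
    split_ifs
    · exact (hG s).sub (hG t)
    · exact integrable_zero _ _ _
  have hite : ∀ s t (P : Prop) [Decidable P],
      ∫ y, (if P then G s y - G t y else 0) ∂μ =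
        if P then ∫ y, G s y ∂μ - ∫ y, G t y ∂μ else 0 := fun s t P _ => by
    split_ifs
    · exact integral_sub (hG s) (hG t)
    · exact integral_zero _ _
  unfold discreteLaplacian
  rw [integral_div, integral_finsetSum]
  · congr 1
    refine Finset.sum_congr rfl fun w _ => ?_
    rw [integral_const_mul, integral_add (hint _ _ _) (hint _ _ _), hite, hite]
  · exact fun w _ => ((hint _ _ _).add (hint _ _ _)).const_mul _

/-- The Green's function `2 (min x y - x y)`. -/
def greenKernel (x y : ℝ) : ℝ := 2 * (min x y - x * y)

theorem continuous_uncurry_greenKernel : Continuous (Function.uncurry greenKernel) := by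
  unfold greenKernel Function.uncurry; fun_prop

theorem greenKernel_nonneg {x y : ℝ} (hx : x ∈ Set.Icc (0 : ℝ) 1) (hy : y ∈ Set.Icc (0 : ℝ) 1) :
    0 ≤ greenKernel x y := by
  unfold greenKernel
  rcases le_total x y with h | h
  · rw [min_eq_left h]; nlinarith [hx.1, hy.2]
  · rw [min_eq_right h]; nlinarith [hy.1, hx.2]

/-- The term `x y` only enforces the boundary values: it is affine in `x`, so its Laplacian vanishes
at interior vertices. -/
theorem discreteLaplacian_greenKernel (hp₀ : 0 < p) (hp₁ : p < 1 / 2) {n : ℕ} {x : ℝ}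
    (hx : x ∈ vertices p n) (hx' : x ∈ Set.Ioo (0 : ℝ) 1) (y c : ℝ) :
    discreteLaplacian p n (fun t => greenKernel t y * c) x = 2 * minKernel p n x y * c := by
  have : (fun t => greenKernel t y * c) = fun t => (2 * c) * min t y + (-2 * y * c) * t := by
    funext t; unfold greenKernel; ring
  rw [this, discreteLaplacian_linear, discreteLaplacian_id hp₀ hp₁ n hx hx', minKernel]
  ring

/-- The potential of `u`. -/
def greenPotential (μ : Measure ℝ) (u : ℝ → ℝ) (x : ℝ) : ℝ :=
  ∫ y in Set.Icc (0 : ℝ) 1, greenKernel x y * u y ∂μ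

theorem continuous_greenKernel_mul {u : ℝ → ℝ} (hu : Continuous u) (x : ℝ) :
    Continuous fun y => greenKernel x y * u y := by
  unfold greenKernel; fun_prop

theorem discreteLaplacian_greenPotential (hp₀ : 0 < p) (hp₁ : p < 1 / 2)
    (hμ : IsSelfSimilarMeasure p μ) {u : ℝ → ℝ} (hu : Continuous u) {n : ℕ} {x : ℝ}
    (hx : x ∈ vertices p n) (hx' : x ∈ Set.Ioo (0 : ℝ) 1) :
    discreteLaplacian p n (greenPotential μ u) x = ∫ y, 2 * minKernel p n x y * u y ∂μ := by
  have : greenPotential μ u = fun t => ∫ y, greenKernel t y * u y ∂μ := by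
    funext t; rw [greenPotential, hμ.restrict_eq]
  rw [this, discreteLaplacian_integral p n fun t =>
    hμ.integrable (continuous_greenKernel_mul hu t)]
  simp only [discreteLaplacian_greenKernel hp₀ hp₁ hx hx']

theorem renorm_pow_mul_integral_minKernel (hp₀ : 0 < p) (hp₁ : p < 1 / 2)
    (hμ : IsSelfSimilarMeasure p μ) {n : ℕ} {x : ℝ} (hx : x ∈ vertices p n)
    (hx' : x ∈ Set.Ioo (0 : ℝ) 1) (c : ℝ) :
    ∫ y, renorm p ^ n * (2 * minKernel p n x y * c) ∂μ = c := by
  have hC := pow_ne_zero n (renorm_pos hp₀ hp₁).ne'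
  rw [integral_const_mul, integral_mul_const, integral_const_mul,
    integral_minKernel hp₀ hp₁ hμ hx hx', inv_pow]
  field_simp

theorem HasLaplacian.congr (hp₀ : 0 < p) (hp₁ : p < 1 / 2) {f g u v : ℝ → ℝ}
    (h : HasLaplacian p f u) (hfg : ∀ x ∈ Set.Icc (0 : ℝ) 1, f x = g x)
    (huv : ∀ x ∈ Set.Icc (0 : ℝ) 1, u x = v x) : HasLaplacian p g v := by
  obtain ⟨hf, hu, hl⟩ := h
  refine ⟨hf.congr fun x hx => (hfg x hx).symm, hu.congr fun x hx => (huv x hx).symm,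
    fun ε hε => ?_⟩
  filter_upwards [hl ε hε] with n hn x hx
  have hI := vertices_subset_Icc hp₀ hp₁ n
  rw [← discreteLaplacian_congr (fun y hy => hfg y (hI hy)) hx.1, ← huv x (hI hx.1)]
  exact hn x hx

theorem continuous_greenPotential (hμ : IsSelfSimilarMeasure p μ) {u : ℝ → ℝ}
    (hu : Continuous u) : Continuous (greenPotential μ u) := by
  have := hμ.1
  refine continuous_parametric_integral_of_continuous (f := fun x y => greenKernel x y * u y) ?_
    isCompact_Icc
  exact continuous_uncurry_greenKernel.mul (hu.comp continuous_snd)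

/-- At an interior vertex `x`, `C₀ⁿ Δ_n` of the potential is the average of `u` against a
probability density supported within `r_1ⁿ` of `x`. Uniform continuity of `u` makes the convergence
uniform. -/
theorem hasLaplacian_greenPotential (hp₀ : 0 < p) (hp₁ : p < 1 / 2)
    (hμ : IsSelfSimilarMeasure p μ) {u : ℝ → ℝ} (hu : Continuous u) :
    HasLaplacian p (greenPotential μ u) u := by
  have := hμ.1
  refine ⟨(continuous_greenPotential hμ hu).continuousOn, hu.continuousOn, fun ε hε => ?_⟩
  obtain ⟨δ, hδ, hunif⟩ := Metric.uniformContinuousOn_iff.1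
    (isCompact_Icc.uniformContinuousOn_of_continuous hu.continuousOn) (ε / 2) (half_pos hε)
  have hC := fun n => pow_nonneg (renorm_pos hp₀ hp₁).le n
  filter_upwards [(tendsto_pow_atTop_nhds_zero_of_lt_one (resistance_pos hp₀ hp₁ 1).le
    (resistance_lt_one hp₀)).eventually_lt_const hδ] with n hn x hx
  obtain ⟨hx, hx'⟩ := (mem_interior_iff hp₀ hp₁).1 hx
  have hxI := vertices_subset_Icc hp₀ hp₁ n hx
  have hK := continuous_minKernel p n x
  have hcont : ∀ v : ℝ → ℝ, Continuous v →
      Integrable (fun y => renorm p ^ n * (2 * minKernel p n x y * v y)) μ := fun v hv =>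
    hμ.integrable (by fun_prop)
  have key : renorm p ^ n * discreteLaplacian p n (greenPotential μ u) x - u x =
      ∫ y, renorm p ^ n * (2 * minKernel p n x y * (u y - u x)) ∂μ := by
    rw [discreteLaplacian_greenPotential hp₀ hp₁ hμ hu hx hx', ← integral_const_mul]
    conv_lhs => rw [← renorm_pow_mul_integral_minKernel hp₀ hp₁ hμ hx hx' (u x)]
    rw [← integral_sub (hcont u hu) (hcont (fun _ => _) continuous_const)]
    refine integral_congr_ae (Eventually.of_forall fun y => ?_)
    ring
  have hbound : |∫ y, renorm p ^ n * (2 * minKernel p n x y * (u y - u x)) ∂μ| ≤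
      ∫ y, renorm p ^ n * (2 * minKernel p n x y * (ε / 2)) ∂μ := by
    rw [← Real.norm_eq_abs]
    refine norm_integral_le_of_norm_le (hcont (fun _ => ε / 2) continuous_const) ?_
    have hae : ∀ᵐ y ∂μ, y ∈ Set.Icc (0 : ℝ) 1 := mem_ae_iff.2 hμ.2.1
    filter_upwards [hae] with y hy
    have hK := minKernel_nonneg hp₀ hp₁ hx hx' hy
    rw [Real.norm_eq_abs, abs_mul, abs_mul, abs_of_nonneg (hC n),
      abs_of_nonneg (mul_nonneg zero_le_two hK)]
    refine mul_le_mul_of_nonneg_left ?_ (hC n)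
    -- Far from `x` the kernel vanishes; near `x` the oscillation of `u` is below `ε / 2`.
    by_cases hd : resistance p 1 ^ n < |x - y|
    · rw [minKernel_eq_zero hp₀ hp₁ hx hx' hy hd]; simp
    · refine mul_le_mul_of_nonneg_left ?_ (mul_nonneg zero_le_two hK)
      have h1 := hunif y hy x hxI (by
        rw [dist_comm, Real.dist_eq]; exact (not_lt.1 hd).trans_lt hn)
      rw [Real.dist_eq] at h1
      exact h1.le
  rw [key]
  rw [renorm_pow_mul_integral_minKernel hp₀ hp₁ hμ hx hx'] at hbound
  linarith

/-- Uniqueness for the Dirichlet problem. -/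
theorem eq_zero_of_hasLaplacian_zero (hp₀ : 0 < p) (hp₁ : p < 1 / 2)
    (hμ : IsSelfSimilarMeasure p μ) {d : ℝ → ℝ} (hd : HasLaplacian p d fun _ => 0)
    (h0 : d 0 = 0) (h1 : d 1 = 0) {x : ℝ} (hx : x ∈ Set.Icc (0 : ℝ) 1) : d x = 0 := by
  refine eq_zero_of_vertices hp₀ hp₁ hd.1 (fun n x hx => ?_) hx
  -- The barrier: `C₀ᵐ Δ_m v = 1` holds exactly at every interior vertex and every level, and `v`
  -- vanishes at both ends.
  set v := greenPotential μ fun _ => 1 with hv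
  have hv0 : v 0 = 0 := by
    simp only [hv, greenPotential, hμ.restrict_eq]
    rw [hμ.integral_congr (ψ := fun _ => 0) fun y hy => by simp [greenKernel, hy.1], integral_zero]
  have hv1 : v 1 = 0 := by
    simp only [hv, greenPotential, hμ.restrict_eq]
    rw [hμ.integral_congr (ψ := fun _ => 0) fun y hy => by simp [greenKernel, hy.2], integral_zero]
  have hC := fun n => pow_pos (renorm_pos hp₀ hp₁) n
  have hvl : ∀ {m y}, y ∈ vertices p m → y ∈ Set.Ioo (0 : ℝ) 1 →
      renorm p ^ m * discreteLaplacian p m v y = 1 := fun hy hy' => by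
    rw [discreteLaplacian_greenPotential hp₀ hp₁ hμ continuous_const hy hy',
      ← integral_const_mul, renorm_pow_mul_integral_minKernel hp₀ hp₁ hμ hy hy']
  -- At a fine enough level `|C₀ᵐ Δ_m d| < ε`, so `ε v + d` and `ε v - d` both have strictly
  -- positive Laplacian and the minimum principle applies to them.
  have key : ∀ ε > 0, |d x| ≤ ε * v x := fun ε hε => by
    obtain ⟨m, hm, hnm⟩ := ((hd.2.2 ε hε).and (eventually_ge_atTop n)).exists
    have hxm := vertices_mono hp₀ hnm hx
    have hsign : ∀ s : ℝ, |s| = 1 → 0 ≤ ε * v x + s * d x := fun s hs => by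
      refine nonneg_of_discreteLaplacian_pos hp₀ hp₁ (e := fun y => ε * v y + s * d y)
        (by simp [hv0, h0]) (by simp [hv1, h1]) (fun y hy => ?_) hxm
      have hlt := hm y hy
      obtain ⟨hy, hy'⟩ := (mem_interior_iff hp₀ hp₁).1 hy
      rw [discreteLaplacian_linear]
      refine pos_of_mul_pos_right (a := renorm p ^ m) ?_ (hC m).le
      have h2 : renorm p ^ m * (ε * discreteLaplacian p m v y + s * discreteLaplacian p m d y) =
          ε + s * (renorm p ^ m * discreteLaplacian p m d y) := by
        linear_combination ε * hvl hy hy'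
      rw [h2]
      rw [sub_zero] at hlt
      have h3 : |s * (renorm p ^ m * discreteLaplacian p m d y)| < ε := by
        rwa [abs_mul, hs, one_mul]
      linarith [(abs_lt.1 h3).1]
    have h1 := hsign 1 (by simp)
    have h2 := hsign (-1) (by simp)
    rw [abs_le]
    constructor <;> linarith
  have hlim : Tendsto (fun ε : ℝ => ε * v x) (𝓝[>] 0) (𝓝 0) := by
    have : Tendsto (fun ε : ℝ => ε * v x) (𝓝 0) (𝓝 (0 * v x)) :=
      (continuous_id.mul continuous_const).tendsto 0
    rw [zero_mul] at this
    exact this.mono_left nhdsWithin_le_nhds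
  have := ge_of_tendsto hlim (eventually_mem_nhdsWithin.mono fun ε hε => key ε hε)
  exact abs_eq_zero.1 (le_antisymm this (abs_nonneg _))

theorem HasLaplacian.sub {f g u v : ℝ → ℝ} (hf : HasLaplacian p f u) (hg : HasLaplacian p g v) :
    HasLaplacian p (fun x => f x - g x) fun x => u x - v x := by
  refine ⟨hf.1.sub hg.1, hf.2.1.sub hg.2.1, fun ε hε => ?_⟩
  filter_upwards [hf.2.2 (ε / 2) (half_pos hε), hg.2.2 (ε / 2) (half_pos hε)] with n h1 h2 x hx
  have e : discreteLaplacian p n (fun x => f x - g x) x =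
      discreteLaplacian p n f x - discreteLaplacian p n g x := by
    have := discreteLaplacian_linear p n 1 (-1) f g x
    simp only [one_mul, neg_one_mul, ← sub_eq_add_neg] at this
    exact this
  have h1 := abs_lt.1 (h1 x hx)
  have h2 := abs_lt.1 (h2 x hx)
  rw [e, mul_sub, abs_lt]
  constructor <;> linarith [h1.1, h1.2, h2.1, h2.2]

theorem isGreenFunction_greenKernel (hp₀ : 0 < p) (hp₁ : p < 1 / 2)
    (hμ : IsSelfSimilarMeasure p μ) : IsGreenFunction p μ greenKernel := by
  refine ⟨continuous_uncurry_greenKernel.continuousOn, fun x hx y hy => greenKernel_nonneg hx hy,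
    fun u hu f => ?_⟩
  -- Since `u` is continuous only on `[0, 1]`, it is replaced by its constant continuation beyond
  -- the ends; neither the integrals nor the Laplacian statement see the change.
  set u' : ℝ → ℝ := fun x => u (max 0 (min x 1)) with hu'
  have hu'c : Continuous u' := hu.comp_continuous (by fun_prop) fun x =>
    ⟨le_max_left _ _, max_le zero_le_one (min_le_right _ _)⟩
  have huu' : ∀ x ∈ Set.Icc (0 : ℝ) 1, u' x = u x := fun x hx => by
    simp only [hu']; rw [min_eq_left hx.2, max_eq_right hx.1]
  have hpot : ∀ x, ∫ y in Set.Icc (0 : ℝ) 1, greenKernel x y * u y ∂μ = greenPotential μ u' x :=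
    fun x => setIntegral_congr_fun measurableSet_Icc fun y hy => by simp only [huu' y hy]
  have hL := hasLaplacian_greenPotential hp₀ hp₁ hμ hu'c
  have hp0 : greenPotential μ u' 0 = 0 := by
    simp only [greenPotential, hμ.restrict_eq]
    rw [hμ.integral_congr (ψ := fun _ => 0) fun y hy => by simp [greenKernel, hy.1], integral_zero]
  have hp1 : greenPotential μ u' 1 = 0 := by
    simp only [greenPotential, hμ.restrict_eq]
    rw [hμ.integral_congr (ψ := fun _ => 0) fun y hy => by simp [greenKernel, hy.2], integral_zero]
  simp only [hpot]
  constructor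
  · rintro ⟨hf, h0, h1⟩ x hx
    have hd := (hf.sub hL).congr hp₀ hp₁ (fun x _ => rfl) (v := fun _ => 0)
      (fun x hx => by rw [huu' x hx, sub_self])
    exact sub_eq_zero.1 (eq_zero_of_hasLaplacian_zero hp₀ hp₁ hμ hd (by simp [h0, hp0])
      (by simp [h1, hp1]) hx)
  · intro h
    exact ⟨hL.congr hp₀ hp₁ (fun x hx => (h x hx).symm) huu', by rw [h 0 (by simp), hp0],
      by rw [h 1 (by simp), hp1]⟩

/-- A solution of the Dirichlet problem is bounded by the supremum of any Green's function. -/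
theorem IsGreenFunction.abs_le (hμ : IsSelfSimilarMeasure p μ) {g : ℝ → ℝ → ℝ}
    (hg : IsGreenFunction p μ g) {f u : ℝ → ℝ} (hf : HasLaplacian p f u) (h0 : f 0 = 0)
    (h1 : f 1 = 0) {M : ℝ} (hM : ∀ x ∈ Set.Icc (0 : ℝ) 1, |u x| ≤ M) {x : ℝ}
    (hx : x ∈ Set.Icc (0 : ℝ) 1) : |f x| ≤ greenSup g * M := by
  have := hμ.1
  rw [(hg.2.2 u hf.2.1 f).1 ⟨hf, h0, h1⟩ x hx]
  have hbdd : BddAbove (Function.uncurry g '' (Set.Icc 0 1 ×ˢ Set.Icc 0 1)) :=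
    (isCompact_Icc.prod isCompact_Icc).bddAbove_image hg.1
  have hle : ∀ y ∈ Set.Icc (0 : ℝ) 1, g x y ≤ greenSup g := fun y hy =>
    le_csSup hbdd ⟨(x, y), ⟨hx, hy⟩, rfl⟩
  have hb : ‖∫ y in Set.Icc (0 : ℝ) 1, g x y * u y ∂μ‖ ≤
      (greenSup g * M) * μ.real (Set.Icc 0 1) := by
    refine norm_setIntegral_le_of_norm_le_const (measure_lt_top μ _) fun y hy => ?_
    rw [Real.norm_eq_abs, abs_mul, abs_of_nonneg (hg.2.1 x hx y hy)]
    exact mul_le_mul (hle y hy) (hM y hy) (abs_nonneg _) ((hg.2.1 x hx y hy).trans (hle y hy))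
  have h1 : μ.real (Set.Icc 0 1) = 1 := by
    rw [measureReal_def, (prob_compl_eq_zero_iff measurableSet_Icc).1 hμ.2.1]; simp
  rwa [h1, mul_one] at hb

/-! ### Convergence of the eigenfunctions -/

theorem abs_le_supNormOn_vertices (p : ℝ) (n : ℕ) (f : ℝ → ℝ) {x : ℝ} (hx : x ∈ vertices p n) :
    |f x| ≤ supNormOn (vertices p n) f :=
  le_csSup ((finite_vertices p n).image _).bddAbove ⟨x, hx, rfl⟩

theorem abs_interpolation_le (hp₀ : 0 < p) (hp₁ : p < 1 / 2) {n : ℕ} {f : ℝ → ℝ} {M : ℝ}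
    (hM : ∀ x ∈ vertices p n, |f x| ≤ M) {x : ℝ} (hx : x ∈ Set.Icc (0 : ℝ) 1) :
    |interpolation p n f x| ≤ M := by
  obtain ⟨w, y, hy, rfl⟩ := exists_cellMap hp₀ hp₁ n hx
  rw [interpolation_cellMap_eq hp₀ hp₁ w f hy]
  have h0 := abs_le.1 (hM _ (cellMap_zero_mem_vertices w))
  have h1 := abs_le.1 (hM _ (cellMap_one_mem_vertices w))
  rw [abs_le]
  constructor <;> nlinarith [hy.1, hy.2]

theorem eigenvalue_add_le (hp₀ : 0 < p) (hp₁ : p < 1 / 2) {n k : ℕ} (hk : k ≤ 3 ^ n) (m : ℕ) :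
    eigenvalue p (m + n) k ≤ (p / 2) ^ m * 2 := by
  induction m with
  | zero => simpa using (eigenvalue_mem_Icc hp₀ hp₁ hk).2
  | succ m ih =>
    have h := eigenvalue_succ_le hp₀ hp₁ (le_three_pow_of_le hk (Nat.le_add_left n m))
    rw [Nat.add_right_comm]
    refine h.trans ?_
    rw [pow_succ', mul_assoc]
    gcongr

namespace IsEigenfunctionSequence

variable {k n₀ : ℕ} {f : ℕ → ℝ → ℝ}

/-- All `f_{m,k}` are bounded by one constant `B`, and an extension step moves the interpolant by at
most `z B/(1-2p)` with `z = λ_{m+1,k}`, which decays like `(p/2)^m`. -/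
theorem exists_tendstoUniformlyOn (hp₀ : 0 < p) (hp₁ : p < 1 / 2) (hk : k ≤ 3 ^ n₀)
    (hf : IsEigenfunctionSequence p k n₀ f) :
    ∃ F : ℝ → ℝ, TendstoUniformlyOn (fun n => interpolation p n (f n)) F atTop (Set.Icc 0 1) := by
  obtain ⟨B, hB⟩ : ∃ B, ∀ m, n₀ ≤ m → ∀ x ∈ vertices p m, |f m x| ≤ B :=
    ⟨_, fun m hm x hx => hf.abs_le hp₀ hp₁ hk le_rfl
      (fun y hy => abs_le_supNormOn_vertices p n₀ (f n₀) hy) hm hx⟩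
  have hB0 : 0 ≤ B := (abs_nonneg _).trans (hB n₀ le_rfl 0 (zero_mem_vertices p n₀))
  have h2p : 0 < 1 - 2 * p := by linarith
  obtain ⟨F, hF⟩ := exists_tendstoUniformlyOn_of_le_geometric
    (F := fun m => interpolation p (m + n₀) (f (m + n₀))) (s := Set.Icc 0 1) (r := p / 2)
    (C := 2 / (1 - 2 * p) * B) (by linarith) (by linarith) fun m x hx => by
      have hn : n₀ ≤ m + n₀ := Nat.le_add_left _ _
      have hz := (eigenvalue_succ hp₀ hp₁ (le_three_pow_of_le hk hn)).1
      have h1 := (hf.isDecimated hp₀ hn).abs_interpolation_sub_le hp₀ hp₁ hz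
        (hf.extends_prev _ hn) (hB _ hn) hx
      have h2 := eigenvalue_succ_le hp₀ hp₁ (le_three_pow_of_le hk hn)
      have h3 := eigenvalue_add_le hp₀ hp₁ hk m
      have h4 := (eigenvalue_mem_Icc hp₀ hp₁ (le_three_pow_of_le hk hn)).1
      rw [Nat.add_right_comm m 1 n₀]
      refine h1.trans ?_
      have h5 : eigenvalue p (m + n₀ + 1) k ≤ (p / 2) ^ m * 2 := by nlinarith
      calc eigenvalue p (m + n₀ + 1) k / (1 - 2 * p) * B
          ≤ ((p / 2) ^ m * 2) / (1 - 2 * p) * B := by gcongr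
        _ = 2 / (1 - 2 * p) * B * (p / 2) ^ m := by ring
  refine ⟨F, Metric.tendstoUniformlyOn_iff.2 fun ε hε => ?_⟩
  obtain ⟨N, hN⟩ := eventually_atTop.1 (Metric.tendstoUniformlyOn_iff.1 hF ε hε)
  filter_upwards [eventually_ge_atTop (N + n₀)] with n hn x hx
  have := hN (n - n₀) (by omega) x hx
  rwa [Nat.sub_add_cancel (by omega)] at this

section Limit

variable {F : ℝ → ℝ}

theorem limit_eq (hp₀ : 0 < p) (hp₁ : p < 1 / 2) (hf : IsEigenfunctionSequence p k n₀ f)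
    (hF : TendstoUniformlyOn (fun n => interpolation p n (f n)) F atTop (Set.Icc 0 1)) {n : ℕ}
    (hn : n₀ ≤ n) {x : ℝ} (hx : x ∈ vertices p n) : F x = f n x := by
  refine tendsto_nhds_unique (hF.tendsto_at (vertices_subset_Icc hp₀ hp₁ n hx))
    (tendsto_const_nhds.congr' ?_)
  filter_upwards [eventually_ge_atTop n] with m hm
  rw [interpolation_of_mem hp₀ hp₁ _ (vertices_mono hp₀ hm hx), hf.eq_of_le hp₀ hn hm hx]

theorem abs_limit_le (hp₀ : 0 < p) (hp₁ : p < 1 / 2) (hk : k ≤ 3 ^ n₀)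
    (hf : IsEigenfunctionSequence p k n₀ f)
    (hF : TendstoUniformlyOn (fun n => interpolation p n (f n)) F atTop (Set.Icc 0 1)) {n : ℕ}
    (hn : n₀ ≤ n) {x : ℝ} (hx : x ∈ Set.Icc (0 : ℝ) 1) :
    |F x| ≤ supNormOn (vertices p n) (f n) *
      Real.exp (eigenvalue p n k / ((1 - p) - eigenvalue p (n + 1) k) * (p / (2 - p))) := by
  refine le_of_tendsto (hF.tendsto_at hx).abs ?_
  filter_upwards [eventually_ge_atTop n] with m hm
  exact abs_interpolation_le hp₀ hp₁ (fun y hy => hf.abs_le hp₀ hp₁ hk hn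
    (fun y hy => abs_le_supNormOn_vertices p n (f n) hy) hm hy) hx

/-- In a cell the error of the harmonic extension solves a Dirichlet problem. -/
theorem hasLaplacian_cell (hp₀ : 0 < p) (hp₁ : p < 1 / 2) (hk : k ≤ 3 ^ n₀)
    (hf : IsEigenfunctionSequence p k n₀ f)
    (hF : TendstoUniformlyOn (fun n => interpolation p n (f n)) F atTop (Set.Icc 0 1))
    (hFc : ContinuousOn F (Set.Icc 0 1)) {lam : ℝ}
    (hlam : Tendsto (fun n => renorm p ^ n * eigenvalue p n k) atTop (𝓝 lam)) {n : ℕ}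
    (hn : n₀ ≤ n) (w : Fin n → Fin 3) :
    HasLaplacian p (fun y => F (cellMap p w y) - interpolation p n (f n) (cellMap p w y))
      (fun y => (renorm p ^ n)⁻¹ * lam * F (cellMap p w y)) := by
  have hmaps : Set.MapsTo (cellMap p w) (Set.Icc 0 1) (Set.Icc 0 1) := fun y hy =>
    cellMap_mem_Icc hp₀ hp₁ w hy
  have hFw : ContinuousOn (fun y => F (cellMap p w y)) (Set.Icc 0 1) :=
    hFc.comp (continuous_cellMap p w).continuousOn hmaps
  refine ⟨hFw.sub ((continuous_interpolation hp₀ hp₁ n (f n)).comp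
    (continuous_cellMap p w)).continuousOn, continuousOn_const.mul hFw, fun ε hε => ?_⟩
  obtain ⟨B, hB⟩ : ∃ B, ∀ x ∈ Set.Icc (0 : ℝ) 1, |F x| ≤ B :=
    ⟨_, fun x hx => hf.abs_limit_le hp₀ hp₁ hk hF hn hx⟩
  have hC := pow_ne_zero n (renorm_pos hp₀ hp₁).ne'
  -- The shift in level produces the factor `C₀⁻ⁿ`: `C₀ᵐ λ_{m+n,k} = C₀⁻ⁿ (C₀^(m+n) λ_{m+n,k})`.
  have ht : Tendsto (fun m => |renorm p ^ m * eigenvalue p (m + n) k -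
      (renorm p ^ n)⁻¹ * lam| * B) atTop (𝓝 0) := by
    have h1 : Tendsto (fun m => (renorm p ^ n)⁻¹ *
        (renorm p ^ (m + n) * eigenvalue p (m + n) k)) atTop (𝓝 ((renorm p ^ n)⁻¹ * lam)) :=
      ((tendsto_add_atTop_iff_nat n).2 hlam).const_mul _
    have h2 := ((h1.sub_const ((renorm p ^ n)⁻¹ * lam)).abs).mul_const B
    rw [sub_self, abs_zero, zero_mul] at h2
    refine h2.congr fun m => ?_
    rw [pow_add]
    field_simp
  filter_upwards [ht.eventually_lt_const hε] with m hm x hx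
  obtain ⟨hx, hx'⟩ := (mem_interior_iff hp₀ hp₁).1 hx
  have hmn : n₀ ≤ m + n := hn.trans (Nat.le_add_left _ _)
  -- On `V_{m+n}` the limit agrees with `f_{m+n,k}`, an eigenfunction, and interior vertices of the
  -- cell see only the cell.
  have e1 : discreteLaplacian p m (fun y => F (cellMap p w y)) x =
      eigenvalue p (m + n) k * F (cellMap p w x) := by
    have hxw := cellMap_mem_vertices w hx
    have h1 := discreteLaplacian_cellMap hp₀ hp₁ w m F hx'
    rw [discreteLaplacian_congr (fun y hy => hf.limit_eq hp₀ hp₁ hF hmn hy) hxw,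
      (hf.isEigenfunction hp₀ hp₁ hk hmn).2 _ hxw, ← hf.limit_eq hp₀ hp₁ hF hmn hxw] at h1
    exact h1.symm
  have e2 : discreteLaplacian p m (fun y => F (cellMap p w y) -
      interpolation p n (f n) (cellMap p w y)) x = eigenvalue p (m + n) k * F (cellMap p w x) := by
    -- Inside the cell the interpolation is affine, so it drops out of the Laplacian.
    rw [discreteLaplacian_congr (g := fun y => 1 * F (cellMap p w y) + (-1) *
      ((f n (cellMap p w 1) - f n (cellMap p w 0)) * y + f n (cellMap p w 0))) (fun y hy => ?_) hx,
      discreteLaplacian_linear, discreteLaplacian_affine, discreteLaplacian_id hp₀ hp₁ m hx hx', e1]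
    · ring
    · rw [interpolation_cellMap_eq hp₀ hp₁ w _ (vertices_subset_Icc hp₀ hp₁ m hy)]; ring
  have e3 : renorm p ^ m * (eigenvalue p (m + n) k * F (cellMap p w x)) -
      (renorm p ^ n)⁻¹ * lam * F (cellMap p w x) =
      (renorm p ^ m * eigenvalue p (m + n) k - (renorm p ^ n)⁻¹ * lam) * F (cellMap p w x) := by
    ring
  rw [e2, e3, abs_mul]
  exact (mul_le_mul_of_nonneg_left (hB _ (hmaps ⟨hx'.1.le, hx'.2.le⟩)) (abs_nonneg _)).trans_lt hm

end Limit

end IsEigenfunctionSequence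

end FractalInterval

end

/-! ### The error estimate -/

theorem theorem4p4 (p : ℝ) (hp₀ : 0 < p) (hp₁ : p < 1 / 2) :
    (∃ μ : Measure ℝ, FractalInterval.IsSelfSimilarMeasure p μ) ∧
    ∀ μ : Measure ℝ, FractalInterval.IsSelfSimilarMeasure p μ →
      (∃ g : ℝ → ℝ → ℝ, FractalInterval.IsGreenFunction p μ g) ∧
      ∀ g : ℝ → ℝ → ℝ, FractalInterval.IsGreenFunction p μ g →
        ∀ k n₀ : ℕ, k ≤ 3 ^ n₀ →
          ∀ f : ℕ → ℝ → ℝ, FractalInterval.IsEigenfunctionSequence p k n₀ f →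
            ∃ (lam : ℝ) (h : ℕ → ℝ → ℝ) (fk : ℝ → ℝ),
              Tendsto (fun n => FractalInterval.renorm p ^ n * FractalInterval.eigenvalue p n k)
                atTop (𝓝 lam) ∧
              (∀ n, n₀ ≤ n → FractalInterval.IsHarmonicExtension p n (f n) (h n)) ∧
              ContinuousOn fk (Set.Icc 0 1) ∧
              TendstoUniformlyOn h fk atTop (Set.Icc 0 1) ∧
              ∀ n, n₀ ≤ n →
                FractalInterval.supNormOn (Set.Icc 0 1) (fun x => fk x - h n x) ≤
                  (FractalInterval.renorm p ^ n)⁻¹ * lam *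
                    FractalInterval.supNormOn (FractalInterval.vertices p n) (f n) *
                    FractalInterval.greenSup g *
                    Real.exp (FractalInterval.eigenvalue p n k /
                      ((1 - p) - FractalInterval.eigenvalue p (n + 1) k) * (p / (2 - p))) := by
  open FractalInterval in
  refine ⟨exists_isSelfSimilarMeasure hp₀ hp₁, fun μ hμ =>
    ⟨⟨_, isGreenFunction_greenKernel hp₀ hp₁ hμ⟩, fun g hg k n₀ hk f hf => ?_⟩⟩
  obtain ⟨lam, hlam0, hlam⟩ :=
    FractalInterval.exists_tendsto_renorm_pow_mul_eigenvalue hp₀ hp₁ hk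
  obtain ⟨F, hF⟩ := hf.exists_tendstoUniformlyOn hp₀ hp₁ hk
  have hFc : ContinuousOn F (Set.Icc 0 1) := hF.continuousOn (Frequently.of_forall fun n =>
    (FractalInterval.continuous_interpolation hp₀ hp₁ n (f n)).continuousOn)
  refine ⟨lam, _, F, hlam, fun n _ =>
    FractalInterval.isHarmonicExtension_interpolation hp₀ hp₁ n (f n), hFc, hF, fun n hn => ?_⟩
  refine csSup_le (Set.Nonempty.image _ ⟨0, by simp⟩) ?_
  rintro _ ⟨x, hx, rfl⟩
  obtain ⟨w, y, hy, rfl⟩ := FractalInterval.exists_cellMap hp₀ hp₁ n hx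
  have hC : 0 ≤ (FractalInterval.renorm p ^ n)⁻¹ * lam :=
    mul_nonneg (inv_nonneg.2 (pow_nonneg (FractalInterval.renorm_pos hp₀ hp₁).le n)) hlam0
  have hv : ∀ x ∈ FractalInterval.vertices p n,
      F x - FractalInterval.interpolation p n (f n) x = 0 := fun x hx => by
    rw [hf.limit_eq hp₀ hp₁ hF hn hx, FractalInterval.interpolation_of_mem hp₀ hp₁ _ hx, sub_self]
  -- The error vanishes at both ends of the cell, so its pullback to `[0, 1]` solves a Dirichlet
  -- problem with right-hand side `C₀⁻ⁿ λ_k F ∘ F_w`. The bound uses only the defining property of a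
  -- Green's function, hence holds for any given `g`.
  have hb := hg.abs_le hμ (hf.hasLaplacian_cell hp₀ hp₁ hk hF hFc hlam hn w)
    (hv _ (FractalInterval.cellMap_zero_mem_vertices w))
    (hv _ (FractalInterval.cellMap_one_mem_vertices w))
    (M := (FractalInterval.renorm p ^ n)⁻¹ * lam *
      (FractalInterval.supNormOn (FractalInterval.vertices p n) (f n) *
      Real.exp (FractalInterval.eigenvalue p n k /
        ((1 - p) - FractalInterval.eigenvalue p (n + 1) k) * (p / (2 - p)))))
    (fun t ht => by
      rw [abs_mul, abs_of_nonneg hC]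
      exact mul_le_mul_of_nonneg_left (hf.abs_limit_le hp₀ hp₁ hk hF hn
        (FractalInterval.cellMap_mem_Icc hp₀ hp₁ w ht)) hC) hy
  refine hb.trans (le_of_eq ?_)
  ring
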